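/- Write $e(x)=e^{2\pi i x}$. Let $\tau$ be in the upper half plane, $q^r=e(r\tau)$, $\zeta^r=e(rz)$, $\zeta_j^r=e(rz_j)$, and let $\left(\frac{a}{n}\right)$ be the Kronecker symbol. Let $\eta$ be the Dedekind eta function and put $$\theta(z;\tau)=q^{1/8}(\zeta^{1/2}-\zeta^{-1/2})\prod_{n\ge1}(1-q^n)(1-\zeta q^n)(1-\zeta^{-1}q^n),\qquad \theta_2(z;\tau)=-i\,\theta(z+\tfrac12;\tau),\qquad \theta_4(z;\tau)=-\zeta^{1/2}q^{1/8}\theta(z+\tfrac{\tau}{2};\tau),$$ $$\theta^*(z;\tau)=\frac{\eta(\tau)\,\theta(2z;\tau)}{\theta(z;\tau)},\qquad \theta_2^*(z;\tau)=-i\,\theta^*(z+\tfrac12;\tau),$$ where $\theta^*$ is extended by continuity to the zeros of $\theta(z;\tau)$. For $z\in\mathbb C$ write $z=z_1+iz_2=\frac{z_3+\sqrt{-3}\,z_4}{2}$ with $z_j\in\mathbb R$, and define $$\begin{aligned}\phi_{26}(z;\tau)=\;&\frac12\sum_{n_1,n_2\in\mathbb Z}(-1)^{\frac{n_1+n_2-1}{2}}\left(\frac{4}{n_1(n_2+1)}\right)\left(\frac{n_1}{3}\right)\zeta_3^{\frac{n_1}{12}}\zeta_4^{\frac{n_2}{4}}q^{\frac{n_1^2+3n_2^2}{12}}\\&+\frac14\sum_{n_1\equiv\pm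 n_2\,(8)}\left(\frac{12}{n_1}\right)\zeta_3^{\frac{n_1}{24}}\zeta_4^{\frac{n_2}{8}}q^{\frac{n_1^2+3n_2^2}{48}}\\&-\frac12\sum_{(n_1,n_2)\equiv(\pm1,0)\,(3)}(-1)^{n_2}\left(\frac{4}{n_1+n_2}\right)\zeta_1^{\frac{n_1}{6}}\zeta_2^{\frac{n_2}{6}}q^{\frac{n_1^2+n_2^2}{12}}\\&+\frac12\sum_{(n_1,n_2)\equiv(0,\pm1)\,(3)}(-1)^{n_2}\left(\frac{4}{n_1+n_2}\right)\zeta_1^{\frac{n_1}{6}}\zeta_2^{\frac{n_2}{6}}q^{\frac{n_1^2+n_2^2}{12}}.\end{aligned}$$ Then the four series converge absolutely, and for all such $z$ and $\tau$ $$\begin{aligned}\phi_{26}(z;\tau)=\;&\frac12\theta^*\!\left(\frac{z_3}{6};2\tau\right)\theta_4\!\left(\frac{z_4}{2};2\tau\right)+\frac18\theta^*\!\left(\frac{z_3}{12};\frac\tau2\right)\theta_2\!\left(\frac{z_4}{4};\frac\tau2\right)\\&+\frac1{16}\left[\theta^*\!\left(\frac{z_3}{12}+\frac14;\frac\tau2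\right)\theta_2\!\left(\frac{z_4}{4}-\frac14;\frac\tau2\right)+\theta_2^*\!\left(\frac{z_3}{12}+\frac14;\frac\tau2\right)\theta\!\left(\frac{z_4}{4}-\frac14;\frac\tau2\right)\right]\\&+\frac1{16}\left[\theta^*\!\left(\frac{z_3}{12}+\frac14;\frac\tau2\right)\theta_2\!\left(\frac{z_4}{4}+\frac14;\frac\tau2\right)-\theta_2^*\!\left(\frac{z_3}{12}+\frac14;\frac\tau2\right)\theta\!\left(\frac{z_4}{4}+\frac14;\frac\tau2\right)\right]\\&-\frac12\theta^*\!\left(\frac{z_1+z_2}{6};\tau\right)\theta^*\!\left(\frac{z_1-z_2}{6};\tau\right).\end{aligned}$$ Moreover, $\phi_{26}(\cdot;\tau)$ is a smooth function on $\mathbb C=\mathbb R^2$, and with $D_z=\frac1{2\pi i}\frac{\partial}{\partial z}$, where $\frac{\partial}{\partial z}=\frac12\left(\frac{\partial}{\partial z_1}-i\frac{\partial}{\partial z_2}\right)$, $$D_z^{12}\left[\phi_{26}(z;\tau)\right]_{z=0}=\frac{2^8\cdot3^4\cdot11^2\cdot13}{12^{12}}\,\eta(\tau)^{26}.$$ 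-/

import Mathlib

open Filter
open scoped Topology ContDiff

noncomputable section

namespace EtaTwentySix

/-- `e(x) = exp(2πix)`.  Throughout, `q ^ r` means `e (r τ)` and `ζ_j ^ r` means `e (r z_j)`. -/
def e (x : ℂ) : ℂ := Complex.exp (2 * Real.pi * Complex.I * x)

/-- The Kronecker symbol `(a / n)` for arbitrary integers `a`, `n`: the completely multiplicative
extension in `n` of the Jacobi symbol with `(a / -1) = -1` exactly when `a < 0`,
`(a / 2) = χ₈(a)` and `(a / 0) = 1` exactly when `a = ±1` (and `0` otherwise). -/
def kroneckerSym (a n : ℤ) : ℤ :=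
  if n = 0 then (if a.natAbs = 1 then 1 else 0)
  else (if n < 0 ∧ a < 0 then -1 else 1) * (ZMod.χ₈ (a : ZMod 8)) ^ padicValNat 2 n.natAbs *
    jacobiSym a (n.natAbs / 2 ^ padicValNat 2 n.natAbs)

/-- The Jacobi theta function
`θ(z; τ) = q^{1/8} (ζ^{1/2} - ζ^{-1/2}) ∏_{n ≥ 1} (1 - q^n)(1 - ζ q^n)(1 - ζ⁻¹ q^n)`. -/
def theta (z τ : ℂ) : ℂ :=
  e (τ / 8) * (e (z / 2) - e (-z / 2)) *
    ∏' n : ℕ, ((1 - e ((n + 1) * τ)) * (1 - e (z + (n + 1) * τ)) * (1 - e (-z + (n + 1) * τ)))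

/-- `θ₂(z; τ) = -i θ(z + 1/2; τ)`. -/
def theta2 (z τ : ℂ) : ℂ := -Complex.I * theta (z + 1 / 2) τ

/-- `θ₄(z; τ) = -ζ^{1/2} q^{1/8} θ(z + τ/2; τ)`. -/
def theta4 (z τ : ℂ) : ℂ := -e (z / 2) * e (τ / 8) * theta (z + τ / 2) τ

/-- `θ*(z; τ) = η(τ) θ(2z; τ) / θ(z; τ)`, as an entire function of `z`: the zeros of the
denominator are removable singularities, and the value there is the limit. -/
def thetaStar (z τ : ℂ) : ℂ :=
  limUnder (𝓝[≠] z) fun w : ℂ => ModularForm.eta τ * theta (2 * w) τ / theta w τ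

/-- `θ₂*(z; τ) = -i θ*(z + 1/2; τ)`. -/
def theta2Star (z τ : ℂ) : ℂ := -Complex.I * thetaStar (z + 1 / 2) τ

/-- The terms of the first sum, in the coordinates `z = (z₃ + √-3 z₄) / 2`.  They vanish unless `n₁`
is odd and `n₂` is even, so the integer division in the exponent of `-1` is exact when it matters. -/
def term1 (z₃ z₄ : ℝ) (τ : ℂ) (n : ℤ × ℤ) : ℂ :=
  (-1) ^ ((n.1 + n.2 - 1) / 2) * (kroneckerSym 4 (n.1 * (n.2 + 1)) : ℂ) * (kroneckerSym n.1 3 : ℂ) *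
    e (n.1 / 12 * z₃) * e (n.2 / 4 * z₄) * e ((n.1 ^ 2 + 3 * n.2 ^ 2) / 12 * τ)

/-- The terms of the second sum (zero outside the range `n₁ ≡ ± n₂ mod 8`), in the coordinates
`z = (z₃ + √-3 z₄) / 2`. -/
def term2 (z₃ z₄ : ℝ) (τ : ℂ) (n : ℤ × ℤ) : ℂ :=
  if n.1 ≡ n.2 [ZMOD 8] ∨ n.1 ≡ -n.2 [ZMOD 8] then
    (kroneckerSym 12 n.1 : ℂ) *
      e (n.1 / 24 * z₃) * e (n.2 / 8 * z₄) * e ((n.1 ^ 2 + 3 * n.2 ^ 2) / 48 * τ)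
  else 0

/-- The terms of the third sum (zero outside the range `(n₁, n₂) ≡ (±1, 0) mod 3`), in the
coordinates `z = z₁ + i z₂`. -/
def term3 (z₁ z₂ : ℝ) (τ : ℂ) (n : ℤ × ℤ) : ℂ :=
  if (n.1 ≡ 1 [ZMOD 3] ∨ n.1 ≡ -1 [ZMOD 3]) ∧ n.2 ≡ 0 [ZMOD 3] then
    (-1) ^ n.2 * (kroneckerSym 4 (n.1 + n.2) : ℂ) *
      e (n.1 / 6 * z₁) * e (n.2 / 6 * z₂) * e ((n.1 ^ 2 + n.2 ^ 2) / 12 * τ)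
  else 0

/-- The terms of the fourth sum (zero outside the range `(n₁, n₂) ≡ (0, ±1) mod 3`), in the
coordinates `z = z₁ + i z₂`. -/
def term4 (z₁ z₂ : ℝ) (τ : ℂ) (n : ℤ × ℤ) : ℂ :=
  if n.1 ≡ 0 [ZMOD 3] ∧ (n.2 ≡ 1 [ZMOD 3] ∨ n.2 ≡ -1 [ZMOD 3]) then
    (-1) ^ n.2 * (kroneckerSym 4 (n.1 + n.2) : ℂ) *
      e (n.1 / 6 * z₁) * e (n.2 / 6 * z₂) * e ((n.1 ^ 2 + n.2 ^ 2) / 12 * τ)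
  else 0

/-- The function `φ₂₆(z; τ)`, where `z = z₁ + i z₂ = (z₃ + √-3 z₄) / 2` with real `z_j`, that is
`z₁ = Re z`, `z₂ = Im z`, `z₃ = 2 Re z`, `z₄ = 2 Im z / √3`. -/
def phi26 (z τ : ℂ) : ℂ :=
  1 / 2 * ∑' n : ℤ × ℤ, term1 (2 * z.re) (2 * z.im / √3) τ n
    + 1 / 4 * ∑' n : ℤ × ℤ, term2 (2 * z.re) (2 * z.im / √3) τ n
    - 1 / 2 * ∑' n : ℤ × ℤ, term3 z.re z.im τ n
    + 1 / 2 * ∑' n : ℤ × ℤ, term4 z.re z.im τ n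

/-- The operator `D_z = (1 / 2πi) ∂/∂z` on functions of `z = x + iy` that need not be holomorphic,
with the Wirtinger derivative `∂/∂z = (∂/∂x - i ∂/∂y) / 2`. -/
def Dz (f : ℂ → ℂ) (z : ℂ) : ℂ :=
  1 / (2 * Real.pi * Complex.I) * ((fderiv ℝ f z 1 - Complex.I * fderiv ℝ f z Complex.I) / 2)

end EtaTwentySix

end

/-! ### Additive characters and Kronecker symbols -/

namespace EtaTwentySix

/-! Everything is reduced to one-variable theta series `thetaSeries c x w`, that is `∑ c(n) e(n x +
n² w)`, with `c` a bounded periodic integer function. The Jacobi triple product (`triple_product`)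
puts `θ`, `θ₂`, `θ₄` in this form, with `c` equal to `chi4`, `oddInd`, `altEven`. The quintuple
product identity (`theta_mul_thetaSeries`) puts `θ*` in this form with `c = chi12`. The theta
expression of `φ₂₆` is then a comparison of coefficients of double series (`tsum_coeff1`,
`tsum_coeff2`, `tsum_coeff3`): the shifts by `1/4` insert eighth roots of unity that select `n₁ ≡ ±
n₂` mod 8, and the third minus the fourth sum is a product of two series in the coordinates `n₁ +
n₂`, `n₁ - n₂`.

For the derivative, each exponential in `Re z` and `Im z` is written as `e(α z + β z̄)`, so that
`D_z` multiplies it by `α`. Twelve derivatives at the origin give lattice sums weighted by `(n - i√3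
m)¹²` or `(n - i m)¹²`. These linear forms are isotropic for the dual quadratic form, that is, the
weights are harmonic. Along such a complex line the exponential factors in the inversion formulas of
the theta series cancel, so the inversion formulas can be differentiated and yield weight 13 laws
under `τ ↦ -1/τ`.

Inversion does not preserve the coefficients of the first sum. However, multiplication by a cube
root of unity preserves both the norm and the twelfth power on the hexagonal lattice, so only the
coefficients summed over its orbits matter. A finite check modulo 24 shows that the dual
coefficients and those of the second sum then agree with twice those of the first
(`latticeSum_eq_of_hexRot`). The derivative thus becomes `etaPowerSum`, up to `12¹²`, and it obeys
the same laws as `η²⁶` under both generators of the modular group.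

In `etaPowerSum` the coefficient of `q^(1/12)` is `2 - 4/2 = 0`, and that of `q^(13/12)` is
`18795164 + 27645128/2 = 2⁸ 3⁴ 11² 13`. Since `η²⁶` starts with `q^(13/12)` and has no zeros, the
quotient is a level one modular form of weight zero, hence the constant found at the cusp. -/

lemma e_add (x y : ℂ) : e (x + y) = e x * e y := by
  simp only [e, mul_add, Complex.exp_add]

lemma e_zero : e 0 = 1 := by simp [e]

lemma e_ne_zero (x : ℂ) : e x ≠ 0 := Complex.exp_ne_zero _

lemma e_neg (x : ℂ) : e (-x) = (e x)⁻¹ := by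
  rw [e, e, ← Complex.exp_neg]; ring_nf

lemma e_sub (x y : ℂ) : e (x - y) = e x * (e y)⁻¹ := by
  rw [sub_eq_add_neg, e_add, e_neg]

lemma e_nat_mul (n : ℕ) (x : ℂ) : e (n * x) = e x ^ n := by
  rw [e, e, ← Complex.exp_nat_mul]; ring_nf

lemma e_int_mul (n : ℤ) (x : ℂ) : e (n * x) = e x ^ n := by
  rw [e, e, ← Complex.exp_int_mul]; ring_nf

lemma e_one : e 1 = 1 := by simp [e]

lemma e_int (n : ℤ) : e n = 1 := by
  rw [← mul_one (n : ℂ), e_int_mul, e_one, one_zpow]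

lemma e_half : e (1 / 2) = -1 := by
  rw [e, ← Complex.exp_pi_mul_I]; ring_nf

lemma e_quarter : e (1 / 4) = Complex.I := by
  rw [e, show 2 * Real.pi * Complex.I * (1 / 4) = (Real.pi / 2 : ℂ) * Complex.I by ring,
    Complex.exp_pi_div_two_mul_I]

lemma e_add_int (x : ℂ) (n : ℤ) : e (x + n) = e x := by rw [e_add, e_int, mul_one]

lemma e_int_div_two (n : ℤ) : e (n / 2) = (-1) ^ n := by
  rw [← e_half, ← e_int_mul]; ring_nf

lemma norm_e (x : ℂ) : ‖e x‖ = Real.exp (-(2 * Real.pi * x.im)) := by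
  rw [e, Complex.norm_exp]; congr 1; simp [Complex.mul_re]

lemma norm_e_lt_one {τ : ℂ} (h : 0 < τ.im) : ‖e τ‖ < 1 := by
  rw [norm_e, Real.exp_lt_one_iff]; have := Real.pi_pos; simp only [neg_lt_zero]; positivity

lemma norm_e_le (x : ℂ) : ‖e x‖ ≤ Real.exp (2 * Real.pi * ‖x‖) := by
  rw [norm_e, Real.exp_le_exp]
  have h := (abs_le.1 (Complex.abs_im_le_norm x)).1
  nlinarith [Real.pi_pos]

lemma differentiable_e : Differentiable ℂ e := by
  unfold e; fun_prop

/-- The Kronecker symbol `(-4 / n)`. -/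
def chi4 (n : ℤ) : ℤ := if n % 4 = 1 then 1 else if n % 4 = 3 then -1 else 0

/-- The Kronecker symbol `(12 / n)`. -/
def chi12 (n : ℤ) : ℤ :=
  if n % 12 = 1 ∨ n % 12 = 11 then 1 else if n % 12 = 5 ∨ n % 12 = 7 then -1 else 0

lemma abs_chi4_le (n : ℤ) : |chi4 n| ≤ 1 := by unfold chi4; split_ifs <;> simp

lemma abs_chi12_le (n : ℤ) : |chi12 n| ≤ 1 := by unfold chi12; split_ifs <;> simp

lemma chi12_neg (n : ℤ) : chi12 (-n) = chi12 n := by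
  unfold chi12; grind

lemma kroneckerSym_three (n : ℤ) :
    kroneckerSym n 3 = if n % 3 = 1 then 1 else if n % 3 = 2 then -1 else 0 := by
  have h2 : padicValNat 2 3 = 0 := padicValNat.eq_zero_of_not_dvd (by norm_num)
  have : kroneckerSym n 3 = jacobiSym n 3 := by
    simp [kroneckerSym, h2]
  rw [this, jacobiSym.mod_left]
  have h : n % 3 = 0 ∨ n % 3 = 1 ∨ n % 3 = 2 := by lia
  rcases h with h | h | h <;> simp only [Nat.cast_ofNat, h] <;> norm_num

/-- For even `n ≠ 0` a positive power of `χ₈(4) = 0` occurs; for `n = 0` the symbol vanishes because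
`|a| ≠ 1`. -/
lemma kroneckerSym_of_even {a n : ℤ} (ha : (a : ZMod 8) = 4) (hn : n % 2 = 0) (ha' : a.natAbs ≠ 1) :
    kroneckerSym a n = 0 := by
  by_cases h0 : n = 0
  · simp [kroneckerSym, h0, ha']
  · rw [kroneckerSym, if_neg h0, ha, show ZMod.χ₈ (4 : ZMod 8) = 0 by decide, zero_pow]
    · simp
    · have := one_le_padicValNat_of_dvd (p := 2) (n := n.natAbs) (by lia) (by lia)
      lia

lemma kroneckerSym_of_odd {a n : ℤ} (ha : 0 ≤ a) (hn : n % 2 = 1) :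
    kroneckerSym a n = jacobiSym a n.natAbs := by
  have h2 : padicValNat 2 n.natAbs = 0 := padicValNat.eq_zero_of_not_dvd (by lia)
  have h0 : n ≠ 0 := by rintro rfl; simp at hn
  simp [kroneckerSym, h2, h0, ha.not_gt]

lemma kroneckerSym_four (n : ℤ) : kroneckerSym 4 n = if n % 2 = 1 then 1 else 0 := by
  split_ifs with h
  · rw [kroneckerSym_of_odd (by norm_num) h, show (4 : ℤ) = 2 ^ 2 by norm_num, jacobiSym.pow_left,
      ← jacobiSym.pow_left, jacobiSym.sq_one']
    rw [Int.gcd_eq_natAbs]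
    have : Nat.Coprime 2 n.natAbs := by
      rw [Nat.coprime_two_left, Nat.odd_iff]; lia
    exact_mod_cast this
  · exact kroneckerSym_of_even (by decide) (by lia) (by norm_num)

lemma kroneckerSym_twelve (n : ℤ) : kroneckerSym 12 n = chi12 n := by
  by_cases h : n % 2 = 1
  · rw [kroneckerSym_of_odd (by norm_num) h]
    have hodd : Odd n.natAbs := by rw [Nat.odd_iff]; lia
    have h4 : jacobiSym 4 n.natAbs = 1 := by
      have := kroneckerSym_four n
      rwa [if_pos h, kroneckerSym_of_odd (by norm_num) h] at this
    rw [show (12 : ℤ) = 4 * 3 by norm_num, jacobiSym.mul_left, h4, one_mul, jacobiSym.mod_right _ hodd]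
    have h' : n.natAbs % 12 = 1 ∨ n.natAbs % 12 = 3 ∨ n.natAbs % 12 = 5 ∨ n.natAbs % 12 = 7 ∨
      n.natAbs % 12 = 9 ∨ n.natAbs % 12 = 11 := by lia
    norm_num
    rcases h' with h' | h' | h' | h' | h' | h' <;> rw [h'] <;> norm_num <;> unfold chi12 <;>
      grind
  · rw [kroneckerSym_of_even (by decide) (by lia) (by norm_num)]
    unfold chi12; grind

/-- This is the arithmetic content of the quintuple product identity. Both sides have period 12 in
each variable, which leaves 144 cases. -/
lemma chi4_mul_chi12 (n d : ℤ) :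
    chi4 n * chi12 (n + 2 * d) + chi4 d * chi12 (2 * n + d) = chi4 (n + d) * chi12 (n - d) := by
  have key : ∀ a ∈ Finset.range 12, ∀ b ∈ Finset.range 12,
      chi4 a * chi12 (a + 2 * b) + chi4 b * chi12 (2 * a + b) = chi4 (a + b) * chi12 (a - b) := by
    decide
  have h4 : ∀ m k : ℤ, m % 12 = k % 12 → chi4 m = chi4 k := by
    intro m k h; unfold chi4; grind
  have h12 : ∀ m k : ℤ, m % 12 = k % 12 → chi12 m = chi12 k := by
    intro m k h; unfold chi12; rw [h]
  have := key (n % 12).toNat (by simp; lia) (d % 12).toNat (by simp; lia)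
  rw [Int.toNat_of_nonneg (by lia), Int.toNat_of_nonneg (by lia)] at this
  rw [h4 n (n % 12) (by lia), h4 d (d % 12) (by lia), h4 (n + d) (n % 12 + d % 12) (by lia),
    h12 (n + 2 * d) (n % 12 + 2 * (d % 12)) (by lia), h12 (2 * n + d) (2 * (n % 12) + d % 12) (by lia),
    h12 (n - d) (n % 12 - d % 12) (by lia), this]

end EtaTwentySix

/-! ### Gaussian binomials and the q-binomial theorem -/

namespace EtaTwentySix

/-- The Gaussian binomial coefficient. -/
def gaussBinom (q : ℂ) : ℕ → ℕ → ℂ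
  | _, 0 => 1
  | 0, _ + 1 => 0
  | n + 1, k + 1 => q ^ (k + 1) * gaussBinom q n (k + 1) + gaussBinom q n k

lemma gaussBinom_zero_right (q : ℂ) (n : ℕ) : gaussBinom q n 0 = 1 := by
  cases n <;> simp [gaussBinom]

lemma gaussBinom_succ_succ (q : ℂ) (n k : ℕ) :
    gaussBinom q (n + 1) (k + 1) = q ^ (k + 1) * gaussBinom q n (k + 1) + gaussBinom q n k := rfl

lemma gaussBinom_eq_zero_of_lt (q : ℂ) {n k : ℕ} (h : n < k) : gaussBinom q n k = 0 := by
  induction n generalizing k with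
  | zero => obtain ⟨k, rfl⟩ := Nat.exists_eq_succ_of_ne_zero h.ne'; rfl
  | succ n ih =>
    obtain ⟨k, rfl⟩ := Nat.exists_eq_succ_of_ne_zero (Nat.ne_zero_of_lt h)
    rw [gaussBinom_succ_succ, ih (by lia), ih (by lia), mul_zero, add_zero]

/-- The finite Euler product `∏_{i ≤ n} (1 - q ^ i)`. -/
def eulerProd (q : ℂ) (n : ℕ) : ℂ := ∏ i ∈ Finset.range n, (1 - q ^ (i + 1))

lemma eulerProd_succ (q : ℂ) (n : ℕ) : eulerProd q (n + 1) = eulerProd q n * (1 - q ^ (n + 1)) :=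
  Finset.prod_range_succ _ _

/-- The factorial formula in multiplied-out form, valid for every `q`. The double induction feeds
both predecessors in the Pascal rule. -/
lemma gaussBinom_mul_eulerProd (q : ℂ) (n k : ℕ) :
    gaussBinom q (n + k) k * (eulerProd q n * eulerProd q k) = eulerProd q (n + k) := by
  induction k generalizing n with
  | zero => simp [gaussBinom_zero_right, eulerProd]
  | succ k ihk =>
    induction n with
    | zero =>
      have := ihk 0
      simp only [zero_add] at this ⊢
      rw [gaussBinom_succ_succ, gaussBinom_eq_zero_of_lt q (Nat.lt_succ_self k), eulerProd_succ]
      linear_combination (1 - q ^ (k + 1)) * this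
    | succ n ihn =>
      have h1 := ihk (n + 1)
      rw [show n + 1 + k = n + (k + 1) by ring] at h1
      rw [show n + 1 + (k + 1) = n + (k + 1) + 1 by ring, gaussBinom_succ_succ,
        eulerProd_succ q (n + (k + 1)), add_mul, eulerProd_succ q n, eulerProd_succ q k]
      rw [eulerProd_succ q n] at h1
      rw [eulerProd_succ q k] at ihn
      linear_combination q ^ (k + 1) * (1 - q ^ (n + 1)) * ihn + (1 - q ^ (k + 1)) * h1

/-- The `q`-binomial theorem. -/
lemma prod_one_add_mul_pow (q y : ℂ) (n : ℕ) :
    ∏ i ∈ Finset.range n, (1 + y * q ^ i) =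
      ∑ k ∈ Finset.range (n + 1), gaussBinom q n k * q ^ (k.choose 2) * y ^ k := by
  induction n generalizing y with
  | zero => simp [gaussBinom]
  | succ n ih =>
    -- Without its factor `i = 0`, the product is the shorter one evaluated at `y q`; the induction
    -- therefore runs over all `y`.
    have h : ∏ i ∈ Finset.range n, (1 + y * q ^ (i + 1)) =
        ∑ k ∈ Finset.range (n + 1), gaussBinom q n k * q ^ (k.choose 2) * (y * q) ^ k := by
      rw [← ih]
      exact Finset.prod_congr rfl fun i _ => by ring
    rw [Finset.prod_range_succ', h, Finset.sum_range_succ' _ (n + 1)]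
    have h2 : ∑ k ∈ Finset.range (n + 1), gaussBinom q n k * q ^ (k.choose 2) * (y * q) ^ k =
        ∑ k ∈ Finset.range (n + 1),
          gaussBinom q n (k + 1) * q ^ ((k + 1).choose 2) * (y * q) ^ (k + 1) + 1 := by
      have := Finset.sum_range_succ' (fun k => gaussBinom q n k * q ^ (k.choose 2) * (y * q) ^ k)
        (n + 1)
      rw [Finset.sum_range_succ, gaussBinom_eq_zero_of_lt q (Nat.lt_succ_self n)] at this
      simpa [gaussBinom_zero_right] using this
    have e1 (k : ℕ) : q ^ ((k + 1).choose 2) = q ^ (k.choose 2) * q ^ k := by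
      rw [← pow_add, Nat.choose_succ_succ' k 1, Nat.choose_one_right, add_comm]
    have h3 : ∑ k ∈ Finset.range (n + 1),
        gaussBinom q (n + 1) (k + 1) * q ^ ((k + 1).choose 2) * y ^ (k + 1) =
        ∑ k ∈ Finset.range (n + 1),
          gaussBinom q n (k + 1) * q ^ ((k + 1).choose 2) * (y * q) ^ (k + 1) +
        (∑ k ∈ Finset.range (n + 1), gaussBinom q n k * q ^ (k.choose 2) * (y * q) ^ k) * y := by
      rw [Finset.sum_mul, ← Finset.sum_add_distrib]
      refine Finset.sum_congr rfl fun k _ => ?_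
      rw [gaussBinom_succ_succ, e1]
      ring
    rw [h3]
    simp only [pow_zero, mul_one, gaussBinom_zero_right, Nat.choose_zero_succ]
    rw [mul_add, mul_one, h2]
    ring

end EtaTwentySix

/-! ### The Jacobi triple product -/

namespace EtaTwentySix

lemma prod_neg_mul_zpow {q x : ℂ} (hq : q ≠ 0) (N : ℕ) :
    ∏ j ∈ Finset.range N, (-x * q ^ (-((j : ℤ) + 1))) =
      (-x) ^ N * q ^ (-((N + 1).choose 2 : ℤ)) := by
  induction N with
  | zero => simp
  | succ N ih =>
    rw [Finset.prod_range_succ, ih, Nat.choose_succ_succ' (N + 1) 1, Nat.choose_one_right]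
    have : (-((N + 1 + (N + 1).choose (1 + 1) : ℕ) : ℤ)) = -((N + 1).choose 2 : ℤ) + -((N : ℤ) + 1) := by
      push_cast; ring
    rw [this, zpow_add₀ hq]
    ring

lemma two_mul_choose_two (k : ℕ) : 2 * (k.choose 2 : ℤ) = k * (k - 1) := by
  induction k with
  | zero => simp
  | succ k ih =>
    rw [Nat.choose_succ_succ' k 1, Nat.choose_one_right]; push_cast; linarith

/-- The finite Jacobi triple product. -/
lemma finite_triple_product {q x : ℂ} (hq : q ≠ 0) (hx : x ≠ 0) (N : ℕ) :
    (∏ j ∈ Finset.range N, (1 - x * q ^ j)) * ∏ j ∈ Finset.range N, (1 - x⁻¹ * q ^ (j + 1)) =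
      ∑ k ∈ Finset.range (N + N + 1), gaussBinom q (N + N) k *
        ((-x) ^ ((k : ℤ) - N) * q ^ (((k : ℤ) - N) * ((k : ℤ) - N - 1) / 2)) := by
  -- With `y = -x q^(-N)` the `2N` factors are `1 - x q^(i - N)`. The half with `i ≥ N` is the first
  -- product; in the other half, pulling out `-x q^(-(j + 1))` leaves the factors `1 - x⁻¹ q^(j +
  -- 1)`.
  have h := prod_one_add_mul_pow q (-x * q ^ (-(N : ℤ))) (N + N)
  have h1 : ∏ i ∈ Finset.range (N + N), (1 + -x * q ^ (-(N : ℤ)) * q ^ i) =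
      ((∏ j ∈ Finset.range N, (1 - x * q ^ j)) * ∏ j ∈ Finset.range N, (1 - x⁻¹ * q ^ (j + 1))) *
      ((-x) ^ N * q ^ (-((N + 1).choose 2 : ℤ))) := by
    rw [Finset.prod_range_add, ← prod_neg_mul_zpow hq, mul_assoc, mul_comm]
    congr 1
    · refine Finset.prod_congr rfl fun j _ => ?_
      rw [pow_add, zpow_neg, zpow_natCast]
      field_simp
      ring
    · rw [← Finset.prod_range_reflect, ← Finset.prod_mul_distrib]
      refine Finset.prod_congr rfl fun j hj => ?_
      have hj := Finset.mem_range.1 hj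
      have : q ^ (N : ℤ) = q ^ (N - 1 - j) * q ^ (j + 1) := by
        rw [← pow_add, zpow_natCast]; congr 1; lia
      rw [zpow_neg, this, zpow_neg, show ((j : ℤ) + 1) = ((j + 1 : ℕ) : ℤ) by simp, zpow_natCast]
      field_simp
      ring
  rw [h1] at h
  have hne : (-x) ^ N * q ^ (-((N + 1).choose 2 : ℤ)) ≠ 0 :=
    mul_ne_zero (pow_ne_zero _ (neg_ne_zero.2 hx)) (zpow_ne_zero _ hq)
  apply mul_right_cancel₀ hne
  rw [h, Finset.sum_mul]
  refine Finset.sum_congr rfl fun k _ => ?_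
  have e1 : ((-x * q ^ (-(N : ℤ))) ^ k : ℂ) = (-x) ^ ((k : ℤ) - N) * (-x) ^ N * q ^ (-(N : ℤ) * k) := by
    rw [mul_pow, zpow_mul, zpow_natCast, ← zpow_natCast (-x) N, ← zpow_add₀ (neg_ne_zero.2 hx),
      sub_add_cancel, zpow_natCast]
  have e2 : q ^ (k.choose 2) * q ^ (-(N : ℤ) * k) =
      q ^ (((k : ℤ) - N) * ((k : ℤ) - N - 1) / 2) * q ^ (-((N + 1).choose 2 : ℤ)) := by
    rw [← zpow_natCast, ← zpow_add₀ hq, ← zpow_add₀ hq]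
    congr 1
    have a1 := two_mul_choose_two k
    have a2 := two_mul_choose_two (N + 1)
    have a3 := Int.even_mul_pred_self ((k : ℤ) - N)
    have a4 := Int.two_mul_ediv_two_of_even a3
    push_cast at a2
    linarith
  rw [e1]
  linear_combination gaussBinom q (N + N) k * ((-x) ^ ((k : ℤ) - N) * (-x) ^ N) * e2

lemma e_mul_eq_pow (n : ℕ) (τ : ℂ) : e ((n + 1) * τ) = e τ ^ (n + 1) := by
  rw [← e_nat_mul]; push_cast; rfl

lemma summable_norm_pow_succ {q : ℂ} (hq : ‖q‖ < 1) (x : ℂ) : Summable fun n : ℕ => ‖x * q ^ (n + 1)‖ := by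
  simp only [norm_mul, norm_pow, pow_succ]
  exact ((summable_geometric_of_lt_one (norm_nonneg _) hq).mul_right _).mul_left _

lemma multipliable_one_sub_mul_pow {q : ℂ} (hq : ‖q‖ < 1) (x : ℂ) :
    Multipliable fun n : ℕ => 1 - x * q ^ (n + 1) := by
  simp only [sub_eq_add_neg]
  exact multipliable_one_add_of_summable (by simpa using summable_norm_pow_succ hq x)

lemma tprod_one_sub_mul_pow_ne_zero {q : ℂ} (hq : ‖q‖ < 1) (x : ℂ)
    (h : ∀ n : ℕ, 1 - x * q ^ (n + 1) ≠ 0) : ∏' n : ℕ, (1 - x * q ^ (n + 1)) ≠ 0 := by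
  simp only [sub_eq_add_neg] at h ⊢
  exact tprod_one_add_ne_zero_of_summable h (by simpa using summable_norm_pow_succ hq x)

lemma one_sub_pow_ne_zero {q : ℂ} (hq : ‖q‖ < 1) (n : ℕ) : 1 - q ^ (n + 1) ≠ 0 := by
  intro h
  have : ‖q ^ (n + 1)‖ < 1 := by rw [norm_pow]; exact pow_lt_one₀ (norm_nonneg _) hq (by simp)
  rw [← sub_eq_zero.1 h] at this
  simp at this

lemma eulerProd_ne_zero {q : ℂ} (hq : ‖q‖ < 1) (n : ℕ) : eulerProd q n ≠ 0 :=
  Finset.prod_ne_zero_iff.2 fun i _ => one_sub_pow_ne_zero hq i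

lemma tendsto_eulerProd {q : ℂ} (hq : ‖q‖ < 1) :
    Tendsto (eulerProd q) atTop (𝓝 (∏' n : ℕ, (1 - q ^ (n + 1)))) := by
  have := (multipliable_one_sub_mul_pow hq 1).tendsto_prod_tprod_nat
  simp only [one_mul] at this
  exact this

lemma tprod_one_sub_pow_ne_zero {q : ℂ} (hq : ‖q‖ < 1) : ∏' n : ℕ, (1 - q ^ (n + 1)) ≠ 0 := by
  have := tprod_one_sub_mul_pow_ne_zero hq 1 (by simpa using one_sub_pow_ne_zero hq)
  simpa using this

lemma gaussBinom_eq_div {q : ℂ} (hq : ‖q‖ < 1) {n k : ℕ} (h : k ≤ n) :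
    gaussBinom q n k = eulerProd q n / (eulerProd q (n - k) * eulerProd q k) := by
  have := gaussBinom_mul_eulerProd q (n - k) k
  rw [Nat.sub_add_cancel h] at this
  rw [eq_div_iff (mul_ne_zero (eulerProd_ne_zero hq _) (eulerProd_ne_zero hq _)), this]

/-- The bound is uniform in both indices, as dominated convergence in the triple product requires.
It holds because the Euler products converge to a nonzero limit, so they and their inverses are
bounded. -/
lemma exists_norm_gaussBinom_le {q : ℂ} (hq : ‖q‖ < 1) : ∃ C : ℝ, ∀ n k, ‖gaussBinom q n k‖ ≤ C := by
  obtain ⟨C, hC⟩ := (tendsto_eulerProd hq).norm.bddAbove_range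
  obtain ⟨D, hD⟩ := ((tendsto_eulerProd hq).inv₀ (tprod_one_sub_pow_ne_zero hq)).norm.bddAbove_range
  replace hC n : ‖eulerProd q n‖ ≤ C := hC ⟨n, rfl⟩
  replace hD n : ‖(eulerProd q n)⁻¹‖ ≤ D := hD ⟨n, rfl⟩
  have hC0 : 0 ≤ C := (norm_nonneg _).trans (hC 0)
  have hD0 : 0 ≤ D := (norm_nonneg _).trans (hD 0)
  refine ⟨C * (D * D), fun n k => ?_⟩
  rcases le_or_gt k n with h | h
  · rw [gaussBinom_eq_div hq h, div_eq_mul_inv, mul_inv, norm_mul, norm_mul]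
    exact mul_le_mul (hC _) (mul_le_mul (hD _) (hD _) (norm_nonneg _) hD0) (by positivity) hC0
  · rw [gaussBinom_eq_zero_of_lt q h, norm_zero]
    positivity

/-- The central Gaussian binomial coefficient with an integer offset. -/
def centralBinom (q : ℂ) (N : ℕ) (r : ℤ) : ℂ :=
  if 0 ≤ r + N then gaussBinom q (N + N) (r + N).toNat else 0

/-- All three Euler products in the factorial formula tend to the same `P`, so the limit is `P / (P
P)`, whatever the offset. -/
lemma tendsto_centralBinom {q : ℂ} (hq : ‖q‖ < 1) (r : ℤ) :
    Tendsto (fun N => centralBinom q N r) atTop (𝓝 (∏' n : ℕ, (1 - q ^ (n + 1)))⁻¹) := by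
  set P := ∏' n : ℕ, (1 - q ^ (n + 1))
  have hP : P ≠ 0 := tprod_one_sub_pow_ne_zero hq
  have h1 : Tendsto (fun N : ℕ => N + N) atTop atTop := tendsto_atTop_mono (fun N => Nat.le_add_left N N) tendsto_id
  have h2 : Tendsto (fun N : ℕ => (r + N).toNat) atTop atTop := by
    rw [tendsto_atTop]; intro b
    filter_upwards [eventually_ge_atTop (b + r.natAbs)] with N hN
    lia
  have h3 : Tendsto (fun N : ℕ => N + N - (r + N).toNat) atTop atTop := by
    rw [tendsto_atTop]; intro b
    filter_upwards [eventually_ge_atTop (b + r.natAbs)] with N hN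
    lia
  have hE := tendsto_eulerProd hq
  have := (hE.comp h1).div ((hE.comp h3).mul (hE.comp h2)) (mul_ne_zero hP hP)
  rw [show P / (P * P) = P⁻¹ by field_simp] at this
  refine this.congr' ?_
  filter_upwards [eventually_ge_atTop r.natAbs] with N hN
  rw [centralBinom, if_pos (by lia), gaussBinom_eq_div hq (by lia)]
  rfl

lemma jacobiTheta₂_term_eq (r : ℤ) (z τ : ℂ) :
    jacobiTheta₂_term r (z + 1 / 2 - τ / 2) τ = (-e z) ^ r * e τ ^ (r * (r - 1) / 2) := by
  have h : (((r * (r - 1) / 2 : ℤ) : ℂ)) = r * (r - 1) / 2 := by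
    rw [Int.cast_div (Int.even_mul_pred_self r).two_dvd (by norm_num)]; push_cast; ring
  rw [neg_eq_neg_one_mul, mul_zpow, ← e_int_div_two, ← e_int_mul, ← e_int_mul, ← e_add, ← e_add, h,
    jacobiTheta₂_term, e]
  ring_nf

/-- The Jacobi triple product identity. -/
lemma triple_product (z : ℂ) {τ : ℂ} (hτ : 0 < τ.im) :
    (1 - e z) * ∏' n : ℕ, ((1 - e ((n + 1) * τ)) * (1 - e (z + (n + 1) * τ)) *
      (1 - e (-z + (n + 1) * τ))) = jacobiTheta₂ (z + 1 / 2 - τ / 2) τ := by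
  have hq := norm_e_lt_one hτ
  have hq0 := e_ne_zero τ
  have hx0 := e_ne_zero z
  simp only [e_add, e_mul_eq_pow, e_neg]
  set q := e τ
  set x := e z
  set P := ∏' n : ℕ, (1 - q ^ (n + 1)) with hPdef
  have hP : P ≠ 0 := tprod_one_sub_pow_ne_zero hq
  have hL : Tendsto (fun N => (1 - x) * ∏ n ∈ Finset.range N,
      ((1 - q ^ (n + 1)) * (1 - x * q ^ (n + 1)) * (1 - x⁻¹ * q ^ (n + 1)))) atTop
      (𝓝 ((1 - x) * ∏' n : ℕ,
      ((1 - q ^ (n + 1)) * (1 - x * q ^ (n + 1)) * (1 - x⁻¹ * q ^ (n + 1))))) := by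
    refine Tendsto.const_mul _ (Multipliable.tendsto_prod_tprod_nat ?_)
    exact ((by simpa using multipliable_one_sub_mul_pow hq 1 :
      Multipliable fun n : ℕ => 1 - q ^ (n + 1)).mul (multipliable_one_sub_mul_pow hq x)).mul
      (multipliable_one_sub_mul_pow hq x⁻¹)
  obtain ⟨C, hC⟩ := exists_norm_gaussBinom_le hq
  have hC0 : 0 ≤ C := (norm_nonneg _).trans (hC 0 0)
  have hs := ((summable_jacobiTheta₂_term_iff (z + 1 / 2 - τ / 2) τ).2 hτ)
  have hR : Tendsto (fun N => ∑' r : ℤ, centralBinom q N r * jacobiTheta₂_term r (z + 1 / 2 - τ / 2) τ)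
      atTop (𝓝 (∑' r : ℤ, P⁻¹ * jacobiTheta₂_term r (z + 1 / 2 - τ / 2) τ)) := by
    refine tendsto_tsum_of_dominated_convergence (hs.norm.mul_left C)
      (fun r => (tendsto_centralBinom hq r).mul_const _) (Eventually.of_forall fun N r => ?_)
    rw [norm_mul]
    refine mul_le_mul_of_nonneg_right ?_ (norm_nonneg _)
    unfold centralBinom
    split_ifs
    · exact hC _ _
    · simpa using hC0
  -- The finite identity runs over the exponents `0, …, N - 1` of `x q^j`, the product wanted here
  -- over `0, …, N`. This accounts for the extra factor `1 - x q^N`, which tends to 1.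
  have hfin (N : ℕ) : (1 - x) * ∏ n ∈ Finset.range N,
      ((1 - q ^ (n + 1)) * (1 - x * q ^ (n + 1)) * (1 - x⁻¹ * q ^ (n + 1))) =
      eulerProd q N * (1 - x * q ^ N) *
        ∑' r : ℤ, centralBinom q N r * jacobiTheta₂_term r (z + 1 / 2 - τ / 2) τ := by
    have h1 : ∑' r : ℤ, centralBinom q N r * jacobiTheta₂_term r (z + 1 / 2 - τ / 2) τ =
        (∏ j ∈ Finset.range N, (1 - x * q ^ j)) * ∏ j ∈ Finset.range N, (1 - x⁻¹ * q ^ (j + 1)) := by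
      let φ : ℕ ↪ ℤ := ⟨fun k => (k : ℤ) - N, fun a b h => by simpa using h⟩
      have hφ (k : ℕ) : φ k = (k : ℤ) - N := rfl
      rw [finite_triple_product hq0 hx0, tsum_eq_sum (s := (Finset.range (N + N + 1)).map φ),
        Finset.sum_map]
      · refine Finset.sum_congr rfl fun k _ => ?_
        rw [jacobiTheta₂_term_eq]
        simp [hφ, centralBinom, q, x]
      · intro r hr
        unfold centralBinom
        split_ifs with h0
        · rw [gaussBinom_eq_zero_of_lt, zero_mul]
          by_contra hlt
          exact hr (Finset.mem_map.2 ⟨(r + N).toNat, by simp; lia, by rw [hφ]; lia⟩)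
        · rw [zero_mul]
    rw [h1, Finset.prod_mul_distrib, Finset.prod_mul_distrib, ← eulerProd]
    have h2 := Finset.prod_range_succ (fun j => 1 - x * q ^ j) N
    rw [Finset.prod_range_succ'] at h2
    simp only [pow_zero, mul_one] at h2
    linear_combination eulerProd q N * (∏ j ∈ Finset.range N, (1 - x⁻¹ * q ^ (j + 1))) * h2
  have hlim : Tendsto (fun N => eulerProd q N * (1 - x * q ^ N) *
      ∑' r : ℤ, centralBinom q N r * jacobiTheta₂_term r (z + 1 / 2 - τ / 2) τ) atTop
      (𝓝 (P * (1 - x * 0) * ∑' r : ℤ, P⁻¹ * jacobiTheta₂_term r (z + 1 / 2 - τ / 2) τ)) :=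
    ((tendsto_eulerProd hq).mul (((tendsto_pow_atTop_nhds_zero_of_norm_lt_one hq).const_mul x).const_sub
      1)).mul hR
  rw [tendsto_nhds_unique (hL.congr hfin) hlim, tsum_mul_left, jacobiTheta₂]
  field_simp
  ring

end EtaTwentySix

/-! ### Theta functions and η as one-variable theta series -/

namespace EtaTwentySix

/-- The partial theta-type series `∑ c(n) e(n x + n² w)`. -/
noncomputable def thetaSeries (c : ℤ → ℤ) (x w : ℂ) : ℂ := ∑' n : ℤ, (c n : ℂ) * e (n * x + n ^ 2 * w)

lemma e_eq_jacobiTheta₂_term (n : ℤ) (x w : ℂ) :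
    e (n * x + n ^ 2 * w) = jacobiTheta₂_term n x (2 * w) := by
  rw [e, jacobiTheta₂_term]; ring_nf

lemma norm_intCast_le_one {c : ℤ} (hc : |c| ≤ 1) : ‖(c : ℂ)‖ ≤ 1 := by
  rw [Complex.norm_intCast]; exact_mod_cast hc

lemma summable_norm_thetaSeries {c : ℤ → ℤ} (hc : ∀ n, |c n| ≤ 1) (x : ℂ) {w : ℂ} (hw : 0 < w.im) :
    Summable fun n : ℤ => ‖(c n : ℂ) * e (n * x + n ^ 2 * w)‖ := by
  have h := ((summable_jacobiTheta₂_term_iff x (2 * w)).2 (by simpa using hw)).norm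
  refine h.of_nonneg_of_le (fun _ => norm_nonneg _) fun n => ?_
  rw [norm_mul, e_eq_jacobiTheta₂_term]
  exact mul_le_of_le_one_left (norm_nonneg _) (norm_intCast_le_one (hc n))

lemma summable_thetaSeries {c : ℤ → ℤ} (hc : ∀ n, |c n| ≤ 1) (x : ℂ) {w : ℂ} (hw : 0 < w.im) :
    Summable fun n : ℤ => (c n : ℂ) * e (n * x + n ^ 2 * w) :=
  (summable_norm_thetaSeries hc x hw).of_norm

lemma differentiable_thetaSeries {c : ℤ → ℤ} (hc : ∀ n, |c n| ≤ 1) {w : ℂ} (hw : 0 < w.im) :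
    Differentiable ℂ fun x => thetaSeries c x w := by
  intro x
  -- The terms are bounded uniformly on horizontal strips, which suffices for locally uniform
  -- convergence.
  let U : Set ℂ := {y | |y.im| < |x.im| + 1}
  have hU : IsOpen U := isOpen_lt (by fun_prop) continuous_const
  have hx : x ∈ U := by simp [U]
  have hw2 : 0 < (2 * w).im := by simpa using hw
  have hs := summable_pow_mul_jacobiTheta₂_term_bound (|x.im| + 1) hw2 0
  have := Complex.differentiableOn_tsum_of_summable_norm (F := fun (n : ℤ) (y : ℂ) =>
    (c n : ℂ) * e (n * y + n ^ 2 * w)) hs (fun n => ?_) hU (fun n y hy => ?_)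
  · exact this.differentiableAt (hU.mem_nhds hx)
  · exact (((differentiable_e.comp (by fun_prop)).const_mul _).differentiableOn)
  · rw [norm_mul, e_eq_jacobiTheta₂_term, pow_zero, one_mul]
    refine (mul_le_of_le_one_left (norm_nonneg _) (norm_intCast_le_one (hc n))).trans ?_
    exact norm_jacobiTheta₂_term_le hw2 (le_of_lt hy) le_rfl n

/-- Completing the square in the triple product moves the summation to the odd integers `n = 2r -
1`, where the sign `-(-1)^r` is the character modulo 4. -/
lemma theta_eq_thetaSeries (z : ℂ) {τ : ℂ} (hτ : 0 < τ.im) :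
    theta z τ = thetaSeries chi4 (z / 2) (τ / 8) := by
  have h1 : theta z τ = -e (τ / 8 - z / 2) * jacobiTheta₂ (z + 1 / 2 - τ / 2) τ := by
    rw [← triple_product z hτ, theta, e_sub, show e z = e (z / 2) * e (z / 2) by rw [← e_add]; ring_nf,
      neg_div, e_neg]
    have := e_ne_zero (z / 2)
    field_simp
    ring
  have hinj : Function.Injective fun r : ℤ => 2 * r - 1 := fun a b h => by
    simp only at h; lia
  rw [h1, thetaSeries, ← hinj.tsum_eq, jacobiTheta₂, ← tsum_mul_left]
  · refine tsum_congr fun r => ?_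
    have hr : (chi4 (2 * r - 1) : ℂ) = -e (r / 2) := by
      rw [e_int_div_two]
      rcases Int.even_or_odd' r with ⟨k, rfl | rfl⟩
      · rw [Even.neg_one_zpow (even_two_mul k), chi4, if_neg (by lia), if_pos (by lia)]; simp
      · rw [Odd.neg_one_zpow (odd_two_mul_add_one k), chi4, if_pos (by lia)]; simp
    rw [hr, ← sub_eq_zero, show jacobiTheta₂_term r (z + 1 / 2 - τ / 2) τ =
      e (r * (z + 1 / 2 - τ / 2) + r ^ 2 * (τ / 2)) by
        rw [e_eq_jacobiTheta₂_term]; ring_nf, neg_mul, neg_mul, ← e_add, ← e_add, sub_eq_zero]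
    congr 2
    push_cast; ring
  · intro n hn
    have : chi4 n ≠ 0 := by rintro h; simp [h] at hn
    refine ⟨(n + 1) / 2, ?_⟩
    have : n % 2 = 1 := by unfold chi4 at this; grind
    simp only; lia

/-- The indicator function of the odd integers. -/
def oddInd (n : ℤ) : ℤ := if n % 2 = 1 then 1 else 0

/-- The function `(-1) ^ (n / 2)` on even integers, extended by zero. -/
def altEven (n : ℤ) : ℤ := if n % 4 = 0 then 1 else if n % 4 = 2 then -1 else 0

lemma abs_oddInd_le (n : ℤ) : |oddInd n| ≤ 1 := by unfold oddInd; split_ifs <;> simp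

lemma abs_altEven_le (n : ℤ) : |altEven n| ≤ 1 := by unfold altEven; split_ifs <;> simp

lemma e_int_div_four (n : ℤ) : e (n / 4) = Complex.I ^ (n % 4).toNat := by
  have h : ((n : ℂ) / 4) = ((n % 4).toNat : ℂ) * (1 / 4) + (n / 4 : ℤ) := by
    have : (n : ℂ) = (((n % 4).toNat : ℤ) : ℂ) + 4 * ((n / 4 : ℤ) : ℂ) := by
      exact_mod_cast (by lia : n = ((n % 4).toNat : ℤ) + 4 * (n / 4))
    rw [this]; push_cast; ring
  rw [h, e_add_int, e_nat_mul, e_quarter]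

lemma chi4_mul_e (n : ℤ) : -Complex.I * (chi4 n * e (n / 4)) = oddInd n := by
  rw [e_int_div_four]
  have h : n % 4 = 0 ∨ n % 4 = 1 ∨ n % 4 = 2 ∨ n % 4 = 3 := by lia
  rcases h with h | h | h | h
  · rw [chi4, oddInd, if_neg (by lia), if_neg (by lia), if_neg (by lia)]; simp
  · rw [chi4, oddInd, if_pos (by lia), if_pos (by lia), h]; simp
  · rw [chi4, oddInd, if_neg (by lia), if_neg (by lia), if_neg (by lia)]; simp
  · rw [chi4, oddInd, if_neg (by lia), if_pos (by lia), if_pos (by lia), h]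
    simp [Complex.I_pow_three]

/-- The half-period shift multiplies the `n`-th term by `i^n`, and `-i · i^n` is the inverse of the
character modulo 4 at odd `n`. -/
lemma theta2_eq_thetaSeries (z : ℂ) {τ : ℂ} (hτ : 0 < τ.im) :
    theta2 z τ = thetaSeries oddInd (z / 2) (τ / 8) := by
  rw [theta2, theta_eq_thetaSeries _ hτ, thetaSeries, thetaSeries, ← tsum_mul_left]
  refine tsum_congr fun n => ?_
  rw [← chi4_mul_e, show (n : ℂ) * ((z + 1 / 2) / 2) + n ^ 2 * (τ / 8) =
    n / 4 + (n * (z / 2) + n ^ 2 * (τ / 8)) by ring, e_add]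
  ring

/-- The shift by `τ/2` together with the prefactor completes the square for `n + 1`, so odd indices
become even ones. -/
lemma theta4_eq_thetaSeries (z : ℂ) {τ : ℂ} (hτ : 0 < τ.im) :
    theta4 z τ = thetaSeries altEven (z / 2) (τ / 8) := by
  rw [theta4, theta_eq_thetaSeries _ hτ, thetaSeries, thetaSeries, ← tsum_mul_left,
    ← (Equiv.addRight (1 : ℤ)).tsum_eq (fun n : ℤ => (altEven n : ℂ) * _)]
  refine tsum_congr fun n => ?_
  have h : altEven (n + 1) = -chi4 n := by unfold altEven chi4; grind
  have h2 : e (((n + 1 : ℤ) : ℂ) * (z / 2) + ((n + 1 : ℤ) : ℂ) ^ 2 * (τ / 8)) =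
      e (z / 2) * e (τ / 8) * e (n * ((z + τ / 2) / 2) + n ^ 2 * (τ / 8)) := by
    rw [← e_add, ← e_add]; push_cast; ring_nf
  rw [Equiv.coe_addRight]
  simp only [h, h2]
  push_cast
  ring

lemma eta_eq (τ : ℂ) : ModularForm.eta τ = e (τ / 24) * ∏' n : ℕ, (1 - e τ ^ (n + 1)) := by
  rw [ModularForm.eta, Function.Periodic.qParam]
  congr 1
  · rw [e]; push_cast; ring_nf
  · refine tprod_congr fun n => ?_
    rw [ModularForm.eta_q_eq_pow]; rfl

/-- The exponents `3n`, `3n + 1`, `3n - 1` with `n ≥ 1` cover every positive integer except 1, which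
the prefactor supplies. The partial products are matched along `3N + 1`. -/
lemma tprod_three_mul {q : ℂ} (hq : ‖q‖ < 1) :
    (1 - q) * ∏' n : ℕ, ((1 - q ^ (3 * (n + 1))) * (1 - q * q ^ (3 * (n + 1))) *
      (1 - q⁻¹ * q ^ (3 * (n + 1)))) = ∏' n : ℕ, (1 - q ^ (n + 1)) := by
  rcases eq_or_ne q 0 with rfl | h0
  · simp
  have hq3 : ‖q ^ 3‖ < 1 := by rw [norm_pow]; exact pow_lt_one₀ (norm_nonneg _) hq (by norm_num)
  have hL : Multipliable fun n : ℕ => ((1 - q ^ (3 * (n + 1))) * (1 - q * q ^ (3 * (n + 1))) *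
      (1 - q⁻¹ * q ^ (3 * (n + 1)))) := by
    simp only [pow_mul]
    exact ((by simpa using multipliable_one_sub_mul_pow hq3 1 :
      Multipliable fun n : ℕ => 1 - (q ^ 3) ^ (n + 1)).mul (multipliable_one_sub_mul_pow hq3 q)).mul
      (multipliable_one_sub_mul_pow hq3 q⁻¹)
  have h1 := hL.tendsto_prod_tprod_nat.const_mul (1 - q)
  have h2 : Tendsto (fun N => 3 * N + 1) atTop atTop :=
    tendsto_atTop_mono (fun N : ℕ => (by lia : N ≤ 3 * N + 1)) tendsto_id
  refine tendsto_nhds_unique h1 (((tendsto_eulerProd hq).comp h2).congr fun N => ?_)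
  rw [Function.comp]
  induction N with
  | zero => simp [eulerProd]
  | succ N ih =>
    rw [Finset.prod_range_succ, ← mul_assoc, ← ih, show 3 * (N + 1) + 1 = 3 * N + 1 + 1 + 1 + 1 by ring,
      eulerProd_succ, eulerProd_succ, eulerProd_succ]
    have : q⁻¹ * q ^ (3 * (N + 1)) = q ^ (3 * N + 1 + 1) := by
      rw [show 3 * (N + 1) = 3 * N + 1 + 1 + 1 by ring, pow_succ]; field_simp
    rw [this]
    ring

/-- Euler's pentagonal number theorem, as a theta series for `η`. -/
lemma eta_eq_thetaSeries {τ : ℂ} (hτ : 0 < τ.im) :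
    2 * ModularForm.eta τ = thetaSeries chi12 0 (τ / 24) := by
  have h3 : 0 < (3 * τ).im := by simpa using hτ
  -- Specializing the triple product to `z = τ` with modulus `3τ` reassembles the Euler product of
  -- `η`.
  have h1 : -ModularForm.eta τ = e (τ / 6) * theta τ (3 * τ) := by
    rw [theta, eta_eq, ← tprod_three_mul (norm_e_lt_one hτ)]
    have : ∀ n : ℕ, e ((n + 1) * (3 * τ)) = e τ ^ (3 * (n + 1)) := fun n => by
      rw [← e_nat_mul]; push_cast; ring_nf
    simp only [e_add, this, e_neg]
    rw [← mul_assoc, ← mul_assoc, ← neg_mul]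
    congr 1
    rw [mul_sub, mul_sub, mul_sub, ← e_add, ← e_add, ← e_add, ← e_add, ← e_add, mul_one]
    ring_nf
  have h2 : -ModularForm.eta τ = ∑' n : ℤ, -((chi12 (3 * n + 2) : ℂ) * e ((3 * n + 2) ^ 2 * (τ / 24))) := by
    rw [h1, theta_eq_thetaSeries _ h3, thetaSeries, ← tsum_mul_left]
    refine tsum_congr fun n => ?_
    have : chi12 (3 * n + 2) = -chi4 n := by unfold chi12 chi4; grind
    rw [this, mul_left_comm, ← e_add]
    push_cast
    rw [neg_mul, neg_neg]
    congr 2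
    ring
  rw [tsum_neg, neg_inj] at h2
  have hs := summable_thetaSeries abs_chi12_le 0 (w := τ / 24) (by simpa using hτ)
  let g (n : ℤ) : ℂ := (chi12 n : ℂ) * e (n * 0 + n ^ 2 * (τ / 24))
  have hg : g = fun n => {n : ℤ | n % 3 = 2}.indicator g n + {n : ℤ | n % 3 = 1}.indicator g n := by
    funext n
    have h : n % 3 = 0 ∨ n % 3 = 1 ∨ n % 3 = 2 := by lia
    rcases h with h | h | h <;> simp [h]
    have : chi12 n = 0 := by unfold chi12; grind
    simp [g, this]
  have hinj : Function.Injective fun r : ℤ => 3 * r + 2 := fun a b h => by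
    simp only at h; lia
  have hA : ∑' n, {n : ℤ | n % 3 = 2}.indicator g n = ModularForm.eta τ := by
    rw [h2, ← hinj.tsum_eq]
    · refine tsum_congr fun n => ?_
      rw [Set.indicator_of_mem (show 3 * n + 2 ∈ {n : ℤ | n % 3 = 2} by simp only [Set.mem_ofPred_eq]; lia)]
      simp only [g]; push_cast; ring_nf
    · intro n hn
      have : n % 3 = 2 := by by_contra h; simp [h] at hn
      exact ⟨n / 3, by simp only; lia⟩
  -- The residues 2 and 1 modulo 3 are exchanged by `n ↦ -n` and `chi12` is even; each class
  -- contributes one copy of `η`.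
  have hB : ∑' n, {n : ℤ | n % 3 = 1}.indicator g n = ModularForm.eta τ := by
    rw [← hA, ← (Equiv.neg ℤ).tsum_eq]
    refine tsum_congr fun n => ?_
    have : (-n) % 3 = 1 ↔ n % 3 = 2 := by lia
    by_cases h : n % 3 = 2
    · rw [Set.indicator_of_mem (show n ∈ {n : ℤ | n % 3 = 2} from h),
        Set.indicator_of_mem (show (Equiv.neg ℤ) n ∈ {n : ℤ | n % 3 = 1} from this.2 h)]
      simp [g, chi12_neg]
    · rw [Set.indicator_of_notMem (show n ∉ {n : ℤ | n % 3 = 2} from h),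
        Set.indicator_of_notMem (show (Equiv.neg ℤ) n ∉ {n : ℤ | n % 3 = 1} from fun hh => h (this.1 hh))]
  change _ = ∑' n, g n
  rw [hg, Summable.tsum_add (Summable.indicator hs _) (Summable.indicator hs _), hA, hB]
  ring

end EtaTwentySix

/-! ### The quintuple product identity and θ* -/

namespace EtaTwentySix

/-- The terms of a product of two theta series. -/
noncomputable def pairTerm (c d : ℤ → ℤ) (x y w v : ℂ) (p : ℤ × ℤ) : ℂ :=
  (c p.1 * d p.2 : ℂ) * e (p.1 * x + p.2 * y + (p.1 ^ 2 * w + p.2 ^ 2 * v))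

lemma pairTerm_eq (c d : ℤ → ℤ) (x y w v : ℂ) (p : ℤ × ℤ) :
    pairTerm c d x y w v p = (c p.1 * e (p.1 * x + p.1 ^ 2 * w)) * (d p.2 * e (p.2 * y + p.2 ^ 2 * v)) := by
  rw [pairTerm, show (p.1 : ℂ) * x + p.2 * y + (p.1 ^ 2 * w + p.2 ^ 2 * v) =
    (p.1 * x + p.1 ^ 2 * w) + (p.2 * y + p.2 ^ 2 * v) by ring, e_add]
  ring

variable {c d : ℤ → ℤ} {w v : ℂ}

lemma thetaSeries_mul (hc : ∀ n, |c n| ≤ 1) (hd : ∀ n, |d n| ≤ 1) (x y : ℂ)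
    (hw : 0 < w.im) (hv : 0 < v.im) :
    thetaSeries c x w * thetaSeries d y v = ∑' p, pairTerm c d x y w v p := by
  simp only [pairTerm_eq]
  exact tsum_mul_tsum_of_summable_norm (summable_norm_thetaSeries hc x hw)
    (summable_norm_thetaSeries hd y hv)

lemma summable_pairTerm (hc : ∀ n, |c n| ≤ 1) (hd : ∀ n, |d n| ≤ 1) (x y : ℂ)
    (hw : 0 < w.im) (hv : 0 < v.im) : Summable (pairTerm c d x y w v) := by
  have := summable_mul_of_summable_norm (summable_norm_thetaSeries hc x hw)
    (summable_norm_thetaSeries hd y hv)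
  exact this.congr fun p => (pairTerm_eq c d x y w v p).symm

/-- The quintuple product identity, in the form `θ(z) K(z) = η θ(2z)`. -/
lemma theta_mul_thetaSeries (z : ℂ) {τ : ℂ} (hτ : 0 < τ.im) :
    theta z τ * thetaSeries chi12 (z / 2) (τ / 24) = ModularForm.eta τ * theta (2 * z) τ := by
  have h8 : 0 < (τ / 8).im := by simpa using hτ
  have h24 : 0 < (τ / 24).im := by simpa using hτ
  suffices 2 * (theta z τ * thetaSeries chi12 (z / 2) (τ / 24)) =
      (2 * ModularForm.eta τ) * theta (2 * z) τ by linear_combination this / 2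
  rw [eta_eq_thetaSeries hτ, theta_eq_thetaSeries _ hτ, theta_eq_thetaSeries _ hτ,
    mul_comm (thetaSeries chi12 0 _)]
  -- The substitutions `(n, n + 2d)` on the left and `(n + d, n - d)` on the right both turn the
  -- exponential into this expression, which is symmetric in `n` and `d`. The right side is
  -- therefore the left side symmetrized, by `chi4_mul_chi12`, and this absorbs the factor 2.
  let E (p : ℤ × ℤ) : ℂ := e ((p.1 + p.2) * z + (p.1 ^ 2 + p.1 * p.2 + p.2 ^ 2) * (τ / 6))
  let a (p : ℤ × ℤ) : ℂ := (chi4 p.1 * chi12 (p.1 + 2 * p.2) : ℂ) * E p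
  have hL : ∀ p : ℤ × ℤ,
      pairTerm chi4 chi12 (z / 2) (z / 2) (τ / 8) (τ / 24) (p.1, p.1 + 2 * p.2) = a p := by
    intro p
    simp only [pairTerm, a, E]; congr 2; push_cast; ring
  have hR : ∀ p : ℤ × ℤ,
      pairTerm chi4 chi12 (2 * z / 2) 0 (τ / 8) (τ / 24) (p.1 + p.2, p.1 - p.2) = a p + a p.swap := by
    intro p
    have := chi4_mul_chi12 p.1 p.2
    have : (chi4 (p.1 + p.2) * chi12 (p.1 - p.2) : ℂ) =
        chi4 p.1 * chi12 (p.1 + 2 * p.2) + chi4 p.2 * chi12 (p.2 + 2 * p.1) := by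
      rw [add_comm p.2]; exact_mod_cast this.symm
    have hE : E p.swap = E p := by simp only [E, Prod.fst_swap, Prod.snd_swap]; ring_nf
    simp only [pairTerm, a, hE, this, Prod.fst_swap, Prod.snd_swap]
    rw [← add_mul]
    congr 1
    simp only [E]; congr 1; push_cast; ring
  have iL : Function.Injective fun p : ℤ × ℤ => (p.1, p.1 + 2 * p.2) := fun p q h => by
    simp only [Prod.mk.injEq] at h; ext <;> lia
  have iR : Function.Injective fun p : ℤ × ℤ => (p.1 + p.2, p.1 - p.2) := fun p q h => by
    simp only [Prod.mk.injEq] at h; ext <;> lia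
  have odd4 : ∀ n, chi4 n ≠ 0 → n % 2 = 1 := by intro n; unfold chi4; grind
  have odd12 : ∀ n, chi12 n ≠ 0 → n % 2 = 1 := by intro n; unfold chi12; grind
  have key : ∀ {x y : ℂ} {p : ℤ × ℤ}, p ∈ Function.support (pairTerm chi4 chi12 x y (τ / 8) (τ / 24)) →
      p.1 % 2 = 1 ∧ p.2 % 2 = 1 := by
    intro x y p hp
    rw [Function.mem_support, pairTerm] at hp
    constructor
    · exact odd4 _ fun h => hp (by simp [h])
    · exact odd12 _ fun h => hp (by simp [h])
  have sL := iL.summable_iff (f := pairTerm chi4 chi12 (z / 2) (z / 2) (τ / 8) (τ / 24)) (fun p hp => by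
    by_contra h
    have := key h
    exact hp ⟨(p.1, (p.2 - p.1) / 2), by ext <;> simp only; lia⟩)
  have ha : Summable a := by
    have := sL.2 (summable_pairTerm abs_chi4_le abs_chi12_le _ _ h8 h24)
    exact this.congr fun p => (hL p)
  have ha' : Summable fun p : ℤ × ℤ => a p.swap := (Equiv.prodComm ℤ ℤ).summable_iff.2 ha
  have hsw : ∑' p : ℤ × ℤ, a p.swap = ∑' p, a p := (Equiv.prodComm ℤ ℤ).tsum_eq a
  have tL : ∑' p, pairTerm chi4 chi12 (z / 2) (z / 2) (τ / 8) (τ / 24) p = ∑' p, a p := by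
    rw [← iL.tsum_eq]
    · exact tsum_congr hL
    · intro p hp
      have := key hp
      exact ⟨(p.1, (p.2 - p.1) / 2), by ext <;> simp only; lia⟩
  have tR : ∑' p, pairTerm chi4 chi12 (2 * z / 2) 0 (τ / 8) (τ / 24) p = ∑' p, (a p + a p.swap) := by
    rw [← iR.tsum_eq]
    · exact tsum_congr hR
    · intro p hp
      have := key hp
      exact ⟨((p.1 + p.2) / 2, (p.1 - p.2) / 2), by ext <;> simp only <;> lia⟩
  rw [thetaSeries_mul abs_chi4_le abs_chi12_le _ _ h8 h24,
    thetaSeries_mul abs_chi4_le abs_chi12_le _ _ h8 h24, tL, tR, ha.tsum_add ha', hsw, two_mul]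

/-- One nonvanishing value makes the zeros of the entire function `θ` isolated, so that division by
it is legitimate near every point. -/
lemma theta_half_ne_zero {τ : ℂ} (hτ : 0 < τ.im) : theta (1 / 2) τ ≠ 0 := by
  have hq := norm_e_lt_one hτ
  have h1 : Multipliable fun n : ℕ => 1 - e τ ^ (n + 1) := by
    simpa using multipliable_one_sub_mul_pow hq 1
  have h2 := multipliable_one_sub_mul_pow hq (-1)
  have h3 : ∀ n : ℕ, 1 - (-1) * e τ ^ (n + 1) ≠ 0 := by
    intro n h
    have : ‖e τ ^ (n + 1)‖ < 1 := by rw [norm_pow]; exact pow_lt_one₀ (norm_nonneg _) hq (by simp)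
    rw [show e τ ^ (n + 1) = -1 by linear_combination h] at this
    simp at this
  have hm : e (-(1 / 2)) = -1 := by rw [e_neg, e_half]; norm_num
  rw [theta]
  simp only [e_add, e_mul_eq_pow, e_half, hm]
  rw [(h1.mul h2).tprod_mul h2, h1.tprod_mul h2]
  refine mul_ne_zero (mul_ne_zero (e_ne_zero _) ?_) (mul_ne_zero (mul_ne_zero
    (tprod_one_sub_pow_ne_zero hq) (tprod_one_sub_mul_pow_ne_zero hq _ h3))
    (tprod_one_sub_mul_pow_ne_zero hq _ h3))
  rw [show (1 / 2 / 2 : ℂ) = 1 / 4 by norm_num, show (-(1 / 2) / 2 : ℂ) = -(1 / 4) by norm_num, e_neg,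
    e_quarter]
  simp [← two_mul]

lemma eventually_theta_ne_zero (z : ℂ) {τ : ℂ} (hτ : 0 < τ.im) : ∀ᶠ y in 𝓝[≠] z, theta y τ ≠ 0 := by
  have h8 : 0 < (τ / 8).im := by simpa using hτ
  have hd : Differentiable ℂ fun y => theta y τ := by
    simp only [theta_eq_thetaSeries _ hτ]
    exact (differentiable_thetaSeries abs_chi4_le h8).comp
      (by fun_prop : Differentiable ℂ fun y : ℂ => y / 2)
  have ha : AnalyticOnNhd ℂ (fun y => theta y τ) Set.univ := fun y _ => hd.analyticAt y
  by_contra hcon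
  have := ha.eqOn_zero_of_preconnected_of_frequently_eq_zero isPreconnected_univ (Set.mem_univ z)
    hcon
  exact theta_half_ne_zero hτ (this (Set.mem_univ _))

/-- By the quintuple product the quotient agrees with an entire series wherever `θ ≠ 0`, hence on a
punctured neighbourhood of each point; continuity of the series gives the limit. -/
lemma thetaStar_eq_thetaSeries (z : ℂ) {τ : ℂ} (hτ : 0 < τ.im) :
    thetaStar z τ = thetaSeries chi12 (z / 2) (τ / 24) := by
  have h24 : 0 < (τ / 24).im := by simpa using hτ
  have hd : Differentiable ℂ fun y => thetaSeries chi12 (y / 2) (τ / 24) :=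
    (differentiable_thetaSeries abs_chi12_le h24).comp (by fun_prop : Differentiable ℂ fun y : ℂ => y / 2)
  refine Tendsto.limUnder_eq (Tendsto.congr' ?_ (hd.continuous.tendsto z |>.mono_left nhdsWithin_le_nhds))
  filter_upwards [eventually_theta_ne_zero z hτ] with y hy
  rw [← theta_mul_thetaSeries y hτ]
  field_simp

end EtaTwentySix

/-! ### Wirtinger derivatives of exponential series -/

namespace EtaTwentySix

open ComplexConjugate

variable {ι : Type*} {c α β : ι → ℂ}

/-- The exponential series `∑ c e(α z + β z̄)`. -/
noncomputable def expSeries (c α β : ι → ℂ) (z : ℂ) : ℂ := ∑' i, c i * e (α i * z + β i * conj z)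

/-- The coefficients `c` decay faster than any exponential in the frequencies `α`, `β`. -/
def RapidDecay (c α β : ι → ℂ) : Prop :=
  ∀ R : ℝ, Summable fun i => ‖c i‖ * Real.exp (R * (‖α i‖ + ‖β i‖))

/-- A polynomial factor in the frequencies costs only an increase of `R` by one, since `t ≤ exp t`.
Rapid decay therefore survives repeated differentiation. -/
lemma RapidDecay.mul {γ : ι → ℂ} (h : RapidDecay c α β) (hγ : ∀ i, ‖γ i‖ ≤ ‖α i‖ + ‖β i‖) :
    RapidDecay (fun i => c i * γ i) α β := by
  intro R
  refine (h (R + 1)).of_nonneg_of_le (fun i => by positivity) fun i => ?_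
  rw [norm_mul, add_mul, one_mul, Real.exp_add, mul_assoc]
  refine mul_le_mul_of_nonneg_left ?_ (norm_nonneg _)
  rw [mul_comm]
  refine mul_le_mul_of_nonneg_left ?_ (Real.exp_pos _).le
  linarith [hγ i, Real.add_one_le_exp (‖α i‖ + ‖β i‖)]

lemma RapidDecay.mul_left (h : RapidDecay c α β) : RapidDecay (fun i => c i * α i) α β :=
  h.mul fun _ => le_add_of_nonneg_right (norm_nonneg _)

lemma RapidDecay.mul_right (h : RapidDecay c α β) : RapidDecay (fun i => c i * β i) α β :=
  h.mul fun _ => le_add_of_nonneg_left (norm_nonneg _)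

lemma norm_e_expSeries_le (a b : ℂ) {z : ℂ} {R : ℝ} (hz : ‖z‖ ≤ R) :
    ‖e (a * z + b * conj z)‖ ≤ Real.exp (2 * Real.pi * R * (‖a‖ + ‖b‖)) := by
  refine (norm_e_le _).trans (Real.exp_le_exp.2 ?_)
  rw [mul_assoc (2 * Real.pi)]
  refine mul_le_mul_of_nonneg_left ?_ Real.two_pi_pos.le
  refine (norm_add_le _ _).trans ?_
  rw [norm_mul, norm_mul, RCLike.norm_conj, ← add_mul, mul_comm]
  exact mul_le_mul_of_nonneg_right hz (by positivity)

lemma RapidDecay.summable (h : RapidDecay c α β) (z : ℂ) :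
    Summable fun i => c i * e (α i * z + β i * conj z) := by
  refine (h (2 * Real.pi * ‖z‖)).of_norm_bounded fun i => ?_
  rw [norm_mul]
  exact mul_le_mul_of_nonneg_left (norm_e_expSeries_le _ _ le_rfl) (norm_nonneg _)

/-- The differential `2πi dz`. -/
noncomputable def dzCLM : ℂ →L[ℝ] ℂ := (2 * Real.pi * Complex.I : ℂ) • ContinuousLinearMap.id ℝ ℂ

/-- The differential `2πi dz̄`. -/
noncomputable def dzbarCLM : ℂ →L[ℝ] ℂ :=
  (2 * Real.pi * Complex.I : ℂ) • (Complex.conjCLE : ℂ →L[ℝ] ℂ)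

lemma hasFDerivAt_e_term (k a b z : ℂ) :
    HasFDerivAt (𝕜 := ℝ) (fun z => k * e (a * z + b * conj z))
      ((k * a * e (a * z + b * conj z)) • dzCLM + (k * b * e (a * z + b * conj z)) • dzbarCLM) z := by
  have h1 : HasFDerivAt (𝕜 := ℝ) (fun z : ℂ => z) (ContinuousLinearMap.id ℝ ℂ) z := hasFDerivAt_id z
  have h2 : HasFDerivAt (𝕜 := ℝ) (fun z : ℂ => conj z) (Complex.conjCLE : ℂ →L[ℝ] ℂ) z :=
    Complex.conjCLE.hasFDerivAt
  have h3 := (((h1.const_mul a).add (h2.const_mul b)).const_mul (2 * Real.pi * Complex.I)).cexp.const_mul k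
  refine h3.congr_fderiv ?_
  ext y; simp [dzCLM, dzbarCLM, e]; ring_nf

lemma RapidDecay.hasFDerivAt (h : RapidDecay c α β) (z : ℂ) :
    HasFDerivAt (𝕜 := ℝ) (expSeries c α β)
      (expSeries (fun i => c i * α i) α β z • dzCLM +
        expSeries (fun i => c i * β i) α β z • dzbarCLM) z := by
  let R := ‖z‖ + 1
  have hz : z ∈ Metric.ball (0 : ℂ) R := by simp [R]
  have hu : Summable fun i => (‖c i * α i‖ * Real.exp (2 * Real.pi * R * (‖α i‖ + ‖β i‖))) * ‖dzCLM‖ +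
      (‖c i * β i‖ * Real.exp (2 * Real.pi * R * (‖α i‖ + ‖β i‖))) * ‖dzbarCLM‖ :=
    ((h.mul_left _).mul_right _).add ((h.mul_right _).mul_right _)
  have key := hasFDerivAt_tsum_of_isPreconnected (𝕜 := ℝ) hu Metric.isOpen_ball
    (convex_ball (0 : ℂ) R).isPreconnected
    (fun i y _ => hasFDerivAt_e_term (c i) (α i) (β i) y) (fun i y hy => ?_) hz (h.summable z) hz
  · refine key.congr_fderiv ?_
    have sα := h.mul_left.summable z
    have sβ := h.mul_right.summable z
    rw [Summable.tsum_add (sα.smul_const _) (sβ.smul_const _), sα.tsum_smul_const, sβ.tsum_smul_const]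
    rfl
  · have hy' : ‖y‖ ≤ R := by simpa using (mem_ball_zero_iff.1 hy).le
    refine (norm_add_le _ _).trans (add_le_add ?_ ?_) <;>
    · rw [norm_smul, norm_mul]
      exact mul_le_mul_of_nonneg_right (mul_le_mul_of_nonneg_left
        (norm_e_expSeries_le _ _ hy') (norm_nonneg _)) (norm_nonneg _)

lemma RapidDecay.contDiff (h : RapidDecay c α β) : ContDiff ℝ ∞ (expSeries c α β) := by
  rw [contDiff_infty]
  intro n
  induction n generalizing c with
  | zero =>
    rw [Nat.cast_zero, contDiff_zero]
    exact continuous_iff_continuousAt.2 fun z => (h.hasFDerivAt z).continuousAt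
  | succ n ih =>
    rw [Nat.cast_succ, contDiff_succ_iff_hasFDerivAt]
    exact ⟨_, ((ih h.mul_left).smul contDiff_const).add ((ih h.mul_right).smul contDiff_const),
      h.hasFDerivAt⟩

/-- The Wirtinger combination annihilates the `dz̄` part of the differential, and the normalization
of `Dz` cancels the `2πi` in `dzCLM`. -/
lemma RapidDecay.Dz_eq (h : RapidDecay c α β) :
    Dz (expSeries c α β) = expSeries (fun i => c i * α i) α β := by
  funext z
  rw [Dz, (h.hasFDerivAt z).fderiv]
  have h2 : (2 * Real.pi * Complex.I : ℂ) ≠ 0 := Complex.two_pi_I_ne_zero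
  simp only [dzCLM, dzbarCLM, add_apply, smul_apply, ContinuousLinearMap.id_apply, smul_eq_mul,
    ContinuousLinearEquiv.coe_coe, Complex.conjCLE_apply, map_one, Complex.conj_I]
  generalize (2 * Real.pi * Complex.I : ℂ) = p at h2 ⊢
  field_simp
  linear_combination (expSeries (fun i => c i * β i) α β z - expSeries (fun i => c i * α i) α β z) *
    Complex.I_sq

lemma RapidDecay.Dz_iterate (h : RapidDecay c α β) (k : ℕ) :
    RapidDecay (fun i => c i * α i ^ k) α β ∧
    Dz^[k] (expSeries c α β) = expSeries (fun i => c i * α i ^ k) α β := by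
  induction k with
  | zero => simpa using h
  | succ k ih =>
    rw [Function.iterate_succ_apply', ih.2, ih.1.Dz_eq]
    simpa only [pow_succ, ← mul_assoc, and_true] using ih.1.mul_left

lemma expSeries_zero (c α β : ι → ℂ) : expSeries c α β 0 = ∑' i, c i := by
  simp [expSeries, e_zero]

lemma contDiff_Dz {f : ℂ → ℂ} (hf : ContDiff ℝ ∞ f) : ContDiff ℝ ∞ (Dz f) := by
  have h : ContDiff ℝ ∞ (fderiv ℝ f) := (contDiff_infty_iff_fderiv.1 hf).2
  have h1 (v : ℂ) : ContDiff ℝ ∞ fun z => fderiv ℝ f z v := h.clm_apply contDiff_const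
  unfold Dz
  exact contDiff_const.mul (((h1 1).sub (contDiff_const.mul (h1 Complex.I))).div_const 2)

lemma Dz_add {f g : ℂ → ℂ} (hf : ContDiff ℝ ∞ f) (hg : ContDiff ℝ ∞ g) :
    Dz (f + g) = Dz f + Dz g := by
  funext z
  have hf' := (hf.differentiable (by simp)).differentiableAt (x := z)
  have hg' := (hg.differentiable (by simp)).differentiableAt (x := z)
  simp only [Dz, Pi.add_apply]
  rw [fderiv_add hf' hg']
  simp only [add_apply]
  ring

lemma contDiff_Dz_iterate {f : ℂ → ℂ} (hf : ContDiff ℝ ∞ f) (k : ℕ) : ContDiff ℝ ∞ (Dz^[k] f) := by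
  induction k with
  | zero => exact hf
  | succ k ih => rw [Function.iterate_succ_apply']; exact contDiff_Dz ih

lemma Dz_iterate_add {f g : ℂ → ℂ} (hf : ContDiff ℝ ∞ f) (hg : ContDiff ℝ ∞ g) (k : ℕ) :
    Dz^[k] (f + g) = Dz^[k] f + Dz^[k] g := by
  induction k with
  | zero => rfl
  | succ k ih =>
    simp only [Function.iterate_succ_apply', ih]
    exact Dz_add (contDiff_Dz_iterate hf k) (contDiff_Dz_iterate hg k)

/-- Gaussian coefficients on `ℤ²` decay faster than any exponential in linear frequencies. -/
lemma rapidDecay_gaussian {κ : ℤ × ℤ → ℂ} (hκ : ∀ p, ‖κ p‖ ≤ 1) {w v : ℂ} (hw : 0 < w.im) (hv : 0 < v.im)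
    {α β : ℤ × ℤ → ℂ} {M : ℝ} (hM : ∀ p : ℤ × ℤ, ‖α p‖ + ‖β p‖ ≤ M * (|p.1| + |p.2|)) :
    RapidDecay (fun p => κ p * e (p.1 ^ 2 * w + p.2 ^ 2 * v)) α β := by
  intro R
  -- Chosen so that the linear term `2π S |n|` in the standard bound for theta terms equals `|R| M
  -- |n|`.
  let S : ℝ := |R| * M / (2 * Real.pi)
  have h1 := summable_pow_mul_jacobiTheta₂_term_bound S (T := 2 * w.im) (by positivity) 0
  have h2 := summable_pow_mul_jacobiTheta₂_term_bound S (T := 2 * v.im) (by positivity) 0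
  simp only [pow_zero, one_mul] at h1 h2
  have h3 := h1.mul_of_nonneg h2 (fun _ => (Real.exp_pos _).le) (fun _ => (Real.exp_pos _).le)
  refine h3.of_nonneg_of_le (fun _ => by positivity) fun p => ?_
  rw [norm_mul, norm_e, mul_assoc, ← Real.exp_add, ← Real.exp_add]
  refine (mul_le_of_le_one_left (Real.exp_pos _).le (hκ p)).trans (Real.exp_le_exp.2 ?_)
  have hR : R * (‖α p‖ + ‖β p‖) ≤ |R| * (M * (|p.1| + |p.2|)) :=
    (mul_le_mul_of_nonneg_right (le_abs_self R) (by positivity)).trans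
      (mul_le_mul_of_nonneg_left (hM p) (abs_nonneg R))
  have him : ((p.1 : ℂ) ^ 2 * w + (p.2 : ℂ) ^ 2 * v).im = p.1 ^ 2 * w.im + p.2 ^ 2 * v.im := by
    rw [show (p.1 : ℂ) ^ 2 * w + (p.2 : ℂ) ^ 2 * v =
      ((p.1 ^ 2 : ℝ) : ℂ) * w + ((p.2 ^ 2 : ℝ) : ℂ) * v by push_cast; ring]
    simp only [Complex.add_im, Complex.im_ofReal_mul]
  rw [him]
  have hS : 2 * Real.pi * S = |R| * M := by simp only [S]; field_simp
  push_cast at hR ⊢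
  linear_combination hR - (|(p.1 : ℝ)| + |(p.2 : ℝ)|) * hS

end EtaTwentySix

/-! ### The four series as Gaussian sums over ℤ² -/

namespace EtaTwentySix

lemma neg_one_zpow_eq (k : ℤ) : ((-1 : ℂ) ^ k) = ((if k % 2 = 0 then 1 else -1 : ℤ) : ℂ) := by
  split_ifs with h
  · rw [Even.neg_one_zpow (Int.even_iff.2 h)]; simp
  · rw [Odd.neg_one_zpow (Int.odd_iff.2 (by lia))]; simp

lemma chi12_eq_mul (n : ℤ) :
    chi12 n = chi4 n * (if n % 3 = 1 then 1 else if n % 3 = 2 then -1 else 0) := by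
  have h : n % 12 = 0 ∨ n % 12 = 1 ∨ n % 12 = 2 ∨ n % 12 = 3 ∨ n % 12 = 4 ∨ n % 12 = 5 ∨ n % 12 = 6 ∨
    n % 12 = 7 ∨ n % 12 = 8 ∨ n % 12 = 9 ∨ n % 12 = 10 ∨ n % 12 = 11 := by lia
  have h4 : n % 4 = n % 12 % 4 := by lia
  have h3 : n % 3 = n % 12 % 3 := by lia
  unfold chi12 chi4
  rw [h4, h3]
  rcases h with h | h | h | h | h | h | h | h | h | h | h | h <;> rw [h] <;> rfl

/-- Separates the sign of the first sum into a factor in each variable, which is what lets that sum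
become a product of theta series. -/
lemma sign_eq_mul {n m : ℤ} (hn : n % 2 = 1) (hm : m % 2 = 0) :
    (if (n + m - 1) / 2 % 2 = 0 then 1 else -1 : ℤ) = chi4 n * altEven m := by
  unfold chi4 altEven
  have h1 : n % 4 = 1 ∨ n % 4 = 3 := by lia
  have h2 : m % 4 = 0 ∨ m % 4 = 2 := by lia
  rcases h1 with h1 | h1 <;> rcases h2 with h2 | h2 <;> rw [h1, h2]
  · rw [if_pos (by lia)]; rfl
  · rw [if_neg (by lia)]; rfl
  · rw [if_neg (by lia)]; rfl
  · rw [if_pos (by lia)]; rfl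

lemma chi12_of_even {n : ℤ} (hn : n % 2 = 0) : chi12 n = 0 := by
  unfold chi12; grind

lemma altEven_of_odd {n : ℤ} (hn : n % 2 = 1) : altEven n = 0 := by
  unfold altEven; grind

lemma oddInd_of_odd {n : ℤ} (hn : n % 2 = 1) : oddInd n = 1 := by
  unfold oddInd; grind

lemma term1_coeff (n m : ℤ) :
    (-1 : ℂ) ^ ((n + m - 1) / 2) * (kroneckerSym 4 (n * (m + 1)) : ℂ) * (kroneckerSym n 3 : ℂ) =
      chi12 n * altEven m := by
  rw [neg_one_zpow_eq, kroneckerSym_four, kroneckerSym_three, ← Int.cast_mul, ← Int.cast_mul, ← Int.cast_mul, Int.cast_inj]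
  by_cases hn : n % 2 = 1
  · by_cases hm : m % 2 = 0
    · rw [sign_eq_mul hn hm, chi12_eq_mul, if_pos]
      · ring
      · rw [← Int.odd_iff, Int.odd_mul, Int.odd_iff, Int.odd_iff]; lia
    · rw [altEven_of_odd (by lia), if_neg (c := n * (m + 1) % 2 = 1)]
      · ring
      · rw [← Int.odd_iff, Int.odd_mul, Int.odd_iff, Int.odd_iff]; lia
  · rw [chi12_of_even (by lia), if_neg (c := n * (m + 1) % 2 = 1)]
    · ring
    · rw [← Int.odd_iff, Int.odd_mul, Int.odd_iff, Int.odd_iff]; lia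

/-- Gaussian sums over `ℤ²` with coefficients `κ`. -/
noncomputable def gaussTerm (κ : ℤ × ℤ → ℤ) (x y w v : ℂ) (p : ℤ × ℤ) : ℂ :=
  (κ p : ℂ) * e (p.1 * x + p.2 * y + (p.1 ^ 2 * w + p.2 ^ 2 * v))

/-- The coefficients of the first sum. -/
def coeff1 (p : ℤ × ℤ) : ℤ := chi12 p.1 * altEven p.2

/-- The coefficients of the second sum. -/
def coeff2 (p : ℤ × ℤ) : ℤ :=
  if p.1 ≡ p.2 [ZMOD 8] ∨ p.1 ≡ -p.2 [ZMOD 8] then chi12 p.1 else 0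

/-- The coefficients of the difference of the third and the fourth sum. -/
def coeff3 (p : ℤ × ℤ) : ℤ := chi12 (p.1 + p.2) * chi12 (p.1 - p.2)

lemma abs_mul_le_one {a b : ℤ} (ha : |a| ≤ 1) (hb : |b| ≤ 1) : |a * b| ≤ 1 := by
  rw [abs_mul]; exact mul_le_one₀ ha (abs_nonneg _) hb

lemma abs_coeff1_le (p : ℤ × ℤ) : |coeff1 p| ≤ 1 := abs_mul_le_one (abs_chi12_le _) (abs_altEven_le _)

lemma abs_coeff2_le (p : ℤ × ℤ) : |coeff2 p| ≤ 1 := by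
  unfold coeff2; split_ifs
  · exact abs_chi12_le _
  · simp

lemma abs_coeff3_le (p : ℤ × ℤ) : |coeff3 p| ≤ 1 := abs_mul_le_one (abs_chi12_le _) (abs_chi12_le _)

lemma summable_gaussTerm {κ : ℤ × ℤ → ℤ} (hκ : ∀ p, |κ p| ≤ 1) (x y : ℂ) {w v : ℂ}
    (hw : 0 < w.im) (hv : 0 < v.im) : Summable (gaussTerm κ x y w v) := by
  have h := (summable_pairTerm (c := 1) (d := 1) (by simp) (by simp) x y hw hv).norm
  refine h.of_norm_bounded fun p => ?_
  rw [gaussTerm, pairTerm, norm_mul, norm_mul]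
  simpa using mul_le_of_le_one_left (norm_nonneg _) (norm_intCast_le_one (hκ p))

lemma term1_eq (x y : ℝ) (τ : ℂ) : term1 x y τ = gaussTerm coeff1 (x / 12) (y / 4) (τ / 12) (τ / 4) := by
  funext p
  rw [term1, term1_coeff, gaussTerm, coeff1, mul_assoc, mul_assoc, ← e_add, ← e_add]
  push_cast; congr 2; ring

lemma term2_eq (x y : ℝ) (τ : ℂ) : term2 x y τ = gaussTerm coeff2 (x / 24) (y / 8) (τ / 48) (τ / 16) := by
  funext p
  rw [term2, gaussTerm, coeff2]
  split_ifs
  · rw [kroneckerSym_twelve, mul_assoc, mul_assoc, ← e_add, ← e_add]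
    congr 2; ring
  · simp

/-- The coefficients of the third sum. -/
def coeffThird (p : ℤ × ℤ) : ℤ :=
  if (p.1 ≡ 1 [ZMOD 3] ∨ p.1 ≡ -1 [ZMOD 3]) ∧ p.2 ≡ 0 [ZMOD 3] then
    (if p.2 % 2 = 0 then 1 else -1) * (if (p.1 + p.2) % 2 = 1 then 1 else 0) else 0

/-- The coefficients of the fourth sum. -/
def coeffFourth (p : ℤ × ℤ) : ℤ :=
  if p.1 ≡ 0 [ZMOD 3] ∧ (p.2 ≡ 1 [ZMOD 3] ∨ p.2 ≡ -1 [ZMOD 3]) then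
    (if p.2 % 2 = 0 then 1 else -1) * (if (p.1 + p.2) % 2 = 1 then 1 else 0) else 0

lemma abs_coeffThird_le (p : ℤ × ℤ) : |coeffThird p| ≤ 1 := by
  unfold coeffThird; split_ifs <;> simp

lemma abs_coeffFourth_le (p : ℤ × ℤ) : |coeffFourth p| ≤ 1 := by
  unfold coeffFourth; split_ifs <;> simp

lemma term3_eq (x y : ℝ) (τ : ℂ) : term3 x y τ = gaussTerm coeffThird (x / 6) (y / 6) (τ / 12) (τ / 12) := by
  funext p
  rw [term3, gaussTerm, coeffThird]
  by_cases h : (p.1 ≡ 1 [ZMOD 3] ∨ p.1 ≡ -1 [ZMOD 3]) ∧ p.2 ≡ 0 [ZMOD 3]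
  · rw [if_pos h, if_pos h, kroneckerSym_four, neg_one_zpow_eq, Int.cast_mul, mul_assoc, mul_assoc,
      ← e_add, ← e_add]
    congr 2; ring
  · rw [if_neg h, if_neg h]; simp

lemma term4_eq (x y : ℝ) (τ : ℂ) : term4 x y τ = gaussTerm coeffFourth (x / 6) (y / 6) (τ / 12) (τ / 12) := by
  funext p
  rw [term4, gaussTerm, coeffFourth]
  by_cases h : p.1 ≡ 0 [ZMOD 3] ∧ (p.2 ≡ 1 [ZMOD 3] ∨ p.2 ≡ -1 [ZMOD 3])
  · rw [if_pos h, if_pos h, kroneckerSym_four, neg_one_zpow_eq, Int.cast_mul, mul_assoc, mul_assoc,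
      ← e_add, ← e_add]
    congr 2; ring
  · rw [if_neg h, if_neg h]; simp

/-- A nonzero product of `chi12` at `p.1 + p.2` and `p.1 - p.2` forces opposite parities and exactly
one coordinate divisible by 3. These are the supports of the two sums; the signs are checked modulo
12. -/
lemma coeffThird_sub_coeffFourth (p : ℤ × ℤ) : coeffThird p - coeffFourth p = coeff3 p := by
  have key : ∀ a ∈ Finset.range 12, ∀ b ∈ Finset.range 12,
      coeffThird ((a : ℤ), (b : ℤ)) - coeffFourth ((a : ℤ), (b : ℤ)) = coeff3 ((a : ℤ), (b : ℤ)) := by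
    decide
  have hh := key (p.1 % 12).toNat (by simp; lia) (p.2 % 12).toNat (by simp; lia)
  rw [Int.toNat_of_nonneg (by lia), Int.toNat_of_nonneg (by lia)] at hh
  have h3 : coeffThird p = coeffThird (p.1 % 12, p.2 % 12) := by
    simp only [coeffThird, Int.ModEq, show p.1 % 12 % 3 = p.1 % 3 by lia,
      show p.2 % 12 % 3 = p.2 % 3 by lia, show p.2 % 12 % 2 = p.2 % 2 by lia,
      show (p.1 % 12 + p.2 % 12) % 2 = (p.1 + p.2) % 2 by lia]
    congr
  have h4 : coeffFourth p = coeffFourth (p.1 % 12, p.2 % 12) := by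
    simp only [coeffFourth, Int.ModEq, show p.1 % 12 % 3 = p.1 % 3 by lia,
      show p.2 % 12 % 3 = p.2 % 3 by lia, show p.2 % 12 % 2 = p.2 % 2 by lia,
      show (p.1 % 12 + p.2 % 12) % 2 = (p.1 + p.2) % 2 by lia]
    congr
  have h12 : ∀ m k : ℤ, m % 12 = k % 12 → chi12 m = chi12 k := by
    intro m k h; unfold chi12; rw [h]
  rw [h3, h4, hh, coeff3, coeff3, h12 (p.1 + p.2) (p.1 % 12 + p.2 % 12) (by lia),
    h12 (p.1 - p.2) (p.1 % 12 - p.2 % 12) (by lia)]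

section

variable {τ : ℂ}

lemma summable_terms (hτ : 0 < τ.im) (x y : ℝ) : Summable (term1 x y τ) ∧ Summable (term2 x y τ) ∧
    Summable (term3 x y τ) ∧ Summable (term4 x y τ) := by
  rw [term1_eq, term2_eq, term3_eq, term4_eq]
  exact ⟨summable_gaussTerm abs_coeff1_le _ _ (by simpa using hτ) (by simpa using hτ),
    summable_gaussTerm abs_coeff2_le _ _ (by simpa using hτ) (by simpa using hτ),
    summable_gaussTerm abs_coeffThird_le _ _ (by simpa using hτ) (by simpa using hτ),
    summable_gaussTerm abs_coeffFourth_le _ _ (by simpa using hτ) (by simpa using hτ)⟩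

lemma phi26_eq (hτ : 0 < τ.im) (z : ℂ) : phi26 z τ =
    1 / 2 * ∑' p, gaussTerm coeff1 (z.re / 6) (z.im / (2 * √3 : ℝ)) (τ / 12) (τ / 4) p
    + 1 / 4 * ∑' p, gaussTerm coeff2 (z.re / 12) (z.im / (4 * √3 : ℝ)) (τ / 48) (τ / 16) p
    - 1 / 2 * ∑' p, gaussTerm coeff3 (z.re / 6) (z.im / 6) (τ / 12) (τ / 12) p := by
  have h34 : ∑' p, gaussTerm coeff3 (z.re / 6) (z.im / 6) (τ / 12) (τ / 12) p =
      ∑' p, term3 z.re z.im τ p - ∑' p, term4 z.re z.im τ p := by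
    obtain ⟨-, -, h3, h4⟩ := summable_terms hτ z.re z.im
    rw [← h3.tsum_sub h4, term3_eq, term4_eq]
    refine tsum_congr fun p => ?_
    rw [gaussTerm, gaussTerm, gaussTerm, ← coeffThird_sub_coeffFourth]
    push_cast; ring
  rw [phi26, h34, term1_eq, term2_eq]
  push_cast
  rw [show (2 * z.re / 12 : ℂ) = z.re / 6 by ring, show (2 * z.re / 24 : ℂ) = z.re / 12 by ring,
    show (2 * z.im / (√3 : ℝ) / 4 : ℂ) = z.im / (2 * (√3 : ℝ)) by field_simp; ring,
    show (2 * z.im / (√3 : ℝ) / 8 : ℂ) = z.im / (4 * (√3 : ℝ)) by field_simp; ring]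
  ring

end

end EtaTwentySix

/-! ### The expression through theta functions -/

namespace EtaTwentySix

lemma e_eighth_pow_four : e (1 / 8) ^ 4 = -1 := by
  rw [← e_nat_mul, ← e_half]; norm_num

lemma e_eighth_sq : e (1 / 8) ^ 2 = Complex.I := by
  rw [← e_nat_mul, ← e_quarter]; norm_num

lemma e_int_div_eight {n : ℤ} {r : ℕ} (h : n % 8 = r) : e (n / 8) = e (1 / 8) ^ r := by
  have h : ((n : ℂ) / 8) = (r : ℂ) * (1 / 8) + (n / 8 : ℤ) := by
    have : (n : ℂ) = (r : ℂ) + 8 * ((n / 8 : ℤ) : ℂ) := by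
      exact_mod_cast (by lia : n = (r : ℤ) + 8 * (n / 8))
    rw [this]; ring
  rw [h, e_add_int, e_nat_mul]

/-- The arguments of the theta series are halved, so shifts by `±1/4` become `e(±n/8)`, and the
further `1/2` in `θ₂*` turns `1/8` into `3/8`. For odd `n`, `m` the root-of-unity combination
detects `n ≡ ± m` modulo 8. -/
lemma coeff2_eq (n m : ℤ) :
    1 / 8 * (chi12 n * oddInd m : ℂ) +
    1 / 16 * ((chi12 n * oddInd m : ℂ) * (e (n / 8) * e (-m / 8)) +
      -Complex.I * ((chi12 n * chi4 m : ℂ) * (e (n * 3 / 8) * e (-m / 8)))) +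
    1 / 16 * ((chi12 n * oddInd m : ℂ) * (e (n / 8) * e (m / 8)) -
      -Complex.I * ((chi12 n * chi4 m : ℂ) * (e (n * 3 / 8) * e (m / 8)))) =
    1 / 4 * (coeff2 (n, m) : ℂ) := by
  by_cases hn : n % 2 = 1
  swap
  · rw [coeff2, chi12_of_even (by lia)]; simp
  by_cases hm : m % 2 = 1
  swap
  · rw [coeff2, if_neg (by simp only [Int.ModEq]; lia), oddInd, if_neg hm, chi4, if_neg (by lia),
      if_neg (by lia)]
    simp
  have hpos : n % 8 = m % 8 ∨ n % 8 + m % 8 = 8 → coeff2 (n, m) = chi12 n := fun h =>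
    if_pos (by simp only [Int.ModEq]; lia)
  have hneg : ¬ (n % 8 = m % 8 ∨ n % 8 + m % 8 = 8) → coeff2 (n, m) = 0 := fun h =>
    if_neg (by simp only [Int.ModEq]; lia)
  rw [oddInd_of_odd hm]
  have hu := e_eighth_pow_four
  rw [← e_eighth_sq]
  have h1 : n % 8 = 1 ∨ n % 8 = 3 ∨ n % 8 = 5 ∨ n % 8 = 7 := by lia
  have h2 : m % 8 = 1 ∨ m % 8 = 3 ∨ m % 8 = 5 ∨ m % 8 = 7 := by lia
  have e1 : ∀ {r : ℕ}, n % 8 = r → e (n / 8) = e (1 / 8) ^ r := fun h => e_int_div_eight h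
  have e2 : ∀ {r : ℕ}, (n * 3) % 8 = r → e (n * 3 / 8) = e (1 / 8) ^ r := fun h => by
    rw [← e_int_div_eight h]; push_cast; rfl
  have e3 : ∀ {r : ℕ}, m % 8 = r → e (m / 8) = e (1 / 8) ^ r := fun h => e_int_div_eight h
  have e4 : ∀ {r : ℕ}, (-m) % 8 = r → e (-m / 8) = e (1 / 8) ^ r := fun h => by
    rw [← e_int_div_eight h]; push_cast; rfl
  have hc : (chi4 m = 1 ∧ m % 4 = 1) ∨ (chi4 m = -1 ∧ m % 4 = 3) := by unfold chi4; grind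
  -- In the remaining sixteen cases only the relation `u⁴ = -1` is needed, with `i = u²`.
  generalize e (1 / 8) = u at *
  rcases h1 with h1 | h1 | h1 | h1
  · rw [e1 (r := 1) (by lia), e2 (r := 3) (by lia)]
    rcases h2 with h2 | h2 | h2 | h2
    · rw [e3 (r := 1) (by lia), e4 (r := 7) (by lia), (by lia : chi4 m = 1), hpos (by lia)]
      push_cast
      clear e1 e2 e3 e4 hc hpos hneg
      grind
    · rw [e3 (r := 3) (by lia), e4 (r := 5) (by lia), (by lia : chi4 m = -1), hneg (by lia)]
      push_cast
      clear e1 e2 e3 e4 hc hpos hneg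
      grind
    · rw [e3 (r := 5) (by lia), e4 (r := 3) (by lia), (by lia : chi4 m = 1), hneg (by lia)]
      push_cast
      clear e1 e2 e3 e4 hc hpos hneg
      grind
    · rw [e3 (r := 7) (by lia), e4 (r := 1) (by lia), (by lia : chi4 m = -1), hpos (by lia)]
      push_cast
      clear e1 e2 e3 e4 hc hpos hneg
      grind
  · rw [e1 (r := 3) (by lia), e2 (r := 1) (by lia)]
    rcases h2 with h2 | h2 | h2 | h2
    · rw [e3 (r := 1) (by lia), e4 (r := 7) (by lia), (by lia : chi4 m = 1), hneg (by lia)]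
      push_cast
      clear e1 e2 e3 e4 hc hpos hneg
      grind
    · rw [e3 (r := 3) (by lia), e4 (r := 5) (by lia), (by lia : chi4 m = -1), hpos (by lia)]
      push_cast
      clear e1 e2 e3 e4 hc hpos hneg
      grind
    · rw [e3 (r := 5) (by lia), e4 (r := 3) (by lia), (by lia : chi4 m = 1), hpos (by lia)]
      push_cast
      clear e1 e2 e3 e4 hc hpos hneg
      grind
    · rw [e3 (r := 7) (by lia), e4 (r := 1) (by lia), (by lia : chi4 m = -1), hneg (by lia)]
      push_cast
      clear e1 e2 e3 e4 hc hpos hneg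
      grind
  · rw [e1 (r := 5) (by lia), e2 (r := 7) (by lia)]
    rcases h2 with h2 | h2 | h2 | h2
    · rw [e3 (r := 1) (by lia), e4 (r := 7) (by lia), (by lia : chi4 m = 1), hneg (by lia)]
      push_cast
      clear e1 e2 e3 e4 hc hpos hneg
      grind
    · rw [e3 (r := 3) (by lia), e4 (r := 5) (by lia), (by lia : chi4 m = -1), hpos (by lia)]
      push_cast
      clear e1 e2 e3 e4 hc hpos hneg
      grind
    · rw [e3 (r := 5) (by lia), e4 (r := 3) (by lia), (by lia : chi4 m = 1), hpos (by lia)]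
      push_cast
      clear e1 e2 e3 e4 hc hpos hneg
      grind
    · rw [e3 (r := 7) (by lia), e4 (r := 1) (by lia), (by lia : chi4 m = -1), hneg (by lia)]
      push_cast
      clear e1 e2 e3 e4 hc hpos hneg
      grind
  · rw [e1 (r := 7) (by lia), e2 (r := 5) (by lia)]
    rcases h2 with h2 | h2 | h2 | h2
    · rw [e3 (r := 1) (by lia), e4 (r := 7) (by lia), (by lia : chi4 m = 1), hpos (by lia)]
      push_cast
      clear e1 e2 e3 e4 hc hpos hneg
      grind
    · rw [e3 (r := 3) (by lia), e4 (r := 5) (by lia), (by lia : chi4 m = -1), hneg (by lia)]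
      push_cast
      clear e1 e2 e3 e4 hc hpos hneg
      grind
    · rw [e3 (r := 5) (by lia), e4 (r := 3) (by lia), (by lia : chi4 m = 1), hneg (by lia)]
      push_cast
      clear e1 e2 e3 e4 hc hpos hneg
      grind
    · rw [e3 (r := 7) (by lia), e4 (r := 1) (by lia), (by lia : chi4 m = -1), hpos (by lia)]
      push_cast
      clear e1 e2 e3 e4 hc hpos hneg
      grind

section

variable {τ : ℂ}

lemma hasSum_pairTerm {c d : ℤ → ℤ} (hc : ∀ n, |c n| ≤ 1) (hd : ∀ n, |d n| ≤ 1) (x y : ℂ) {w v : ℂ}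
    (hw : 0 < w.im) (hv : 0 < v.im) :
    HasSum (pairTerm c d x y w v) (thetaSeries c x w * thetaSeries d y v) := by
  rw [thetaSeries_mul hc hd x y hw hv]
  exact (summable_pairTerm hc hd x y hw hv).hasSum

lemma tsum_coeff1 (hτ : 0 < τ.im) (x y : ℂ) :
    ∑' p, gaussTerm coeff1 (x / 12) (y / 4) (τ / 12) (τ / 4) p =
      thetaStar (x / 6) (2 * τ) * theta4 (y / 2) (2 * τ) := by
  have h2 : 0 < (2 * τ).im := by simpa using hτ
  rw [thetaStar_eq_thetaSeries _ h2, theta4_eq_thetaSeries _ h2, thetaSeries_mul abs_chi12_le abs_altEven_le]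
  · refine tsum_congr fun p => ?_
    rw [gaussTerm, pairTerm, coeff1]; push_cast; congr 2; ring
  · simpa using hτ
  · simpa using hτ

lemma tsum_coeff2 (hτ : 0 < τ.im) (x y : ℂ) :
    1 / 4 * ∑' p, gaussTerm coeff2 (x / 24) (y / 8) (τ / 48) (τ / 16) p =
      1 / 8 * thetaStar (x / 12) (τ / 2) * theta2 (y / 4) (τ / 2)
        + 1 / 16 * (thetaStar (x / 12 + 1 / 4) (τ / 2) * theta2 (y / 4 - 1 / 4) (τ / 2)
          + theta2Star (x / 12 + 1 / 4) (τ / 2) * theta (y / 4 - 1 / 4) (τ / 2))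
        + 1 / 16 * (thetaStar (x / 12 + 1 / 4) (τ / 2) * theta2 (y / 4 + 1 / 4) (τ / 2)
          - theta2Star (x / 12 + 1 / 4) (τ / 2) * theta (y / 4 + 1 / 4) (τ / 2)) := by
  have h2 : 0 < (τ / 2).im := by simpa using hτ
  have hw : 0 < (τ / 2 / 24).im := by simpa using hτ
  have hv : 0 < (τ / 2 / 8).im := by simpa using hτ
  simp only [theta2Star, thetaStar_eq_thetaSeries _ h2, theta2_eq_thetaSeries _ h2,
    theta_eq_thetaSeries _ h2]
  rw [mul_assoc (1 / 8 : ℂ), mul_assoc (-Complex.I), mul_assoc (-Complex.I)]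
  have H1 (y' : ℂ) := hasSum_pairTerm abs_chi12_le abs_oddInd_le (x / 12 / 2) y' hw hv
  have H2 (y' : ℂ) := hasSum_pairTerm abs_chi12_le abs_oddInd_le ((x / 12 + 1 / 4) / 2) y' hw hv
  have H3 (y' : ℂ) := hasSum_pairTerm abs_chi12_le abs_chi4_le ((x / 12 + 1 / 4 + 1 / 2) / 2) y' hw hv
  have H := (((H1 (y / 4 / 2)).mul_left (1 / 8)).add
    (((H2 ((y / 4 - 1 / 4) / 2)).add ((H3 ((y / 4 - 1 / 4) / 2)).mul_left (-Complex.I))).mul_left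
      (1 / 16))).add
    (((H2 ((y / 4 + 1 / 4) / 2)).sub ((H3 ((y / 4 + 1 / 4) / 2)).mul_left (-Complex.I))).mul_left
      (1 / 16))
  rw [← H.tsum_eq, ← tsum_mul_left]
  refine tsum_congr fun p => ?_
  have hE : ∀ a b : ℂ, e (p.1 * (x / 24 + a) + p.2 * (y / 8 + b) +
      (p.1 ^ 2 * (τ / 2 / 24) + p.2 ^ 2 * (τ / 2 / 8))) =
      e (p.1 * a) * e (p.2 * b) *
        e (p.1 * (x / 24) + p.2 * (y / 8) + (p.1 ^ 2 * (τ / 48) + p.2 ^ 2 * (τ / 16))) := by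
    intro a b
    rw [← e_add, ← e_add]; ring_nf
  simp only [pairTerm, gaussTerm]
  rw [show x / 12 / 2 = x / 24 + 0 by ring, show y / 4 / 2 = y / 8 + 0 by ring,
    show (x / 12 + 1 / 4) / 2 = x / 24 + 1 / 8 by ring,
    show (x / 12 + 1 / 4 + 1 / 2) / 2 = x / 24 + 3 / 8 by ring,
    show (y / 4 - 1 / 4) / 2 = y / 8 + (-1 / 8) by ring,
    show (y / 4 + 1 / 4) / 2 = y / 8 + 1 / 8 by ring]
  simp only [hE, mul_zero, e_zero, one_mul]
  have h := coeff2_eq p.1 p.2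
  rw [show (p.1 : ℂ) / 8 = p.1 * (1 / 8) by ring, show (p.1 : ℂ) * 3 / 8 = p.1 * (3 / 8) by ring,
    show -(p.2 : ℂ) / 8 = p.2 * (-1 / 8) by ring, show (p.2 : ℂ) / 8 = p.2 * (1 / 8) by ring] at h
  linear_combination (-e (p.1 * (x / 24) + p.2 * (y / 8) + (p.1 ^ 2 * (τ / 48) + p.2 ^ 2 * (τ / 16)))) * h

/-- Both `chi12` factors vanish on even integers, so the product series is supported on pairs of odd
integers, all of which have the form `(n + m, n - m)`. -/
lemma tsum_coeff3 (hτ : 0 < τ.im) (x y : ℂ) :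
    ∑' p, gaussTerm coeff3 (x / 6) (y / 6) (τ / 12) (τ / 12) p =
      thetaStar ((x + y) / 6) τ * thetaStar ((x - y) / 6) τ := by
  have hw : 0 < (τ / 24).im := by simpa using hτ
  rw [thetaStar_eq_thetaSeries _ hτ, thetaStar_eq_thetaSeries _ hτ,
    thetaSeries_mul abs_chi12_le abs_chi12_le _ _ hw hw]
  have hinj : Function.Injective fun p : ℤ × ℤ => (p.1 + p.2, p.1 - p.2) := fun p q h => by
    simp only [Prod.mk.injEq] at h; ext <;> lia
  symm
  rw [← hinj.tsum_eq]
  · refine tsum_congr fun p => ?_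
    rw [gaussTerm, pairTerm, coeff3]; push_cast; congr 2; ring
  · intro p hp
    rw [Function.mem_support, pairTerm] at hp
    have h1 : p.1 % 2 = 1 := by
      by_contra h; exact hp (by rw [chi12_of_even (n := p.1) (by lia)]; simp)
    have h2 : p.2 % 2 = 1 := by
      by_contra h; exact hp (by rw [chi12_of_even (n := p.2) (by lia)]; simp)
    exact ⟨((p.1 + p.2) / 2, (p.1 - p.2) / 2), by ext <;> simp only <;> lia⟩

lemma phi26_eq_theta (hτ : 0 < τ.im) (z : ℂ) (z₁ z₂ z₃ z₄ : ℝ) (h : z = z₁ + Complex.I * z₂)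
    (h' : z = (z₃ + Complex.I * (√3 : ℝ) * z₄) / 2) :
    phi26 z τ =
      1 / 2 * thetaStar (z₃ / 6) (2 * τ) * theta4 (z₄ / 2) (2 * τ)
      + 1 / 8 * thetaStar (z₃ / 12) (τ / 2) * theta2 (z₄ / 4) (τ / 2)
      + 1 / 16 * (thetaStar (z₃ / 12 + 1 / 4) (τ / 2) * theta2 (z₄ / 4 - 1 / 4) (τ / 2)
        + theta2Star (z₃ / 12 + 1 / 4) (τ / 2) * theta (z₄ / 4 - 1 / 4) (τ / 2))
      + 1 / 16 * (thetaStar (z₃ / 12 + 1 / 4) (τ / 2) * theta2 (z₄ / 4 + 1 / 4) (τ / 2)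
        - theta2Star (z₃ / 12 + 1 / 4) (τ / 2) * theta (z₄ / 4 + 1 / 4) (τ / 2))
      - 1 / 2 * thetaStar ((z₁ + z₂) / 6) τ * thetaStar ((z₁ - z₂) / 6) τ := by
  have e1 : z.re = z₁ := by rw [h]; simp
  have e2 : z.im = z₂ := by rw [h]; simp
  have e3 : z.re = z₃ / 2 := by rw [h']; simp
  have e4 : z.im = √3 * z₄ / 2 := by rw [h']; simp
  have h3 : √3 ≠ 0 := by positivity
  have f3 : (z.re : ℂ) / 6 = z₃ / 12 := by rw [e3]; push_cast; ring
  have f3' : (z.re : ℂ) / 12 = z₃ / 24 := by rw [e3]; push_cast; ring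
  have f4 : (z.im : ℂ) / (2 * √3 : ℝ) = z₄ / 4 := by
    rw [e4]; norm_cast; field_simp; ring
  have f4' : (z.im : ℂ) / (4 * √3 : ℝ) = z₄ / 8 := by
    rw [e4]; norm_cast; field_simp; ring
  have t1 := tsum_coeff1 hτ z₃ z₄
  have t2 := tsum_coeff2 hτ z₃ z₄
  have t3 := tsum_coeff3 hτ z₁ z₂
  rw [phi26_eq hτ, f4, f4', f3', show ∑' p, gaussTerm coeff1 (z.re / 6) (z₄ / 4) (τ / 12) (τ / 4) p =
    ∑' p, gaussTerm coeff1 (z₃ / 12) (z₄ / 4) (τ / 12) (τ / 4) p by rw [f3], e1, e2, t1, t2, t3]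
  ring

end

end EtaTwentySix

/-! ### The twelfth derivative as lattice sums -/

namespace EtaTwentySix

open ComplexConjugate

/-- The lattice sum `∑ κ(n, m) (n - i s m)¹² e((n² + B m²) τ / 12)`. -/
noncomputable def latticeSum (κ : ℤ × ℤ → ℤ) (s : ℝ) (B : ℕ) (τ : ℂ) : ℂ :=
  ∑' p : ℤ × ℤ, (κ p : ℂ) * (p.1 - Complex.I * s * p.2) ^ 12 * e ((p.1 ^ 2 + B * p.2 ^ 2) / 12 * τ)

/-- The coefficients of the expansion of a scaled `gaussTerm` series. -/
noncomputable def gaussCoeff (r : ℂ) (κ : ℤ × ℤ → ℤ) (w v : ℂ) (p : ℤ × ℤ) : ℂ :=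
  (r * κ p) * e (p.1 ^ 2 * w + p.2 ^ 2 * v)

/-- The frequency of `e(n a Re z + m b Im z)` with respect to `z`. -/
noncomputable def freq (a b : ℝ) (p : ℤ × ℤ) : ℂ := (p.1 * a - Complex.I * b * p.2) / 2

lemma norm_freq_le (a b : ℝ) (p : ℤ × ℤ) : ‖freq a b p‖ ≤ (|a| + |b|) / 2 * (|p.1| + |p.2|) := by
  have h : ‖(p.1 * a - Complex.I * b * p.2 : ℂ)‖ ≤ |(p.1 : ℝ)| * |a| + |b| * |(p.2 : ℝ)| := by
    refine (norm_sub_le _ _).trans_eq ?_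
    simp [Complex.norm_real, Complex.norm_intCast]
  rw [freq, norm_div]
  simp only [Complex.norm_ofNat]
  push_cast at h ⊢
  nlinarith [abs_nonneg a, abs_nonneg b, abs_nonneg (p.1 : ℝ), abs_nonneg (p.2 : ℝ)]

lemma rapidDecay_gaussCoeff {r : ℂ} (hr : ‖r‖ ≤ 1) {κ : ℤ × ℤ → ℤ} (hκ : ∀ p, |κ p| ≤ 1) {w v : ℂ}
    (hw : 0 < w.im) (hv : 0 < v.im) (a b : ℝ) :
    RapidDecay (gaussCoeff r κ w v) (freq a b) (freq a (-b)) := by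
  refine rapidDecay_gaussian (κ := fun p => r * κ p) (fun p => ?_) hw hv (M := |a| + |b|) fun p => ?_
  · rw [norm_mul]
    exact mul_le_one₀ hr (norm_nonneg _) (norm_intCast_le_one (hκ p))
  · have h1 := norm_freq_le a b p
    have h2 := norm_freq_le a (-b) p
    rw [abs_neg] at h2
    linarith

lemma tsum_gaussTerm_eq_expSeries (r : ℂ) (κ : ℤ × ℤ → ℤ) (w v : ℂ) (a b : ℝ) (z : ℂ) :
    r * ∑' p, gaussTerm κ (a * z.re) (b * z.im) w v p =
      expSeries (gaussCoeff r κ w v) (freq a b) (freq a (-b)) z := by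
  rw [expSeries, ← tsum_mul_left]
  refine tsum_congr fun p => ?_
  have h : freq a b p * z + freq a (-b) p * conj z = p.1 * (a * z.re) + p.2 * (b * z.im) := by
    have h1 := Complex.add_conj z
    have h2 := Complex.sub_conj z
    simp only [freq]
    push_cast at h1 h2 ⊢
    linear_combination (p.1 * a / 2 : ℂ) * h1 - (Complex.I * b * p.2 / 2 : ℂ) * h2 -
      (b * p.2 * z.im : ℂ) * Complex.I_sq
  rw [h, gaussTerm, gaussCoeff, e_add]
  ring

section

variable {τ : ℂ}

lemma phi26_eq_expSeries (hτ : 0 < τ.im) : (fun z => phi26 z τ) =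
    expSeries (gaussCoeff (1 / 2) coeff1 (τ / 12) (τ / 4)) (freq (1 / 6) (√3 / 6)) (freq (1 / 6) (-(√3 / 6)))
    + expSeries (gaussCoeff (1 / 4) coeff2 (τ / 48) (τ / 16)) (freq (1 / 12) (√3 / 12))
      (freq (1 / 12) (-(√3 / 12)))
    + expSeries (gaussCoeff (-1 / 2) coeff3 (τ / 12) (τ / 12)) (freq (1 / 6) (1 / 6))
      (freq (1 / 6) (-(1 / 6))) := by
  funext z
  have h3 : (√3 : ℝ) ≠ 0 := by positivity
  have hs : (√3 : ℝ) * √3 = 3 := Real.mul_self_sqrt (by norm_num)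
  have f1 : (z.im : ℂ) / (2 * √3 : ℝ) = ((√3 / 6 : ℝ) : ℂ) * z.im := by
    norm_cast; field_simp; rw [sq, hs]; ring
  have f2 : (z.im : ℂ) / (4 * √3 : ℝ) = ((√3 / 12 : ℝ) : ℂ) * z.im := by
    norm_cast; field_simp; rw [sq, hs]; ring
  have f3 : (z.im : ℂ) / 6 = ((1 / 6 : ℝ) : ℂ) * z.im := by push_cast; ring
  have f4 : (z.re : ℂ) / 6 = ((1 / 6 : ℝ) : ℂ) * z.re := by push_cast; ring
  have f5 : (z.re : ℂ) / 12 = ((1 / 12 : ℝ) : ℂ) * z.re := by push_cast; ring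
  rw [Pi.add_apply, Pi.add_apply, ← tsum_gaussTerm_eq_expSeries, ← tsum_gaussTerm_eq_expSeries,
    ← tsum_gaussTerm_eq_expSeries, phi26_eq hτ, f1, f2, f3, f4, f5]
  ring

lemma contDiff_phi26 (hτ : 0 < τ.im) : ContDiff ℝ ∞ fun z => phi26 z τ := by
  rw [phi26_eq_expSeries hτ]
  exact ((rapidDecay_gaussCoeff (by norm_num) abs_coeff1_le (by simpa using hτ) (by simpa using hτ)
    _ _).contDiff.add (rapidDecay_gaussCoeff (by norm_num) abs_coeff2_le (by simpa using hτ)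
    (by simpa using hτ) _ _).contDiff).add (rapidDecay_gaussCoeff (by norm_num) abs_coeff3_le
    (by simpa using hτ) (by simpa using hτ) _ _).contDiff

/-- The first and third sums have frequencies `(n - i√3 m)/12` and `(n - i m)/12`. Those of the
second are half as large as in the first, so its weight is `1/4 · 2⁻¹² = 2⁻¹⁴` once `12¹²` is
factored out; its exponents are those of the first form at `τ/4`. -/
lemma Dz_iterate_phi26 (hτ : 0 < τ.im) : Dz^[12] (fun z => phi26 z τ) 0 =
    (1 / 2 * latticeSum coeff1 √3 3 τ + 1 / 2 ^ 14 * latticeSum coeff2 √3 3 (τ / 4)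
      - 1 / 2 * latticeSum coeff3 1 1 τ) / 12 ^ 12 := by
  have r1 := rapidDecay_gaussCoeff (r := 1 / 2) (by norm_num) abs_coeff1_le (w := τ / 12) (v := τ / 4)
    (by simpa using hτ) (by simpa using hτ) (1 / 6) (√3 / 6)
  have r2 := rapidDecay_gaussCoeff (r := 1 / 4) (by norm_num) abs_coeff2_le (w := τ / 48) (v := τ / 16)
    (by simpa using hτ) (by simpa using hτ) (1 / 12) (√3 / 12)
  have r3 := rapidDecay_gaussCoeff (r := -1 / 2) (by norm_num) abs_coeff3_le (w := τ / 12) (v := τ / 12)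
    (by simpa using hτ) (by simpa using hτ) (1 / 6) (1 / 6)
  have r12 : ContDiff ℝ ∞ (expSeries (gaussCoeff (1 / 2) coeff1 (τ / 12) (τ / 4)) (freq (1 / 6) (√3 / 6))
      (freq (1 / 6) (-(√3 / 6))) + expSeries (gaussCoeff (1 / 4) coeff2 (τ / 48) (τ / 16))
      (freq (1 / 12) (√3 / 12)) (freq (1 / 12) (-(√3 / 12)))) := r1.contDiff.add r2.contDiff
  rw [phi26_eq_expSeries hτ, Dz_iterate_add r12 r3.contDiff,
    Dz_iterate_add r1.contDiff r2.contDiff, Pi.add_apply, Pi.add_apply, (r1.Dz_iterate 12).2,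
    (r2.Dz_iterate 12).2, (r3.Dz_iterate 12).2, expSeries_zero, expSeries_zero, expSeries_zero,
    latticeSum, latticeSum, latticeSum, sub_eq_add_neg, ← neg_mul, add_div, add_div, mul_div_right_comm,
    mul_div_right_comm, mul_div_right_comm, ← tsum_mul_left, ← tsum_mul_left, ← tsum_mul_left]
  congr 1
  · congr 1 <;> refine tsum_congr fun p => ?_
    · rw [gaussCoeff, freq, show (p.1 ^ 2 + (3 : ℕ) * p.2 ^ 2 : ℂ) / 12 * τ =
        p.1 ^ 2 * (τ / 12) + p.2 ^ 2 * (τ / 4) by push_cast; ring]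
      push_cast; ring
    · rw [gaussCoeff, freq, show (p.1 ^ 2 + (3 : ℕ) * p.2 ^ 2 : ℂ) / 12 * (τ / 4) =
        p.1 ^ 2 * (τ / 48) + p.2 ^ 2 * (τ / 16) by push_cast; ring]
      push_cast; ring
  · refine tsum_congr fun p => ?_
    rw [gaussCoeff, freq, show (p.1 ^ 2 + (1 : ℕ) * p.2 ^ 2 : ℂ) / 12 * τ =
        p.1 ^ 2 * (τ / 12) + p.2 ^ 2 * (τ / 12) by push_cast; ring]
    push_cast; ring

end

end EtaTwentySix

/-! ### Inversion formulas for the theta series -/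

namespace EtaTwentySix

/-- The principal branch of `√(-iτ)`. -/
noncomputable def sqrtNegI (τ : ℂ) : ℂ := (-Complex.I * τ) ^ (1 / 2 : ℂ)

lemma sqrtNegI_sq (τ : ℂ) : sqrtNegI τ * sqrtNegI τ = -Complex.I * τ := by
  rw [← sq, sqrtNegI, ← Complex.cpow_nat_mul]; norm_num

lemma sqrtNegI_three_mul {τ : ℂ} (hτ : τ ≠ 0) : sqrtNegI (3 * τ) = (√3 : ℝ) * sqrtNegI τ := by
  have h0 : -Complex.I * τ ≠ 0 := mul_ne_zero (neg_ne_zero.2 Complex.I_ne_zero) hτ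
  have h3 : ((3 : ℝ) : ℂ) ≠ 0 := by norm_num
  rw [sqrtNegI, sqrtNegI, show -Complex.I * (3 * τ) = ((3 : ℝ) : ℂ) * (-Complex.I * τ) by push_cast; ring,
    Complex.cpow_def_of_ne_zero (mul_ne_zero h3 h0), Complex.cpow_def_of_ne_zero h0,
    Complex.log_ofReal_mul (by norm_num) h0, add_mul, Complex.exp_add, Real.sqrt_eq_rpow,
    Complex.ofReal_cpow (by norm_num), Complex.cpow_def_of_ne_zero h3, Complex.ofReal_log (by norm_num)]
  push_cast; rfl

lemma jacobiTheta₂_S (z : ℂ) {τ : ℂ} (hτ : τ ≠ 0) :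
    jacobiTheta₂ (z / τ) (-1 / τ) = sqrtNegI τ * e (z ^ 2 / (2 * τ)) * jacobiTheta₂ z τ := by
  have h0 : -Complex.I * τ ≠ 0 := mul_ne_zero (neg_ne_zero.2 Complex.I_ne_zero) hτ
  have h1 : (-Complex.I * τ) ^ (1 / 2 : ℂ) ≠ 0 := by simp [Complex.cpow_eq_zero_iff, hτ]
  rw [jacobiTheta₂_functional_equation z τ, sqrtNegI]
  have h2 : e (z ^ 2 / (2 * τ)) * Complex.exp (-Real.pi * Complex.I * z ^ 2 / τ) = 1 := by
    rw [e, ← Complex.exp_add, ← Complex.exp_zero]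
    congr 1; field_simp; ring
  linear_combination (-jacobiTheta₂ (z / τ) (-1 / τ)) * h2 + (-jacobiTheta₂ (z / τ) (-1 / τ) *
    e (z ^ 2 / (2 * τ)) * Complex.exp (-Real.pi * Complex.I * z ^ 2 / τ)) * (mul_one_div_cancel h1)

lemma thetaSeries_altEven (z τ : ℂ) :
    thetaSeries altEven (z / 2) (τ / 8) = jacobiTheta₂ (z + 1 / 2) τ := by
  have hinj : Function.Injective fun r : ℤ => 2 * r := fun a b h => by simp only at h; lia
  rw [thetaSeries, ← hinj.tsum_eq, jacobiTheta₂]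
  · refine tsum_congr fun r => ?_
    have hr : (altEven (2 * r) : ℂ) = e (r / 2) := by
      rw [e_int_div_two, neg_one_zpow_eq, Int.cast_inj]
      unfold altEven; grind
    rw [hr, ← e_add, jacobiTheta₂_term, e]
    push_cast; ring_nf
  · intro n hn
    have : n % 2 = 0 := by
      by_contra h; exact hn (by simp only [altEven_of_odd (n := n) (by lia)]; simp)
    exact ⟨n / 2, by simp only; lia⟩

lemma thetaSeries_oddInd (z τ : ℂ) :
    thetaSeries oddInd (z / 2) (τ / 8) = e (z / 2 + τ / 8) * jacobiTheta₂ (z + τ / 2) τ := by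
  have hinj : Function.Injective fun r : ℤ => 2 * r + 1 := fun a b h => by simp only at h; lia
  rw [thetaSeries, ← hinj.tsum_eq, jacobiTheta₂, ← tsum_mul_left]
  · refine tsum_congr fun r => ?_
    have hr : oddInd (2 * r + 1) = 1 := oddInd_of_odd (by lia)
    rw [hr, Int.cast_one, one_mul, jacobiTheta₂_term, e, e, ← Complex.exp_add]
    push_cast; ring_nf
  · intro n hn
    have : n % 2 = 1 := by
      by_contra h; exact hn (by simp only [oddInd, if_neg h]; simp)
    exact ⟨n / 2, by simp only; lia⟩

/-- The finite Fourier expansion of the even character modulo 12: on odd `n` it is the value of `2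
cos(πn/6)`, divided by `√3`. -/
lemma chi12_eq_sum_e (n : ℤ) : (√3 : ℝ) * (chi12 n : ℂ) = oddInd n * e (n / 12) + oddInd n * e (-n / 12) := by
  have hu : e (1 / 12) = (√3 : ℝ) / 2 + 1 / 2 * Complex.I := by
    rw [e, show 2 * Real.pi * Complex.I * (1 / 12) = ((Real.pi / 6 : ℝ) : ℂ) * Complex.I by push_cast; ring,
      Complex.exp_mul_I, ← Complex.ofReal_cos, ← Complex.ofReal_sin, Real.cos_pi_div_six,
      Real.sin_pi_div_six]
    push_cast; ring
  have hv : e (-1 / 12) = (√3 : ℝ) / 2 - 1 / 2 * Complex.I := by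
    rw [e, show 2 * Real.pi * Complex.I * (-1 / 12) = ((-(Real.pi / 6) : ℝ) : ℂ) * Complex.I by
      push_cast; ring, Complex.exp_mul_I, ← Complex.ofReal_cos, ← Complex.ofReal_sin, Real.cos_neg,
      Real.sin_neg, Real.cos_pi_div_six, Real.sin_pi_div_six]
    push_cast; ring
  have h3 : e (3 / 12) = Complex.I := by rw [← e_quarter]; norm_num
  have h3' : e (-3 / 12) = -Complex.I := by
    rw [show (-3 / 12 : ℂ) = -(1 / 4) by norm_num, e_neg, e_quarter, Complex.inv_I]
  have h6 : ∀ x : ℂ, e (x + 6 / 12) = -e x := fun x => by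
    rw [e_add, show (6 / 12 : ℂ) = 1 / 2 by norm_num, e_half]; ring
  have hred : ∀ {r k : ℤ}, n = 12 * k + r → e (n / 12) = e (r / 12) ∧ e (-n / 12) = e (-r / 12) := by
    rintro r k rfl
    constructor
    · rw [← e_add_int (r / 12) k]; push_cast; ring_nf
    · rw [← e_add_int (-r / 12) (-k)]; push_cast; ring_nf
  by_cases hn : n % 2 = 1
  swap
  · rw [chi12_of_even (by lia), oddInd, if_neg hn]; simp
  rw [oddInd_of_odd hn]
  have h : n % 12 = 1 ∨ n % 12 = 3 ∨ n % 12 = 5 ∨ n % 12 = 7 ∨ n % 12 = 9 ∨ n % 12 = 11 := by lia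
  rcases h with h | h | h | h | h | h
  · obtain ⟨a, b⟩ := hred (r := 1) (k := n / 12) (by lia)
    rw [a, b, chi12, if_pos (by lia)]
    push_cast; rw [hu, hv]; ring
  · obtain ⟨a, b⟩ := hred (r := 3) (k := n / 12) (by lia)
    rw [a, b, chi12, if_neg (by lia), if_neg (by lia)]
    push_cast; rw [h3, h3']; ring
  · obtain ⟨a, b⟩ := hred (r := 5) (k := n / 12) (by lia)
    rw [a, b, chi12, if_neg (by lia), if_pos (by lia)]
    have a' := h6 (-1 / 12)
    have b' := h6 (-5 / 12)
    norm_num at a' b'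
    norm_num at hu hv
    push_cast; norm_num
    rw [a', ← neg_eq_iff_eq_neg.2 b', hu, hv]; ring
  · obtain ⟨a, b⟩ := hred (r := -5) (k := n / 12 + 1) (by lia)
    rw [a, b, chi12, if_neg (by lia), if_pos (by lia)]
    have a' := h6 (-1 / 12)
    have b' := h6 (-5 / 12)
    norm_num at a' b'
    norm_num at hu hv
    push_cast; norm_num
    rw [a', ← neg_eq_iff_eq_neg.2 b', hu, hv]; ring
  · obtain ⟨a, b⟩ := hred (r := -3) (k := n / 12 + 1) (by lia)
    rw [a, b, chi12, if_neg (by lia), if_neg (by lia)]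
    push_cast; rw [neg_neg, h3, h3']; ring
  · obtain ⟨a, b⟩ := hred (r := -1) (k := n / 12 + 1) (by lia)
    rw [a, b, chi12, if_pos (by lia)]
    push_cast; rw [neg_neg, hu, hv]; ring

lemma sqrt_three_mul_thetaSeries_chi12 (x : ℂ) {w : ℂ} (hw : 0 < w.im) :
    (√3 : ℝ) * thetaSeries chi12 x w =
      thetaSeries oddInd (x + 1 / 12) w + thetaSeries oddInd (x - 1 / 12) w := by
  rw [thetaSeries, thetaSeries, thetaSeries, ← tsum_mul_left,
    ← (summable_thetaSeries abs_oddInd_le _ hw).tsum_add (summable_thetaSeries abs_oddInd_le _ hw)]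
  refine tsum_congr fun n => ?_
  rw [← mul_assoc, chi12_eq_sum_e, add_mul, mul_assoc, mul_assoc, ← e_add, ← e_add]
  ring_nf

/-- The character is supported on the classes `±1` modulo 6, on each of which it alternates; each
class is a shifted Jacobi theta function. -/
lemma thetaSeries_chi12 (z : ℂ) {τ : ℂ} (hτ : 0 < τ.im) : thetaSeries chi12 (z / 2) (τ / 24) =
    e (z / 2 + τ / 24) * jacobiTheta₂ (3 * z + τ / 2 + 1 / 2) (3 * τ) +
    e (-z / 2 + τ / 24) * jacobiTheta₂ (3 * z - τ / 2 + 1 / 2) (3 * τ) := by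
  have hs := summable_thetaSeries abs_chi12_le (z / 2) (w := τ / 24) (by simpa using hτ)
  let g (n : ℤ) : ℂ := (chi12 n : ℂ) * e (n * (z / 2) + n ^ 2 * (τ / 24))
  have hg : g = fun n => {n : ℤ | n % 6 = 1}.indicator g n + {n : ℤ | n % 6 = 5}.indicator g n := by
    funext n
    by_cases h1 : n % 6 = 1
    · simp [h1]
    by_cases h5 : n % 6 = 5
    · simp [h5]
    have : chi12 n = 0 := by unfold chi12; grind
    simp [g, this, h1, h5]
  have i1 : Function.Injective fun r : ℤ => 6 * r + 1 := fun a b h => by simp only at h; lia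
  have i5 : Function.Injective fun r : ℤ => 6 * r - 1 := fun a b h => by simp only at h; lia
  change ∑' n, g n = _
  rw [hg, Summable.tsum_add (Summable.indicator hs _) (Summable.indicator hs _)]
  congr 1
  · rw [← i1.tsum_eq, jacobiTheta₂, ← tsum_mul_left]
    · refine tsum_congr fun r => ?_
      rw [Set.indicator_of_mem (show 6 * r + 1 ∈ {n : ℤ | n % 6 = 1} by simp only [Set.mem_ofPred_eq]; lia)]
      have hr : (chi12 (6 * r + 1) : ℂ) = e (r / 2) := by
        rw [e_int_div_two, neg_one_zpow_eq, Int.cast_inj]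
        unfold chi12; grind
      rw [hr, ← e_add, jacobiTheta₂_term, e, e, ← Complex.exp_add]
      push_cast; ring_nf
    · intro n hn
      have : n % 6 = 1 := by by_contra h; simp [h] at hn
      exact ⟨n / 6, by simp only; lia⟩
  · rw [← i5.tsum_eq, jacobiTheta₂, ← tsum_mul_left]
    · refine tsum_congr fun r => ?_
      rw [Set.indicator_of_mem (show 6 * r - 1 ∈ {n : ℤ | n % 6 = 5} by simp only [Set.mem_ofPred_eq]; lia)]
      have hr : (chi12 (6 * r - 1) : ℂ) = e (r / 2) := by
        rw [e_int_div_two, neg_one_zpow_eq, Int.cast_inj]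
        unfold chi12; grind
      rw [hr, ← e_add, jacobiTheta₂_term, e, e, ← Complex.exp_add]
      push_cast; ring_nf
    · intro n hn
      have : n % 6 = 5 := by by_contra h; simp [h] at hn
      exact ⟨n / 6 + 1, by simp only; lia⟩

section

variable {τ : ℂ}

lemma thetaSeries_altEven_S (z : ℂ) (hτ : τ ≠ 0) : thetaSeries altEven (z / τ / 2) (-1 / τ / 8) =
    sqrtNegI τ * e (z ^ 2 / (2 * τ)) * thetaSeries oddInd (z / 2) (τ / 8) := by
  rw [thetaSeries_altEven, thetaSeries_oddInd, show z / τ + 1 / 2 = (z + τ / 2) / τ by field_simp,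
    jacobiTheta₂_S _ hτ, show (z + τ / 2) ^ 2 / (2 * τ) = z ^ 2 / (2 * τ) + (z / 2 + τ / 8) by
      field_simp; ring, e_add]
  ring

lemma thetaSeries_oddInd_S (z : ℂ) (hτ : τ ≠ 0) : thetaSeries oddInd (z / τ / 2) (-1 / τ / 8) =
    sqrtNegI τ * e (z ^ 2 / (2 * τ)) * thetaSeries altEven (z / 2) (τ / 8) := by
  rw [thetaSeries_altEven, thetaSeries_oddInd, show z / τ + -1 / τ / 2 = (z - 1 / 2) / τ by
      field_simp; ring, jacobiTheta₂_S _ hτ,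
    show z + 1 / 2 = z - 1 / 2 + 1 by ring, jacobiTheta₂_add_left]
  have : e (z / τ / 2 + -1 / τ / 8) * e ((z - 1 / 2) ^ 2 / (2 * τ)) = e (z ^ 2 / (2 * τ)) := by
    rw [← e_add]; congr 1; field_simp; ring
  rw [← this]; ring

/-- The character modulo 12 is self-dual. Its Fourier expansion gives two odd theta series shifted
by `±1/12`; inverting these at `3τ` gives exactly the two residue-class pieces of
`thetaSeries_chi12`, and `√(3τ)` supplies the `√3` that cancels. -/
lemma thetaSeries_chi12_S (z : ℂ) (hτ : 0 < τ.im) : thetaSeries chi12 (z / τ / 2) (-1 / τ / 24) =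
    sqrtNegI τ * e (3 * z ^ 2 / (2 * τ)) * thetaSeries chi12 (z / 2) (τ / 24) := by
  have h0 : τ ≠ 0 := by rintro rfl; simp at hτ
  have h30 : 3 * τ ≠ 0 := mul_ne_zero (by norm_num) h0
  have h3 : ((√3 : ℝ) : ℂ) ≠ 0 := by
    rw [Complex.ofReal_ne_zero]; positivity
  have him : 0 < (-1 / τ / 24).im := by
    have : 0 < (-τ⁻¹).im := by
      rw [Complex.neg_im, Complex.inv_im, neg_div, neg_neg]
      exact div_pos hτ (Complex.normSq_pos.2 h0)
    have h24 : -1 / τ / 24 = ((1 / 24 : ℝ) : ℂ) * -τ⁻¹ := by push_cast; field_simp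
    rw [h24, Complex.im_ofReal_mul]
    positivity
  apply mul_left_cancel₀ h3
  rw [sqrt_three_mul_thetaSeries_chi12 _ him, thetaSeries_chi12 z hτ,
    show z / τ / 2 + 1 / 12 = (3 * z + τ / 2) / (3 * τ) / 2 by field_simp; ring,
    show z / τ / 2 - 1 / 12 = (3 * z - τ / 2) / (3 * τ) / 2 by field_simp; ring,
    show -1 / τ / 24 = -1 / (3 * τ) / 8 by field_simp; ring,
    thetaSeries_oddInd_S _ h30, thetaSeries_oddInd_S _ h30, thetaSeries_altEven, thetaSeries_altEven,
    sqrtNegI_three_mul h0,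
    show (3 * z + τ / 2) ^ 2 / (2 * (3 * τ)) = 3 * z ^ 2 / (2 * τ) + (z / 2 + τ / 24) by
      field_simp; ring,
    show (3 * z - τ / 2) ^ 2 / (2 * (3 * τ)) = 3 * z ^ 2 / (2 * τ) + (-z / 2 + τ / 24) by
      field_simp; ring, e_add, e_add (3 * z ^ 2 / (2 * τ))]
  ring

end

end EtaTwentySix

/-! ### Transformation of twelfth moments along isotropic lines -/

namespace EtaTwentySix

section

variable {c d c' d' : ℤ → ℤ} {w v w' v' : ℂ}

/-- The twelfth moment of the linear form `n μ + m ν` with respect to a pair of theta series. -/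
noncomputable def pairMoment (c d : ℤ → ℤ) (μ ν w v : ℂ) : ℂ :=
  ∑' p : ℤ × ℤ, (c p.1 * d p.2 : ℂ) * e (p.1 ^ 2 * w + p.2 ^ 2 * v) * (p.1 * μ + p.2 * ν) ^ 12

lemma pairMoment_mul (k μ ν : ℂ) : pairMoment c d (k * μ) (k * ν) w v = k ^ 12 * pairMoment c d μ ν w v := by
  rw [pairMoment, pairMoment, ← tsum_mul_left]
  refine tsum_congr fun p => ?_
  ring

lemma RapidDecay.const_mul {ι : Type*} {c α β : ι → ℂ} (h : RapidDecay c α β) (k : ℂ) :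
    RapidDecay (fun i => k * c i) α β := fun R => by
  simpa only [norm_mul, mul_assoc] using (h R).mul_left ‖k‖

lemma Dz_iterate_thetaSeries_mul (hc : ∀ n, |c n| ≤ 1) (hd : ∀ n, |d n| ≤ 1) (hw : 0 < w.im) (hv : 0 < v.im)
    (k μ ν : ℂ) :
    Dz^[12] (fun t => k * (thetaSeries c (μ * t) w * thetaSeries d (ν * t) v)) 0 =
      k * pairMoment c d μ ν w v := by
  have h : RapidDecay (fun p : ℤ × ℤ => (c p.1 * d p.2 : ℂ) * e (p.1 ^ 2 * w + p.2 ^ 2 * v))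
      (fun p => p.1 * μ + p.2 * ν) (fun _ => 0) := by
    refine rapidDecay_gaussian (κ := fun p => (c p.1 * d p.2 : ℂ)) (fun p => ?_) hw hv (M := ‖μ‖ + ‖ν‖)
      fun p => ?_
    · rw [norm_mul]
      exact mul_le_one₀ (norm_intCast_le_one (hc _)) (norm_nonneg _) (norm_intCast_le_one (hd _))
    · have := norm_add_le ((p.1 : ℂ) * μ) (p.2 * ν)
      rw [norm_mul, norm_mul, Complex.norm_intCast, Complex.norm_intCast] at this
      rw [norm_zero, add_zero]
      push_cast
      nlinarith [norm_nonneg μ, norm_nonneg ν, abs_nonneg (p.1 : ℝ), abs_nonneg (p.2 : ℝ)]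
  have hf : (fun t => k * (thetaSeries c (μ * t) w * thetaSeries d (ν * t) v)) =
      expSeries (fun p : ℤ × ℤ => k * ((c p.1 * d p.2) * e (p.1 ^ 2 * w + p.2 ^ 2 * v)))
      (fun p => p.1 * μ + p.2 * ν) (fun _ => 0) := by
    funext t
    rw [thetaSeries_mul hc hd _ _ hw hv, expSeries, ← tsum_mul_left]
    refine tsum_congr fun p => ?_
    rw [pairTerm, e_add, show (p.1 : ℂ) * (μ * t) + p.2 * (ν * t) =
      (p.1 * μ + p.2 * ν) * t + 0 * (starRingEnd ℂ) t by ring]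
    ring
  rw [hf, ((h.const_mul k).Dz_iterate 12).2, expSeries_zero, pairMoment, ← tsum_mul_left]
  refine tsum_congr fun p => ?_
  ring

/-- An identity between products of theta series along a line `t ↦ (μ t, ν t)` is differentiated
twelve times at `t = 0`. The products are holomorphic in `t`, so their conjugate frequencies are
zero. -/
lemma pairMoment_eq_of_thetaSeries (hc : ∀ n, |c n| ≤ 1) (hd : ∀ n, |d n| ≤ 1) (hc' : ∀ n, |c' n| ≤ 1)
    (hd' : ∀ n, |d' n| ≤ 1) (hw : 0 < w.im) (hv : 0 < v.im) (hw' : 0 < w'.im) (hv' : 0 < v'.im)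
    {k μ ν μ' ν' : ℂ} (h : ∀ t, thetaSeries c (μ * t) w * thetaSeries d (ν * t) v =
      k * (thetaSeries c' (μ' * t) w' * thetaSeries d' (ν' * t) v')) :
    pairMoment c d μ ν w v = k * pairMoment c' d' μ' ν' w' v' := by
  have h1 := Dz_iterate_thetaSeries_mul hc hd hw hv 1 μ ν
  have hf : (fun t => 1 * (thetaSeries c (μ * t) w * thetaSeries d (ν * t) v)) =
      fun t => k * (thetaSeries c' (μ' * t) w' * thetaSeries d' (ν' * t) v') := by
    funext t
    rw [one_mul, h]
  rw [hf, Dz_iterate_thetaSeries_mul hc' hd' hw' hv', one_mul] at h1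
  exact h1.symm

end

section

variable {τ : ℂ}

lemma neg_one_div_im_pos (hτ : 0 < τ.im) : 0 < (-1 / τ).im := by
  rw [show -1 / τ = -τ⁻¹ by ring, Complex.neg_im, Complex.inv_im, neg_div, neg_neg]
  exact div_pos hτ (Complex.normSq_pos.2 (by rintro rfl; simp at hτ))

/-- The two inversion factors multiply to `e(2 τ t² (3μ² + ν²))`, which is 1 on an isotropic line.
What remains is `-iτ` from the two square roots and `τ¹²` from rescaling the linear form. -/
lemma pairMoment_chi12_altEven_S (hτ : 0 < τ.im) {μ ν : ℂ} (h : 3 * μ ^ 2 + ν ^ 2 = 0) :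
    pairMoment chi12 altEven μ ν (-1 / τ / 24) (-1 / τ / 8) =
      -Complex.I * τ * τ ^ 12 * pairMoment chi12 oddInd μ ν (τ / 24) (τ / 8) := by
  have h0 : τ ≠ 0 := by rintro rfl; simp at hτ
  have hS := neg_one_div_im_pos hτ
  rw [mul_assoc, ← pairMoment_mul]
  refine pairMoment_eq_of_thetaSeries abs_chi12_le abs_altEven_le abs_chi12_le abs_oddInd_le
    (by simpa using hS) (by simpa using hS) (by simpa using hτ) (by simpa using hτ) fun t => ?_
  rw [show μ * t = (2 * μ * τ * t) / τ / 2 by field_simp, show ν * t = (2 * ν * τ * t) / τ / 2 by field_simp,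
    thetaSeries_chi12_S _ hτ, thetaSeries_altEven_S _ h0, ← sqrtNegI_sq τ,
    show τ * μ * t = 2 * μ * τ * t / 2 by ring, show τ * ν * t = 2 * ν * τ * t / 2 by ring]
  have he : e (3 * (2 * μ * τ * t) ^ 2 / (2 * τ)) * e ((2 * ν * τ * t) ^ 2 / (2 * τ)) = 1 := by
    rw [← e_add, ← e_zero]
    congr 1
    field_simp
    linear_combination 2 * τ * t ^ 2 * h
  linear_combination (sqrtNegI τ * sqrtNegI τ * thetaSeries chi12 (2 * μ * τ * t / 2) (τ / 24) *
    thetaSeries oddInd (2 * ν * τ * t / 2) (τ / 8)) * he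

/-- The same cancellation; both factors now carry the coefficient 3, so isotropy means `μ² + ν² =
0`. -/
lemma pairMoment_chi12_chi12_S (hτ : 0 < τ.im) {μ ν : ℂ} (h : μ ^ 2 + ν ^ 2 = 0) :
    pairMoment chi12 chi12 μ ν (-1 / τ / 24) (-1 / τ / 24) =
      -Complex.I * τ * τ ^ 12 * pairMoment chi12 chi12 μ ν (τ / 24) (τ / 24) := by
  have h0 : τ ≠ 0 := by rintro rfl; simp at hτ
  have hS := neg_one_div_im_pos hτ
  rw [mul_assoc, ← pairMoment_mul]
  refine pairMoment_eq_of_thetaSeries abs_chi12_le abs_chi12_le abs_chi12_le abs_chi12_le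
    (by simpa using hS) (by simpa using hS) (by simpa using hτ) (by simpa using hτ) fun t => ?_
  rw [show μ * t = (2 * μ * τ * t) / τ / 2 by field_simp, show ν * t = (2 * ν * τ * t) / τ / 2 by field_simp,
    thetaSeries_chi12_S _ hτ, thetaSeries_chi12_S _ hτ, ← sqrtNegI_sq τ,
    show τ * μ * t = 2 * μ * τ * t / 2 by ring, show τ * ν * t = 2 * ν * τ * t / 2 by ring]
  have he : e (3 * (2 * μ * τ * t) ^ 2 / (2 * τ)) * e (3 * (2 * ν * τ * t) ^ 2 / (2 * τ)) = 1 := by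
    rw [← e_add, ← e_zero]
    congr 1
    field_simp
    linear_combination 6 * τ * t ^ 2 * h
  linear_combination (sqrtNegI τ * sqrtNegI τ * thetaSeries chi12 (2 * μ * τ * t / 2) (τ / 24) *
    thetaSeries chi12 (2 * ν * τ * t / 2) (τ / 24)) * he

end

/-- The coefficients of the transform of the first sum under `τ ↦ -1 / τ`. -/
def coeffDual (p : ℤ × ℤ) : ℤ := chi12 p.1 * oddInd p.2

lemma abs_coeffDual_le (p : ℤ × ℤ) : |coeffDual p| ≤ 1 := abs_mul_le_one (abs_chi12_le _) (abs_oddInd_le _)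

lemma latticeSum_coeff1 (τ : ℂ) : latticeSum coeff1 √3 3 τ =
    pairMoment chi12 altEven 1 (-Complex.I * √3) (τ / 12) (τ / 4) := by
  refine tsum_congr fun p => ?_
  rw [coeff1, show (p.1 ^ 2 + (3 : ℕ) * p.2 ^ 2 : ℂ) / 12 * τ =
        p.1 ^ 2 * (τ / 12) + p.2 ^ 2 * (τ / 4) by push_cast; ring]
  push_cast; ring

lemma latticeSum_coeffDual (τ : ℂ) : latticeSum coeffDual √3 3 τ =
    pairMoment chi12 oddInd 1 (-Complex.I * √3) (τ / 12) (τ / 4) := by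
  refine tsum_congr fun p => ?_
  rw [coeffDual, show (p.1 ^ 2 + (3 : ℕ) * p.2 ^ 2 : ℂ) / 12 * τ =
        p.1 ^ 2 * (τ / 12) + p.2 ^ 2 * (τ / 4) by push_cast; ring]
  push_cast; ring

/-- In the coordinates `n + m`, `n - m` the form `n - i m` has coefficients `(1 ∓ i)/2`, whose
squares sum to zero. -/
lemma latticeSum_coeff3 (τ : ℂ) : latticeSum coeff3 1 1 τ =
    pairMoment chi12 chi12 ((1 - Complex.I) / 2) ((1 + Complex.I) / 2) (τ / 24) (τ / 24) := by
  have hi : Function.Injective fun p : ℤ × ℤ => (p.1 + p.2, p.1 - p.2) := fun p q h => by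
    simp only [Prod.mk.injEq] at h; ext <;> lia
  rw [pairMoment, ← hi.tsum_eq]
  · refine tsum_congr fun p => ?_
    rw [coeff3, show (p.1 ^ 2 + (1 : ℕ) * p.2 ^ 2 : ℂ) / 12 * τ =
        ((p.1 + p.2 : ℤ) : ℂ) ^ 2 * (τ / 24) + ((p.1 - p.2 : ℤ) : ℂ) ^ 2 * (τ / 24) by push_cast; ring]
    push_cast; ring
  · rintro ⟨n, m⟩ h
    have hn : n % 2 = 1 := by
      by_contra h'; exact h (by simp [chi12_of_even (show n % 2 = 0 by lia)])
    have hm : m % 2 = 1 := by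
      by_contra h'; exact h (by simp [chi12_of_even (show m % 2 = 0 by lia)])
    exact ⟨((n + m) / 2, (n - m) / 2), by ext <;> simp only <;> lia⟩

lemma latticeSum_coeff3_S {τ : ℂ} (hτ : 0 < τ.im) :
    latticeSum coeff3 1 1 (-1 / τ) = -Complex.I * τ ^ 13 * latticeSum coeff3 1 1 τ := by
  rw [latticeSum_coeff3, latticeSum_coeff3, pairMoment_chi12_chi12_S hτ]
  · ring
  · linear_combination Complex.I_sq / 2

/-- The exponents `τ/12`, `τ/4` are `2τ/24`, `2τ/8`, so inversion is applied at `τ/2`. This produces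
the factor `2⁻¹³` and the argument `τ/4`. -/
lemma latticeSum_coeff1_S_dual {τ : ℂ} (hτ : 0 < τ.im) : latticeSum coeff1 √3 3 (-1 / τ) =
    -Complex.I * τ ^ 13 / 2 ^ 13 * latticeSum coeffDual √3 3 (τ / 4) := by
  have h3 : ((√3 : ℝ) : ℂ) ^ 2 = 3 := by
    rw [← Complex.ofReal_pow, Real.sq_sqrt (by norm_num)]; simp
  have := pairMoment_chi12_altEven_S (τ := τ / 2) (by simpa using hτ)
    (show 3 * 1 ^ 2 + (-Complex.I * √3) ^ 2 = 0 by linear_combination Complex.I ^ 2 * h3 + 3 * Complex.I_sq)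
  rw [latticeSum_coeff1, latticeSum_coeffDual, show -1 / τ / 12 = -1 / (τ / 2) / 24 by ring,
    show -1 / τ / 4 = -1 / (τ / 2) / 8 by ring, this, show τ / 4 / 12 = τ / 2 / 24 by ring,
    show τ / 4 / 4 = τ / 2 / 8 by ring]
  ring

end EtaTwentySix

/-! ### Hexagonal symmetry and the modular law -/

namespace EtaTwentySix

/-- The terms of `latticeSum`. -/
noncomputable def latticeTerm (κ : ℤ × ℤ → ℤ) (s : ℝ) (B : ℕ) (τ : ℂ) (p : ℤ × ℤ) : ℂ :=
  (κ p : ℂ) * (p.1 - Complex.I * s * p.2) ^ 12 * e ((p.1 ^ 2 + B * p.2 ^ 2) / 12 * τ)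

lemma summable_norm_latticeTerm {κ : ℤ × ℤ → ℤ} (hκ : ∀ p, |κ p| ≤ 1) (s : ℝ) {B : ℕ} (hB : 0 < B) {τ : ℂ}
    (hτ : 0 < τ.im) : Summable fun p => ‖latticeTerm κ s B τ p‖ := by
  have hB' : (0 : ℝ) < B := by exact_mod_cast hB
  have hw : 0 < (τ / 12).im := by simpa using hτ
  have hv : 0 < (((B / 12 : ℝ) : ℂ) * τ).im := by rw [Complex.im_ofReal_mul]; positivity
  have h : RapidDecay (fun p : ℤ × ℤ => (κ p : ℂ) * e (p.1 ^ 2 * (τ / 12) + p.2 ^ 2 * ((B / 12 : ℝ) * τ)))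
      (fun p => p.1 - Complex.I * s * p.2) (fun _ => 0) := by
    refine rapidDecay_gaussian (κ := fun p => (κ p : ℂ)) (fun p => norm_intCast_le_one (hκ p)) hw hv
      (M := 1 + |s|) fun p => ?_
    have := norm_sub_le (p.1 : ℂ) (Complex.I * s * p.2)
    rw [norm_mul, norm_mul, Complex.norm_intCast, Complex.norm_intCast, Complex.norm_I, Complex.norm_real,
      Real.norm_eq_abs] at this
    rw [norm_zero, add_zero]
    push_cast
    nlinarith [abs_nonneg s, abs_nonneg (p.1 : ℝ), abs_nonneg (p.2 : ℝ)]
  have := (h.Dz_iterate 12).1 0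
  simp only [zero_mul, Real.exp_zero, mul_one] at this
  refine this.congr fun p => ?_
  rw [latticeTerm, show (p.1 ^ 2 + B * p.2 ^ 2 : ℂ) / 12 * τ =
        p.1 ^ 2 * (τ / 12) + p.2 ^ 2 * ((B / 12 : ℝ) * τ) by push_cast; ring]
  congr 1
  ring

/-- Multiplication by a third root of unity on the hexagonal lattice. -/
def hexRot : ℤ × ℤ ≃ ℤ × ℤ where
  toFun p := (-p.2, p.1 - p.2)
  invFun p := (p.2 - p.1, -p.1)
  left_inv p := by ext <;> simp
  right_inv p := by ext <;> simp

/-- The terms `(2α)¹² q^(N(α) / 12)` for `α = x + ω y` in the hexagonal lattice. -/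
noncomputable def hexTerm (τ : ℂ) (p : ℤ × ℤ) : ℂ :=
  (2 * p.1 - p.2 + Complex.I * √3 * p.2) ^ 12 * e ((p.1 ^ 2 - p.1 * p.2 + p.2 ^ 2) / 12 * τ)

lemma ofReal_sqrt_three_sq : ((√3 : ℝ) : ℂ) ^ 2 = 3 := by
  rw [← Complex.ofReal_pow, Real.sq_sqrt (by norm_num)]; simp

lemma hexTerm_hexRot (τ : ℂ) (p : ℤ × ℤ) : hexTerm τ (hexRot p) = hexTerm τ p := by
  have hω : ((-1 + Complex.I * √3) / 2 : ℂ) ^ 3 = 1 := by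
    linear_combination (-3 / 8 * Complex.I ^ 2 + Complex.I ^ 3 * √3 / 8) * ofReal_sqrt_three_sq +
     (-9 / 8 + 3 / 8 * Complex.I * √3) * Complex.I_sq
  have h : (2 * (-p.2) - (p.1 - p.2) + Complex.I * √3 * (p.1 - p.2) : ℂ) =
      (-1 + Complex.I * √3) / 2 * (2 * p.1 - p.2 + Complex.I * √3 * p.2) := by
    linear_combination (-p.2 / 2 * Complex.I ^ 2 : ℂ) * ofReal_sqrt_three_sq - (3 / 2 * p.2 : ℂ) * Complex.I_sq
  simp only [hexTerm, hexRot, Equiv.coe_fn_mk]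
  push_cast
  rw [h, mul_pow, show (12 : ℕ) = 3 * 4 from rfl, pow_mul ((-1 + Complex.I * √3) / 2 : ℂ), hω, one_pow, one_mul]
  congr 3
  ring

/-- Reindexing by the rotation and its square gives three copies of the same sum, since `hexTerm` is
invariant; added together, they vanish termwise. -/
lemma tsum_mul_hexTerm_eq_zero {d : ℤ × ℤ → ℂ} {τ : ℂ} (hs : Summable fun p => d p * hexTerm τ p)
    (h : ∀ p, d p + d (hexRot p) + d (hexRot (hexRot p)) = 0) : ∑' p, d p * hexTerm τ p = 0 := by
  have e1 : (fun p => d (hexRot p) * hexTerm τ p) = (fun p => d p * hexTerm τ p) ∘ hexRot := by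
    funext p; simp [hexTerm_hexRot]
  have e2 : (fun p => d (hexRot (hexRot p)) * hexTerm τ p) =
      ((fun p => d p * hexTerm τ p) ∘ hexRot) ∘ hexRot := by
    funext p; simp [hexTerm_hexRot]
  have s1 := hexRot.summable_iff.2 hs
  have s2 := hexRot.summable_iff.2 s1
  have t1 := hexRot.tsum_eq (fun p => d p * hexTerm τ p)
  have t2 := hexRot.tsum_eq ((fun p => d p * hexTerm τ p) ∘ hexRot)
  have key : ∑' p, (d p * hexTerm τ p + ((fun p => d p * hexTerm τ p) ∘ hexRot) p +
      (((fun p => d p * hexTerm τ p) ∘ hexRot) ∘ hexRot) p) = 0 := by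
    rw [← e2, ← e1, ← tsum_zero (β := ℤ × ℤ)]
    refine tsum_congr fun p => ?_
    rw [← add_mul, ← add_mul, h, zero_mul]
  rw [(hs.add s1).tsum_add s2, hs.tsum_add s1] at key
  simp only [Function.comp_apply] at t1 t2 key
  rw [t2, t1] at key
  linear_combination key / 3

/-- The coefficients of the first sum in hexagonal coordinates. -/
def hexCoeff1 (p : ℤ × ℤ) : ℤ := if p.2 % 2 = 0 then coeff1 (p.1 - p.2 / 2, -(p.2 / 2)) else 0

/-- The coefficients `κ(2 x - y, -y)` in hexagonal coordinates. -/
def hexCoeff (κ : ℤ × ℤ → ℤ) (p : ℤ × ℤ) : ℤ := κ (2 * p.1 - p.2, -p.2)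

/-- Both sums are placed on the hexagonal lattice. The points `2α = n - i√3 m` with `n ≡ m` modulo 2
fill it entirely, which explains `τ/4`. The first sum lives on the sublattice where `y` is even,
with weight `(2(n - i√3 m))¹²`. The factor `2¹³` is this `2¹²` times the 2 in the orbit relation. -/
lemma latticeSum_eq_of_hexRot {κ : ℤ × ℤ → ℤ} (hκ : ∀ p, |κ p| ≤ 1) (hpar : ∀ p, κ p ≠ 0 → (p.1 - p.2) % 2 = 0)
    (h : ∀ p, hexCoeff κ p + hexCoeff κ (hexRot p) + hexCoeff κ (hexRot (hexRot p)) =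
      2 * (hexCoeff1 p + hexCoeff1 (hexRot p) + hexCoeff1 (hexRot (hexRot p)))) {τ : ℂ} (hτ : 0 < τ.im) :
    latticeSum κ √3 3 (τ / 4) = 2 ^ 13 * latticeSum coeff1 √3 3 τ := by
  have i1 : Function.Injective fun p : ℤ × ℤ => (2 * p.1 - p.2, -p.2) := fun p q h => by
    simp only [Prod.mk.injEq] at h; ext <;> lia
  have i2 : Function.Injective fun p : ℤ × ℤ => (p.1 - p.2, -2 * p.2) := fun p q h => by
    simp only [Prod.mk.injEq] at h; ext <;> lia
  have e1 : (fun p => (hexCoeff κ p : ℂ) * hexTerm τ p) =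
      latticeTerm κ √3 3 (τ / 4) ∘ fun p : ℤ × ℤ => (2 * p.1 - p.2, -p.2) := by
    funext p
    simp only [hexCoeff, hexTerm, latticeTerm, Function.comp_apply, mul_assoc]
    congr 2
    · congr 1; push_cast; ring
    · congr 1; push_cast; ring
  have e2 : (fun p => (hexCoeff1 p : ℂ) * hexTerm τ p) ∘ (fun p : ℤ × ℤ => (p.1 - p.2, -2 * p.2)) =
      fun p => 2 ^ 12 * latticeTerm coeff1 √3 3 τ p := by
    funext p
    simp only [hexCoeff1, hexTerm, latticeTerm, Function.comp_apply]
    rw [if_pos (by lia), show p.1 - p.2 - -2 * p.2 / 2 = p.1 by lia, show -(-2 * p.2 / 2) = p.2 by lia,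
      show (((p.1 - p.2 : ℤ) : ℂ) ^ 2 - (p.1 - p.2 : ℤ) * (-2 * p.2 : ℤ) + ((-2 * p.2 : ℤ) : ℂ) ^ 2) / 12 * τ =
        (p.1 ^ 2 + (3 : ℕ) * p.2 ^ 2) / 12 * τ by push_cast; ring,
      show (2 * (p.1 - p.2 : ℤ) - (-2 * p.2 : ℤ) + Complex.I * √3 * (-2 * p.2 : ℤ) : ℂ) =
        2 * (p.1 - Complex.I * √3 * p.2) by push_cast; ring]
    generalize (p.1 - Complex.I * √3 * p.2 : ℂ) = u
    ring
  have r1 : ∀ p ∈ Function.support (latticeTerm κ √3 3 (τ / 4)), p ∈ Set.range fun p : ℤ × ℤ => (2 * p.1 - p.2, -p.2) := by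
    rintro p hp
    have : (p.1 - p.2) % 2 = 0 := by
      refine hpar p fun h => hp ?_
      simp [latticeTerm, h]
    exact ⟨((p.1 - p.2) / 2, -p.2), by ext <;> simp only <;> lia⟩
  have r2 : Function.support (fun p => (hexCoeff1 p : ℂ) * hexTerm τ p) ⊆ Set.range fun p : ℤ × ℤ => (p.1 - p.2, -2 * p.2) := by
    rintro p hp
    have : p.2 % 2 = 0 := by
      by_contra h
      exact hp (by simp [hexCoeff1, h])
    exact ⟨(p.1 - p.2 / 2, -(p.2 / 2)), by ext <;> simp only <;> lia⟩
  have s1 : Summable fun p => (hexCoeff κ p : ℂ) * hexTerm τ p := by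
    rw [e1]
    exact (summable_norm_latticeTerm hκ √3 (B := 3) (by norm_num) (τ := τ / 4) (by simpa using hτ)).of_norm.comp_injective i1
  have s2 : Summable fun p => (hexCoeff1 p : ℂ) * hexTerm τ p := by
    rw [← i2.summable_iff (fun p hp => by by_contra h'; exact hp (r2 h')), e2]
    exact (summable_norm_latticeTerm abs_coeff1_le √3 (by norm_num) hτ).of_norm.mul_left _
  have t1 : latticeSum κ √3 3 (τ / 4) = ∑' p, (hexCoeff κ p : ℂ) * hexTerm τ p := by
    rw [e1]
    exact (i1.tsum_eq r1).symm
  have t2 : 2 ^ 12 * latticeSum coeff1 √3 3 τ = ∑' p, (hexCoeff1 p : ℂ) * hexTerm τ p := by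
    rw [← i2.tsum_eq r2, latticeSum, ← tsum_mul_left]
    exact (tsum_congr fun p => congrFun e2 p).symm
  have key := tsum_mul_hexTerm_eq_zero (d := fun p => hexCoeff κ p - 2 * hexCoeff1 p) (τ := τ)
    ((s1.sub (s2.mul_left 2)).congr fun p => by ring) fun p => by
      have := congrArg (Int.cast (R := ℂ)) (h p)
      push_cast at this
      linear_combination this
  have : ∑' p, ((hexCoeff κ p - 2 * hexCoeff1 p : ℂ) * hexTerm τ p) =
      ∑' p, ((hexCoeff κ p : ℂ) * hexTerm τ p - 2 * (hexCoeff1 p * hexTerm τ p)) :=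
    tsum_congr fun p => by ring
  rw [this, s1.tsum_sub (s2.mul_left 2), tsum_mul_left, ← t1, ← t2] at key
  linear_combination key

lemma chi12_congr {a b : ℤ} (h : a % 12 = b % 12) : chi12 a = chi12 b := by
  unfold chi12; rw [h]

lemma altEven_congr {a b : ℤ} (h : a % 4 = b % 4) : altEven a = altEven b := by
  unfold altEven; rw [h]

lemma oddInd_congr {a b : ℤ} (h : a % 2 = b % 2) : oddInd a = oddInd b := by
  unfold oddInd; rw [h]

lemma coeff1_congr {n m n' m' : ℤ} (hn : n % 12 = n' % 12) (hm : m % 12 = m' % 12) :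
    coeff1 (n, m) = coeff1 (n', m') := by
  rw [coeff1, coeff1, chi12_congr hn, altEven_congr (b := m') (by lia)]

lemma coeffDual_congr {n m n' m' : ℤ} (hn : n % 24 = n' % 24) (hm : m % 24 = m' % 24) :
    coeffDual (n, m) = coeffDual (n', m') := by
  rw [coeffDual, coeffDual, chi12_congr (b := n') (by lia), oddInd_congr (b := m') (by lia)]

lemma coeff2_congr {n m n' m' : ℤ} (hn : n % 24 = n' % 24) (hm : m % 24 = m' % 24) :
    coeff2 (n, m) = coeff2 (n', m') := by
  simp only [coeff2, chi12_congr (show n % 12 = n' % 12 by lia), Int.ModEq]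
  rw [show n % 8 = n' % 8 by lia, show m % 8 = m' % 8 by lia, show (-m) % 8 = (-m') % 8 by lia]
  congr

lemma hexCoeff1_congr {x y x' y' : ℤ} (hx : x % 24 = x' % 24) (hy : y % 24 = y' % 24) :
    hexCoeff1 (x, y) = hexCoeff1 (x', y') := by
  simp only [hexCoeff1]
  rw [show y % 2 = y' % 2 by lia]
  split_ifs
  · exact coeff1_congr (by lia) (by lia)
  · rfl

/-- Period 24 is needed because `hexCoeff1` halves `y`, and `y / 2` has to be known modulo 12. -/
lemma hexCoeff_relation {κ : ℤ × ℤ → ℤ}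
    (hκ : ∀ {n m n' m' : ℤ}, n % 24 = n' % 24 → m % 24 = m' % 24 → κ (n, m) = κ (n', m'))
    (h : ∀ x ∈ Finset.range 24, ∀ y ∈ Finset.range 24, ∀ p, p = ((x : ℤ), (y : ℤ)) →
      hexCoeff κ p + hexCoeff κ (hexRot p) + hexCoeff κ (hexRot (hexRot p)) =
      2 * (hexCoeff1 p + hexCoeff1 (hexRot p) + hexCoeff1 (hexRot (hexRot p)))) (p : ℤ × ℤ) :
    hexCoeff κ p + hexCoeff κ (hexRot p) + hexCoeff κ (hexRot (hexRot p)) =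
      2 * (hexCoeff1 p + hexCoeff1 (hexRot p) + hexCoeff1 (hexRot (hexRot p))) := by
  have := h (p.1 % 24).toNat (by rw [Finset.mem_range]; lia) (p.2 % 24).toNat (by rw [Finset.mem_range]; lia) _ rfl
  rw [Int.toNat_of_nonneg (by lia), Int.toNat_of_nonneg (by lia)] at this
  simp only [hexRot, Equiv.coe_fn_mk, hexCoeff] at this ⊢
  obtain ⟨x, y⟩ := p
  simp only at this ⊢
  convert this using 2
  · congr 1
    · exact hκ (by lia) (by lia)
    · exact hκ (by lia) (by lia)
  · exact hκ (by lia) (by lia)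
  · congr 1
    · congr 1
      · exact hexCoeff1_congr (by lia) (by lia)
      · exact hexCoeff1_congr (by lia) (by lia)
    · exact hexCoeff1_congr (by lia) (by lia)

lemma hexCoeff_coeffDual (p : ℤ × ℤ) :
    hexCoeff coeffDual p + hexCoeff coeffDual (hexRot p) + hexCoeff coeffDual (hexRot (hexRot p)) =
      2 * (hexCoeff1 p + hexCoeff1 (hexRot p) + hexCoeff1 (hexRot (hexRot p))) := by
  refine hexCoeff_relation coeffDual_congr ?_ p
  simp only [forall_eq]
  decide +kernel

lemma hexCoeff_coeff2 (p : ℤ × ℤ) :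
    hexCoeff coeff2 p + hexCoeff coeff2 (hexRot p) + hexCoeff coeff2 (hexRot (hexRot p)) =
      2 * (hexCoeff1 p + hexCoeff1 (hexRot p) + hexCoeff1 (hexRot (hexRot p))) := by
  refine hexCoeff_relation coeff2_congr ?_ p
  simp only [forall_eq]
  decide +kernel

lemma latticeSum_coeffDual_eq {τ : ℂ} (hτ : 0 < τ.im) :
    latticeSum coeffDual √3 3 (τ / 4) = 2 ^ 13 * latticeSum coeff1 √3 3 τ := by
  refine latticeSum_eq_of_hexRot abs_coeffDual_le (fun p h => ?_) hexCoeff_coeffDual hτ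
  by_contra h'
  apply h
  rw [coeffDual]
  by_cases hn : p.1 % 2 = 0
  · rw [chi12_of_even hn, zero_mul]
  · rw [oddInd, if_neg (by lia), mul_zero]

lemma latticeSum_coeff2_eq {τ : ℂ} (hτ : 0 < τ.im) :
    latticeSum coeff2 √3 3 (τ / 4) = 2 ^ 13 * latticeSum coeff1 √3 3 τ := by
  refine latticeSum_eq_of_hexRot abs_coeff2_le (fun p h => ?_) hexCoeff_coeff2 hτ
  by_contra h'
  apply h
  rw [coeff2, if_neg]
  rw [Int.ModEq, Int.ModEq]; lia

lemma latticeSum_coeff1_S {τ : ℂ} (hτ : 0 < τ.im) :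
    latticeSum coeff1 √3 3 (-1 / τ) = -Complex.I * τ ^ 13 * latticeSum coeff1 √3 3 τ := by
  rw [latticeSum_coeff1_S_dual hτ, latticeSum_coeffDual_eq hτ]
  ring

/-- The twelfth derivative of `φ₂₆` at the origin, up to a constant. -/
noncomputable def etaPowerSum (τ : ℂ) : ℂ := latticeSum coeff1 √3 3 τ - 1 / 2 * latticeSum coeff3 1 1 τ

lemma Dz_iterate_phi26_eq {τ : ℂ} (hτ : 0 < τ.im) :
    Dz^[12] (fun z => phi26 z τ) 0 = etaPowerSum τ / 12 ^ 12 := by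
  rw [Dz_iterate_phi26 hτ, latticeSum_coeff2_eq hτ, etaPowerSum]
  ring

lemma etaPowerSum_S {τ : ℂ} (hτ : 0 < τ.im) :
    etaPowerSum (-1 / τ) = -Complex.I * τ ^ 13 * etaPowerSum τ := by
  rw [etaPowerSum, etaPowerSum, latticeSum_coeff1_S hτ, latticeSum_coeff3_S hτ]
  ring

/-- All exponents that occur lie in `1/12 + ℤ`, so a translation multiplies every term by the same
root of unity. -/
lemma latticeSum_add_one {κ : ℤ × ℤ → ℤ} {s : ℝ} {B : ℕ}
    (h : ∀ p : ℤ × ℤ, κ p ≠ 0 → (p.1 ^ 2 + B * p.2 ^ 2) % 12 = 1) (τ : ℂ) :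
    latticeSum κ s B (τ + 1) = e (1 / 12) * latticeSum κ s B τ := by
  rw [latticeSum, latticeSum, ← tsum_mul_left]
  refine tsum_congr fun p => ?_
  by_cases hp : κ p = 0
  · simp [hp]
  obtain ⟨k, hk⟩ : ∃ k : ℤ, p.1 ^ 2 + B * p.2 ^ 2 = 1 + 12 * k := ⟨(p.1 ^ 2 + B * p.2 ^ 2) / 12, by
    have := h p hp; lia⟩
  have hk' : (p.1 ^ 2 + B * p.2 ^ 2 : ℂ) = 1 + 12 * k := by exact_mod_cast hk
  rw [hk', show (1 + 12 * k : ℂ) / 12 * (τ + 1) = 1 / 12 + (1 + 12 * k) / 12 * τ + k by ring, e_add_int, e_add]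
  ring

lemma quadForm_of_coeff1_ne_zero (p : ℤ × ℤ) (h : coeff1 p ≠ 0) : (p.1 ^ 2 + (3 : ℕ) * p.2 ^ 2) % 12 = 1 := by
  have hn : chi12 p.1 ≠ 0 := left_ne_zero_of_mul h
  have hm : altEven p.2 ≠ 0 := right_ne_zero_of_mul h
  have h1 : p.1 % 12 = 1 ∨ p.1 % 12 = 5 ∨ p.1 % 12 = 7 ∨ p.1 % 12 = 11 := by unfold chi12 at hn; grind
  have h2 : ∃ k, p.2 = 2 * k := ⟨p.2 / 2, by unfold altEven at hm; grind⟩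
  obtain ⟨k, hk⟩ := h2
  rw [hk, show ((3 : ℕ) : ℤ) * (2 * k) ^ 2 = 12 * k ^ 2 by push_cast; ring]
  rw [Int.add_mul_emod_self_left, sq, Int.mul_emod]
  rcases h1 with h | h | h | h <;> rw [h] <;> rfl

lemma quadForm_of_coeff3_ne_zero (p : ℤ × ℤ) (h : coeff3 p ≠ 0) : (p.1 ^ 2 + (1 : ℕ) * p.2 ^ 2) % 12 = 1 := by
  have hn : chi12 (p.1 + p.2) ≠ 0 := left_ne_zero_of_mul h
  have hm : chi12 (p.1 - p.2) ≠ 0 := right_ne_zero_of_mul h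
  have h1 : (p.1 + p.2) % 6 = 1 ∨ (p.1 + p.2) % 6 = 5 := by unfold chi12 at hn; grind
  have h2 : (p.1 - p.2) % 6 = 1 ∨ (p.1 - p.2) % 6 = 5 := by unfold chi12 at hm; grind
  obtain ⟨x, y⟩ := p
  obtain ⟨a, ha⟩ : ∃ a, x = 6 * a + x % 6 := ⟨x / 6, by lia⟩
  obtain ⟨b, hb⟩ : ∃ b, y = 6 * b + y % 6 := ⟨y / 6, by lia⟩
  simp only at h1 h2 ⊢
  have : (x % 6 = 0 ∧ (y % 6 = 1 ∨ y % 6 = 5)) ∨ (y % 6 = 0 ∧ (x % 6 = 1 ∨ x % 6 = 5)) ∨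
    (x % 6 = 3 ∧ (y % 6 = 2 ∨ y % 6 = 4)) ∨ (y % 6 = 3 ∧ (x % 6 = 2 ∨ x % 6 = 4)) := by lia
  rcases this with ⟨h3, h4 | h4⟩ | ⟨h4, h3 | h3⟩ | ⟨h3, h4 | h4⟩ | ⟨h4, h3 | h3⟩ <;>
  · rw [h3] at ha; rw [h4] at hb
    rw [ha, hb]
    ring_nf
    lia

lemma etaPowerSum_add_one (τ : ℂ) : etaPowerSum (τ + 1) = e (1 / 12) * etaPowerSum τ := by
  rw [etaPowerSum, etaPowerSum, latticeSum_add_one quadForm_of_coeff1_ne_zero,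
    latticeSum_add_one quadForm_of_coeff3_ne_zero]
  ring

end EtaTwentySix

/-! ### Holomorphy and leading terms at the cusp -/

namespace EtaTwentySix

lemma norm_e_real_mul (r : ℝ) (τ : ℂ) : ‖e (r * τ)‖ = Real.exp (-(2 * Real.pi * r) * τ.im) := by
  rw [norm_e, Complex.im_ofReal_mul]; ring_nf

lemma tendsto_e_real_mul {r : ℝ} (hr : 0 < r) :
    Tendsto (fun τ : ℂ => e (r * τ)) (comap Complex.im atTop) (𝓝 0) := by
  rw [tendsto_zero_iff_norm_tendsto_zero]
  simp only [norm_e_real_mul]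
  have h : Tendsto (fun y : ℝ => -(2 * Real.pi * r) * y) atTop atBot :=
    tendsto_id.const_mul_atTop_of_neg (by have := Real.pi_pos; have := mul_pos this hr; linarith)
  exact Real.tendsto_exp_atBot.comp (h.comp tendsto_comap)

section

variable {κ : ℤ × ℤ → ℤ} {s : ℝ} {B : ℕ}

/-- The exponents of `latticeSum`. -/
def quadForm (B : ℕ) (p : ℤ × ℤ) : ℤ := p.1 ^ 2 + B * p.2 ^ 2

lemma latticeTerm_eq (κ : ℤ × ℤ → ℤ) (s : ℝ) (B : ℕ) (τ : ℂ) (p : ℤ × ℤ) : latticeTerm κ s B τ p =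
    (κ p : ℂ) * (p.1 - Complex.I * s * p.2) ^ 12 * e ((quadForm B p / 12 : ℝ) * τ) := by
  rw [latticeTerm, quadForm]; push_cast; rfl

lemma norm_latticeTerm_le {σ τ : ℂ} (h : σ.im ≤ τ.im) (p : ℤ × ℤ) :
    ‖latticeTerm κ s B τ p‖ ≤ ‖latticeTerm κ s B σ p‖ := by
  rw [latticeTerm_eq, latticeTerm_eq, norm_mul, norm_mul _ (e _), norm_e_real_mul, norm_e_real_mul]
  refine mul_le_mul_of_nonneg_left (Real.exp_le_exp.2 ?_) (norm_nonneg _)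
  refine mul_le_mul_of_nonpos_left h (neg_nonpos.2 ?_)
  have : (0 : ℝ) ≤ quadForm B p := by rw [quadForm]; push_cast; positivity
  positivity

lemma differentiableOn_latticeSum (hκ : ∀ p, |κ p| ≤ 1) (hB : 0 < B) :
    DifferentiableOn ℂ (latticeSum κ s B) {τ | 0 < τ.im} := by
  intro τ hτ
  let U : Set ℂ := {σ | τ.im / 2 < σ.im}
  have hτ' : 0 < τ.im := hτ
  have hU : IsOpen U := isOpen_lt continuous_const Complex.continuous_im
  have hτU : τ ∈ U := half_lt_self hτ'
  have hs := summable_norm_latticeTerm hκ s hB (τ := (τ.im / 2 : ℝ) * Complex.I) (by simpa using hτ')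
  have := Complex.differentiableOn_tsum_of_summable_norm (F := fun p σ => latticeTerm κ s B σ p) hs
    (fun p => ?_) hU (fun p σ hσ => norm_latticeTerm_le (by
      rw [Complex.im_ofReal_mul, Complex.I_im, mul_one]; exact hσ.le) p)
  · exact (this.differentiableAt (hU.mem_nhds hτU)).differentiableWithinAt
  · exact ((differentiable_e.comp (by fun_prop)).const_mul _).differentiableOn

/-- Extracts a `q`-coefficient: `S` holds the terms of lower exponent that are removed, `T` those
with exponent exactly `k/12`. After multiplication by `q^(-k/12)` the terms of `T` are constant and
all later ones decay. -/
lemma tendsto_latticeSum (hκ : ∀ p, |κ p| ≤ 1) (hB : 0 < B) (S T : Finset (ℤ × ℤ)) {k : ℤ}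
    (hT : ∀ p, p ∈ T ↔ quadForm B p = k ∧ κ p ≠ 0)
    (hS : ∀ p, κ p ≠ 0 → p ∉ S → k ≤ quadForm B p) (hST : ∀ p ∈ S, quadForm B p < k) :
    Tendsto (fun τ => e (-(k / 12 : ℝ) * τ) * (latticeSum κ s B τ - ∑ p ∈ S, latticeTerm κ s B τ p))
      (comap Complex.im atTop) (𝓝 (∑ p ∈ T, (κ p : ℂ) * (p.1 - Complex.I * s * p.2) ^ 12)) := by
  let κ' : ℤ × ℤ → ℤ := fun p => if p ∈ S then 0 else κ p
  have hκ' (p) : |κ' p| ≤ 1 := by simp only [κ']; split_ifs <;> simp [hκ]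
  let g : ℤ × ℤ → ℂ := fun p => if p ∈ T then (κ p : ℂ) * (p.1 - Complex.I * s * p.2) ^ 12 else 0
  have hg : ∑' p, g p = ∑ p ∈ T, (κ p : ℂ) * (p.1 - Complex.I * s * p.2) ^ 12 := by
    rw [tsum_eq_sum (s := T) fun p hp => by simp [g, hp]]
    exact Finset.sum_congr rfl fun p hp => by simp [g, hp]
  have hI : (0 : ℝ) < Complex.I.im := by simp
  have hsum {τ : ℂ} (hτ : 0 < τ.im) : latticeSum κ s B τ - ∑ p ∈ S, latticeTerm κ s B τ p =
      ∑' p, latticeTerm κ' s B τ p := by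
    have h1 := (summable_norm_latticeTerm hκ s hB hτ).of_norm
    have h2 : ∑ p ∈ S, latticeTerm κ s B τ p = ∑' p, if p ∈ S then latticeTerm κ s B τ p else 0 := by
      rw [tsum_eq_sum (s := S) fun p hp => by simp [hp]]
      exact Finset.sum_congr rfl fun p hp => by simp [hp]
    have h3 : Summable fun p => if p ∈ S then latticeTerm κ s B τ p else 0 :=
      summable_of_ne_finset_zero (s := S) fun p hp => by simp [hp]
    rw [h2, latticeSum]
    refine (h1.tsum_sub h3).symm.trans (tsum_congr fun p => ?_)
    simp only [latticeTerm, κ']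
    split_ifs <;> simp
  let f : ℂ → ℤ × ℤ → ℂ := fun τ p => (κ' p : ℂ) * (p.1 - Complex.I * s * p.2) ^ 12 *
    e (((quadForm B p - k) / 12 : ℝ) * τ)
  have hf (τ p) : e (-(k / 12 : ℝ) * τ) * latticeTerm κ' s B τ p = f τ p := by
    rw [latticeTerm_eq, mul_left_comm, ← e_add]
    simp only [f]
    congr 2
    push_cast; ring
  have hpos (p) (hp : κ' p ≠ 0) : k ≤ quadForm B p := by
    by_cases h : p ∈ S
    · simp [κ', h] at hp
    · exact hS p (by simpa [κ', h] using hp) h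
  have key : Tendsto (fun τ => ∑' p, f τ p) (comap Complex.im atTop) (𝓝 (∑' p, g p)) := by
    -- The remaining exponents are nonnegative, so for `Im τ ≥ 1` every term is dominated by its
    -- value at `i`.
    refine tendsto_tsum_of_dominated_convergence (bound := fun p => ‖f Complex.I p‖) ?_ (fun p => ?_) ?_
    · simp only [← hf, norm_mul]
      exact (summable_norm_latticeTerm hκ' s hB hI).mul_left _
    · by_cases hp : κ' p = 0
      · have : g p = 0 := by
          by_cases h : p ∈ T
          · have h1 := (hT p).1 h
            by_cases h2 : p ∈ S
            · exact absurd h1.1 (hST p h2).ne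
            · exact absurd (by simpa [κ', h2] using hp) h1.2
          · simp [g, h]
        simp only [f, hp, this, Int.cast_zero, zero_mul]
        exact tendsto_const_nhds
      · have hpS : p ∉ S := fun h => hp (by simp [κ', h])
        have hpκ : κ' p = κ p := by simp [κ', hpS]
        rcases (hpos p hp).eq_or_lt with h | h
        · have hT' : p ∈ T := (hT p).2 ⟨h.symm, hpκ ▸ hp⟩
          simp only [f, g, hT', if_true, hpκ, h, sub_self, zero_div, Complex.ofReal_zero, zero_mul, e_zero, mul_one]
          exact tendsto_const_nhds
        · have hT' : p ∉ T := fun h' => h.ne' ((hT p).1 h').1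
          simp only [f, g, hT', if_false]
          rw [← mul_zero ((κ' p : ℂ) * (p.1 - Complex.I * s * p.2) ^ 12)]
          refine (tendsto_e_real_mul ?_).const_mul _
          have : (k : ℝ) < quadForm B p := by exact_mod_cast h
          linarith
    · filter_upwards [preimage_mem_comap (eventually_ge_atTop (1 : ℝ))] with τ hτ p
      by_cases hp : κ' p = 0
      · simp [f, hp]
      simp only [f]
      rw [norm_mul, norm_mul _ (e _), norm_e_real_mul, norm_e_real_mul]
      refine mul_le_mul_of_nonneg_left (Real.exp_le_exp.2 ?_) (norm_nonneg _)
      refine mul_le_mul_of_nonpos_left (by simpa using hτ) (neg_nonpos.2 ?_)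
      have : (k : ℝ) ≤ quadForm B p := by exact_mod_cast hpos p hp
      have := Real.pi_pos
      have : 0 ≤ ((quadForm B p - k) / 12 : ℝ) := by linarith
      positivity
  rw [hg] at key
  refine key.congr' ?_
  filter_upwards [preimage_mem_comap (eventually_gt_atTop (0 : ℝ))] with τ hτ
  rw [hsum hτ, ← tsum_mul_left]
  exact tsum_congr fun p => (hf τ p).symm

end

lemma differentiableOn_etaPowerSum : DifferentiableOn ℂ etaPowerSum {τ | 0 < τ.im} :=
  (differentiableOn_latticeSum abs_coeff1_le (by norm_num)).sub
    ((differentiableOn_latticeSum abs_coeff3_le (by norm_num)).const_mul _)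

/-- Confines the points relevant up to exponent 13 to a finite box, where supports are decided by
enumeration. -/
lemma mem_box_of_quadForm_lt {B : ℕ} (hB : 0 < B) {p : ℤ × ℤ} (h : quadForm B p < 16) :
    (p.1 = -3 ∨ p.1 = -2 ∨ p.1 = -1 ∨ p.1 = 0 ∨ p.1 = 1 ∨ p.1 = 2 ∨ p.1 = 3) ∧
      (p.2 = -3 ∨ p.2 = -2 ∨ p.2 = -1 ∨ p.2 = 0 ∨ p.2 = 1 ∨ p.2 = 2 ∨ p.2 = 3) := by
  rw [quadForm] at h
  have hB' : (1 : ℤ) ≤ B := by exact_mod_cast hB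
  have h1 : p.1 ^ 2 < 4 ^ 2 := by nlinarith [sq_nonneg p.2]
  have h2 : p.2 ^ 2 < 4 ^ 2 := by nlinarith [sq_nonneg p.1, sq_nonneg p.2]
  have h3 := abs_lt_of_sq_lt_sq h1 (by norm_num)
  have h4 := abs_lt_of_sq_lt_sq h2 (by norm_num)
  rw [abs_lt] at h3 h4
  lia

lemma mem_coeff1_iff (p : ℤ × ℤ) : p ∈ ({(1, 2), (1, -2), (-1, 2), (-1, -2)} : Finset (ℤ × ℤ)) ↔
    quadForm 3 p = 13 ∧ coeff1 p ≠ 0 := by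
  constructor
  · revert p; decide
  · rintro ⟨h, h'⟩
    have := mem_box_of_quadForm_lt (B := 3) (by norm_num) (p := p) (by lia)
    obtain ⟨x, y⟩ := p
    simp only at this
    rcases this with ⟨rfl | rfl | rfl | rfl | rfl | rfl | rfl, rfl | rfl | rfl | rfl | rfl | rfl | rfl⟩ <;>
    revert h h' <;> decide

lemma mem_coeff3_iff (p : ℤ × ℤ) :
    p ∈ ({(3, 2), (3, -2), (-3, 2), (-3, -2), (2, 3), (2, -3), (-2, 3), (-2, -3)} : Finset (ℤ × ℤ)) ↔
    quadForm 1 p = 13 ∧ coeff3 p ≠ 0 := by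
  constructor
  · revert p; decide
  · rintro ⟨h, h'⟩
    have := mem_box_of_quadForm_lt (B := 1) (by norm_num) (p := p) (by lia)
    obtain ⟨x, y⟩ := p
    simp only at this
    rcases this with ⟨rfl | rfl | rfl | rfl | rfl | rfl | rfl, rfl | rfl | rfl | rfl | rfl | rfl | rfl⟩ <;>
    revert h h' <;> decide

lemma thirteen_le_quadForm_coeff1 (p : ℤ × ℤ) (h : coeff1 p ≠ 0)
    (hp : p ∉ ({(1, 0), (-1, 0)} : Finset (ℤ × ℤ))) : 13 ≤ quadForm 3 p := by
  by_contra h'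
  have := mem_box_of_quadForm_lt (B := 3) (by norm_num) (p := p) (by lia)
  obtain ⟨x, y⟩ := p
  simp only at this
  rcases this with ⟨rfl | rfl | rfl | rfl | rfl | rfl | rfl, rfl | rfl | rfl | rfl | rfl | rfl | rfl⟩ <;>
  revert h h' hp <;> decide

lemma thirteen_le_quadForm_coeff3 (p : ℤ × ℤ) (h : coeff3 p ≠ 0)
    (hp : p ∉ ({(1, 0), (-1, 0), (0, 1), (0, -1)} : Finset (ℤ × ℤ))) : 13 ≤ quadForm 1 p := by
  by_contra h'
  have := mem_box_of_quadForm_lt (B := 1) (by norm_num) (p := p) (by lia)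
  obtain ⟨x, y⟩ := p
  simp only at this
  rcases this with ⟨rfl | rfl | rfl | rfl | rfl | rfl | rfl, rfl | rfl | rfl | rfl | rfl | rfl | rfl⟩ <;>
  revert h h' hp <;> decide

lemma pow_twelve_add_pow_twelve {w t : ℂ} (h : w ^ 2 = t) (a b : ℂ) : (a - w * b) ^ 12 + (a + w * b) ^ 12 =
    2 * (a ^ 12 + 66 * a ^ 10 * b ^ 2 * t + 495 * a ^ 8 * b ^ 4 * t ^ 2 + 924 * a ^ 6 * b ^ 6 * t ^ 3 +
      495 * a ^ 4 * b ^ 8 * t ^ 4 + 66 * a ^ 2 * b ^ 10 * t ^ 5 + b ^ 12 * t ^ 6) := by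
  subst h; ring

/-- The points `(±1, 0)` give `2 q^(1/12)`. The four points `(±1, ±2)` have coefficient `-1`, and
the limit is `-4 Re (1 + 2i√3)¹²`. -/
lemma tendsto_latticeSum_coeff1 :
    Tendsto (fun τ => e (-(13 / 12) * τ) * (latticeSum coeff1 √3 3 τ - 2 * e (τ / 12)))
      (comap Complex.im atTop) (𝓝 18795164) := by
  have h := tendsto_latticeSum (s := √3) abs_coeff1_le (B := 3) (by norm_num) _ _ mem_coeff1_iff
    thirteen_le_quadForm_coeff1 (by decide)
  have hw : (Complex.I * √3) ^ 2 = -3 := by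
    linear_combination Complex.I ^ 2 * ofReal_sqrt_three_sq + 3 * Complex.I_sq
  have h1 := pow_twelve_add_pow_twelve hw 1 2
  have h2 := pow_twelve_add_pow_twelve hw (-1) 2
  have hT : ∀ p ∈ ({(1, 2), (1, -2), (-1, 2), (-1, -2)} : Finset (ℤ × ℤ)),
      (coeff1 p : ℂ) * (p.1 - Complex.I * √3 * p.2) ^ 12 = -(p.1 - Complex.I * √3 * p.2) ^ 12 := by
    intro p hp
    have : coeff1 p = -1 := by revert p; decide
    rw [this]; push_cast; ring
  have hS : ∀ p ∈ ({(1, 0), (-1, 0)} : Finset (ℤ × ℤ)), ∀ τ, latticeTerm coeff1 √3 3 τ p = e (τ / 12) := by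
    intro p hp τ
    have h1 : coeff1 p = 1 := by revert p; decide
    have h2 : p.1 ^ 12 = 1 ∧ p.1 ^ 2 = 1 ∧ p.2 = 0 := by revert p; decide
    have h3 : (p.1 : ℂ) ^ 12 = 1 := by exact_mod_cast h2.1
    have h4 : (p.1 : ℂ) ^ 2 = 1 := by exact_mod_cast h2.2.1
    rw [latticeTerm, h1, h2.2.2]
    simp only [Int.cast_zero, mul_zero, sub_zero, h3, h4, Int.cast_one, one_mul]
    congr 1; ring
  rw [Finset.sum_congr rfl hT, Finset.sum_insert (by decide), Finset.sum_insert (by decide),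
    Finset.sum_insert (by decide), Finset.sum_singleton] at h
  convert h using 2
  · rename_i τ
    rw [Finset.sum_congr rfl fun p hp => hS p hp τ, Finset.sum_const,
      show Finset.card ({(1, 0), (-1, 0)} : Finset (ℤ × ℤ)) = 2 from rfl]
    push_cast
    simp
  · push_cast
    linear_combination h1 + h2

/-- The four units of `ℤ[i]` give `4 q^(1/12)`. The eight Gaussian integers of norm 13 have
coefficient `-1`, and the limit is `-8 Re (3 + 2i)¹²`. -/
lemma tendsto_latticeSum_coeff3 :
    Tendsto (fun τ => e (-(13 / 12) * τ) * (latticeSum coeff3 1 1 τ - 4 * e (τ / 12)))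
      (comap Complex.im atTop) (𝓝 (-27645128)) := by
  have h := tendsto_latticeSum (s := 1) abs_coeff3_le (B := 1) (by norm_num) _ _ mem_coeff3_iff
    thirteen_le_quadForm_coeff3 (by decide)
  have h1 := pow_twelve_add_pow_twelve Complex.I_sq 3 2
  have h2 := pow_twelve_add_pow_twelve Complex.I_sq (-3) 2
  have h3 := pow_twelve_add_pow_twelve Complex.I_sq 2 3
  have h4 := pow_twelve_add_pow_twelve Complex.I_sq (-2) 3
  have hT : ∀ p ∈ ({(3, 2), (3, -2), (-3, 2), (-3, -2), (2, 3), (2, -3), (-2, 3), (-2, -3)} : Finset (ℤ × ℤ)),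
      (coeff3 p : ℂ) * (p.1 - Complex.I * (1 : ℝ) * p.2) ^ 12 = -(p.1 - Complex.I * p.2) ^ 12 := by
    intro p hp
    have : coeff3 p = -1 := by revert p; decide
    rw [this]; push_cast; ring
  have hS : ∀ p ∈ ({(1, 0), (-1, 0), (0, 1), (0, -1)} : Finset (ℤ × ℤ)), ∀ τ,
      latticeTerm coeff3 1 1 τ p = e (τ / 12) := by
    intro p hp τ
    have h1 : coeff3 p = 1 := by revert p; decide
    have h2 : p.1 ^ 2 + p.2 ^ 2 = 1 ∧ p.1 * p.2 = 0 := by revert p; decide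
    have h3 : (p.1 : ℂ) ^ 2 + p.2 ^ 2 = 1 := by exact_mod_cast h2.1
    have h4 : (p.1 : ℂ) * p.2 = 0 := by exact_mod_cast h2.2
    -- Each of these points is a unit of `ℤ[i]`, so its twelfth power is 1.
    have h5 : (p.1 - Complex.I * p.2 : ℂ) ^ 4 = 1 := by
      linear_combination (p.1 ^ 2 + p.2 ^ 2 + 1 : ℂ) * h3 + (-4 * Complex.I * p.1 ^ 2 +
        6 * Complex.I ^ 2 * p.1 * p.2 - 4 * Complex.I ^ 3 * p.2 ^ 2 - 2 * p.1 * p.2 : ℂ) * h4 +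
        (p.2 : ℂ) ^ 4 * (Complex.I ^ 2 - 1) * Complex.I_sq
    rw [latticeTerm, h1, Complex.ofReal_one, mul_one, show (12 : ℕ) = 4 * 3 from rfl, pow_mul, h5,
      Nat.cast_one, one_mul, h3, Int.cast_one, one_pow, one_mul, one_mul]
    congr 1; ring
  rw [Finset.sum_congr rfl hT, Finset.sum_insert (by decide), Finset.sum_insert (by decide),
    Finset.sum_insert (by decide), Finset.sum_insert (by decide), Finset.sum_insert (by decide),
    Finset.sum_insert (by decide), Finset.sum_insert (by decide), Finset.sum_singleton] at h
  convert h using 2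
  · rename_i τ
    rw [Finset.sum_congr rfl fun p hp => hS p hp τ, Finset.sum_const,
      show Finset.card ({(1, 0), (-1, 0), (0, 1), (0, -1)} : Finset (ℤ × ℤ)) = 4 from rfl]
    push_cast
    simp
  · push_cast
    linear_combination h1 + h2 + h3 + h4

/-- The `q^(1/12)` terms cancel, as `2 - 4/2 = 0`; subtraction of half the second limit gives the
constant. -/
lemma tendsto_etaPowerSum : Tendsto (fun τ => e (-(13 / 12) * τ) * etaPowerSum τ)
    (comap Complex.im atTop) (𝓝 (2 ^ 8 * 3 ^ 4 * 11 ^ 2 * 13)) := by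
  have := tendsto_latticeSum_coeff1.sub (tendsto_latticeSum_coeff3.const_mul (1 / 2))
  norm_num at this ⊢
  refine this.congr fun τ => ?_
  rw [etaPowerSum]; ring

end EtaTwentySix

/-! ### Comparison with the 26th power of η -/

namespace EtaTwentySix
lemma e_tendsto : Tendsto e (comap Complex.im atTop) (𝓝 0) := by
  simpa using tendsto_e_real_mul one_pos

lemma tendsto_tprod_one_sub_e_pow :
    Tendsto (fun τ => ∏' n : ℕ, (1 - e τ ^ (n + 1))) (comap Complex.im atTop) (𝓝 1) := by
  have h := (ModularForm.differentiableOn_tprod_one_sub_pow.differentiableAt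
    (Metric.ball_mem_nhds 0 one_pos)).continuousAt.tendsto
  simp only [ne_eq, Nat.add_eq_zero_iff, one_ne_zero, and_false, not_false_eq_true, zero_pow, sub_zero, tprod_one] at h
  exact h.comp e_tendsto

lemma tendsto_eta_pow : Tendsto (fun τ => e (-(13 / 12) * τ) * ModularForm.eta τ ^ 26)
    (comap Complex.im atTop) (𝓝 1) := by
  have h := tendsto_tprod_one_sub_e_pow.pow 26
  rw [one_pow] at h
  refine h.congr fun τ => ?_
  rw [eta_eq, mul_pow, ← mul_assoc, ← e_nat_mul, ← e_add,
    show -(13 / 12) * τ + ((26 : ℕ) : ℂ) * (τ / 24) = 0 by push_cast; ring, e_zero, one_mul]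

/-- The even exponent 26 removes the square roots in the law of `η`, and the multiplier becomes
`i⁻¹³ = -i`. -/
lemma eta_pow_S {τ : ℂ} (hτ : 0 < τ.im) :
    ModularForm.eta (-1 / τ) ^ 26 = -Complex.I * τ ^ 13 * ModularForm.eta τ ^ 26 := by
  have h : ModularForm.eta (-1 / τ) = (Complex.sqrt Complex.I)⁻¹ * (Complex.sqrt τ * ModularForm.eta τ) :=
    ModularForm.eta_comp_eq_csqrt_I_inv hτ
  have hs (z : ℂ) : Complex.sqrt z ^ 26 = z ^ 13 := by
    rw [show 26 = 2 * 13 from rfl, pow_mul]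
    congr 1
    rw [Complex.sqrt]
    simp
  rw [h, mul_pow, mul_pow, inv_pow, hs, hs, show (Complex.I) ^ 13 = Complex.I by
    rw [show 13 = 4 * 3 + 1 from rfl, pow_succ, pow_mul, Complex.I_pow_four]; simp, Complex.inv_I]
  ring

lemma eta_pow_add_one (τ : ℂ) : ModularForm.eta (τ + 1) ^ 26 = e (1 / 12) * ModularForm.eta τ ^ 26 := by
  have h1 : e (τ + 1) = e τ := by simpa using e_add_int τ 1
  rw [eta_eq, eta_eq, h1, mul_pow, mul_pow, ← e_nat_mul, ← e_nat_mul, ← mul_assoc, ← e_add]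
  congr 1
  have := e_add_int (1 / 12 + ((26 : ℕ) : ℂ) * (τ / 24)) 1
  rw [← this]
  congr 1
  push_cast; ring

open UpperHalfPlane hiding I
open MatrixGroups ModularForm

/-- The quotient of `etaPowerSum` by `η²⁶` on the upper half plane. -/
noncomputable def etaQuotient (τ : ℍ) : ℂ := etaPowerSum τ / ModularForm.eta τ ^ 26

lemma etaQuotient_T : etaQuotient ∣[(0 : ℤ)] ModularGroup.T = etaQuotient := by
  ext τ
  rw [SL_slash_apply, modular_T_smul]
  simp only [neg_zero, zpow_zero, mul_one, etaQuotient, coe_vadd, Complex.ofReal_one]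
  rw [add_comm, etaPowerSum_add_one, eta_pow_add_one, mul_div_mul_left _ _ (e_ne_zero _)]

lemma etaQuotient_S : etaQuotient ∣[(0 : ℤ)] ModularGroup.S = etaQuotient := by
  ext τ
  have h : ((ModularGroup.S • τ : ℍ) : ℂ) = -1 / τ := by
    rw [modular_S_smul]; simp [neg_div]
  have h0 : -Complex.I * (τ : ℂ) ^ 13 ≠ 0 :=
    mul_ne_zero (neg_ne_zero.2 Complex.I_ne_zero) (pow_ne_zero _ τ.ne_zero)
  rw [SL_slash_apply]
  simp only [neg_zero, zpow_zero, mul_one, etaQuotient]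
  rw [h, etaPowerSum_S τ.im_pos, eta_pow_S τ.im_pos, mul_div_mul_left _ _ h0]

lemma tendsto_etaQuotient : Tendsto etaQuotient atImInfty (𝓝 (2 ^ 8 * 3 ^ 4 * 11 ^ 2 * 13)) := by
  have h := tendsto_etaPowerSum.div tendsto_eta_pow one_ne_zero
  rw [div_one] at h
  have hc : Tendsto (fun τ : ℍ => (τ : ℂ)) atImInfty (comap Complex.im atTop) :=
    tendsto_comap_iff.2 tendsto_comap
  refine (h.comp hc).congr fun τ => ?_
  exact mul_div_mul_left _ _ (e_ne_zero _)

/-- The quotient of `etaPowerSum` by `η²⁶` as a modular form of weight zero. -/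
noncomputable def etaQuotientForm : ModularForm 𝒮ℒ 0 where
  toFun := etaQuotient
  slash_action_eq' A hA := by
    obtain ⟨A, rfl⟩ := hA
    exact SlashInvariantForm.slash_action_generators_SL2Z etaQuotient_S etaQuotient_T A
  holo' := by
    rw [UpperHalfPlane.mdifferentiable_iff]
    refine (differentiableOn_etaPowerSum.div (fun z hz =>
      ((differentiableAt_eta_of_mem_upperHalfPlaneSet hz).pow 26).differentiableWithinAt)
      fun z hz => pow_ne_zero _ (eta_ne_zero hz)).congr fun z hz => ?_
    simp [etaQuotient, ofComplex_apply_of_im_pos hz]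
  -- By invariance under the generators, every cusp reduces to `i∞`, where the quotient has a finite
  -- limit.
  bdd_at_cusps' hc := by
    rw [Subgroup.IsArithmetic.isCusp_iff_isCusp_SL2Z] at hc
    rw [OnePoint.isBoundedAt_iff_forall_SL2Z hc]
    intro γ _
    rw [SlashInvariantForm.slash_action_generators_SL2Z etaQuotient_S etaQuotient_T]
    exact tendsto_etaQuotient.isBigO_one ℝ

/-- A level one form of weight zero is constant, and the limit at the cusp identifies the constant.
-/
lemma etaPowerSum_eq (τ : ℍ) :
    etaPowerSum τ = 2 ^ 8 * 3 ^ 4 * 11 ^ 2 * 13 * ModularForm.eta τ ^ 26 := by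
  obtain ⟨c, hc⟩ := ModularFormClass.levelOne_weight_zero_const etaQuotientForm
  have hc' : etaQuotient = Function.const _ c := hc
  have hlim := tendsto_etaQuotient
  rw [hc'] at hlim
  have h : etaQuotient τ = 2 ^ 8 * 3 ^ 4 * 11 ^ 2 * 13 := by
    rw [hc']; exact tendsto_nhds_unique tendsto_const_nhds hlim
  rw [← h, etaQuotient, div_mul_cancel₀]
  exact pow_ne_zero _ (eta_ne_zero τ.im_pos)

end EtaTwentySix

open EtaTwentySix in
theorem theorem1p3 (τ : UpperHalfPlane) :
    -- the four series defining `φ₂₆` converge absolutely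
    (∀ x y : ℝ, Summable (term1 x y τ) ∧ Summable (term2 x y τ) ∧
      Summable (term3 x y τ) ∧ Summable (term4 x y τ)) ∧
    -- the expression through Jacobi theta functions
    (∀ (z : ℂ) (z₁ z₂ z₃ z₄ : ℝ), z = z₁ + Complex.I * z₂ →
      z = (z₃ + Complex.I * (√3 : ℝ) * z₄) / 2 →
      phi26 z τ =
        1 / 2 * thetaStar (z₃ / 6) (2 * τ) * theta4 (z₄ / 2) (2 * τ)
        + 1 / 8 * thetaStar (z₃ / 12) (τ / 2) * theta2 (z₄ / 4) (τ / 2)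
        + 1 / 16 * (thetaStar (z₃ / 12 + 1 / 4) (τ / 2) * theta2 (z₄ / 4 - 1 / 4) (τ / 2)
          + theta2Star (z₃ / 12 + 1 / 4) (τ / 2) * theta (z₄ / 4 - 1 / 4) (τ / 2))
        + 1 / 16 * (thetaStar (z₃ / 12 + 1 / 4) (τ / 2) * theta2 (z₄ / 4 + 1 / 4) (τ / 2)
          - theta2Star (z₃ / 12 + 1 / 4) (τ / 2) * theta (z₄ / 4 + 1 / 4) (τ / 2))
        - 1 / 2 * thetaStar ((z₁ + z₂) / 6) τ * thetaStar ((z₁ - z₂) / 6) τ) ∧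
    -- the specialization to the 26th power of the Dedekind eta function
    ContDiff ℝ ∞ (fun z : ℂ => phi26 z τ) ∧
    Dz^[12] (fun z : ℂ => phi26 z τ) 0 =
      2 ^ 8 * 3 ^ 4 * 11 ^ 2 * 13 / 12 ^ 12 * ModularForm.eta τ ^ 26 := by
  refine ⟨summable_terms τ.im_pos, fun z z₁ z₂ z₃ z₄ h h' => phi26_eq_theta τ.im_pos z z₁ z₂ z₃ z₄ h h',
    contDiff_phi26 τ.im_pos, ?_⟩
  rw [Dz_iterate_phi26_eq τ.im_pos, etaPowerSum_eq, mul_div_right_comm]
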